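/- Let $C$ and $D$ be compact connected Riemann surfaces (equivalently, smooth projective complex curves) of genus at least $2$, and let $G$ be a finite group acting by holomorphic automorphisms on $C$ and on $D$ such that the diagonal action of $G$ on $C\times D$ is free. Let $S=(C\times D)/G$ be the quotient complex surface (a surface isogenous to a higher product, of unmixed type), with quotient map $\pi:C\times D\to S$. Let $G$ act on the singular cohomology of $C$ and $D$ through its action on the curves, put $$U=\bigl(H^2(C,\mathbb{Q})\otimes H^0(D,\mathbb{Q})\bigr)\oplus\bigl(H^0(C,\mathbb{Q})\otimes H^2(D,\mathbb{Q})\bigr),\qquad Z=\bigl(H^1(C,\mathbb{Q})\otimes H^1(D,\mathbb{Q})\bigr)^G ,$$ where $G$ acts diagonally on the tensor product, and let $\kappa:U\oplus Z\to H^2(C\times D,\mathbb{Q})$ be the linear map given on each summand by the cross product $a\otimes b\mapsto \mathrm{pr}_1^*a\cup \mathrm{pr}_2^*b$. Then $\dim_{\mathbb{Q}}U=2$, and there is an isomorphism of $\mathbb{Q}$-vector spaces $$e: H^2(S,\mathbb{Q})\xrightarrow{\ \cong\ } U\oplus Z$$ which is the natural one, in the sense that $\pi^*x=\kappa(e(x))$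 for all $x\in H^2(S,\mathbb{Q})$. -/

import Mathlib

open CategoryTheory Opposite
open scoped Manifold ContDiff TensorProduct

universe u v

/-! ### Singular cohomology with rational coefficients -/

namespace RatCohomology

/-- Rational `n`-cochains of a simplicial set. -/
abbrev Cochain (K : SSet.{u}) (n : ℕ) : Type u := K.obj (op (SimplexCategory.mk n)) → ℚ

/-- The coboundary `(d f) σ = ∑ i, (-1)^i f (∂ᵢ σ)`. -/
def coboundary (K : SSet.{u}) (n : ℕ) : Cochain K n →ₗ[ℚ] Cochain K (n + 1) where
  toFun f σ := ∑ i : Fin (n + 2), (-1 : ℚ) ^ (i : ℕ) * f (K.map (SimplexCategory.δ i).op σ)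
  map_add' f g := by
    funext σ
    simp [mul_add, Finset.sum_add_distrib]
  map_smul' r f := by
    funext σ
    simp only [Pi.smul_apply, smul_eq_mul, RingHom.id_apply, Finset.mul_sum]
    exact Finset.sum_congr rfl fun i _ => by ring

/-- The `n`-cocycles. -/
def cocycles (K : SSet.{u}) (n : ℕ) : Submodule ℚ (Cochain K n) := LinearMap.ker (coboundary K n)

/-- The `n`-coboundaries. -/
def coboundaries (K : SSet.{u}) : (n : ℕ) → Submodule ℚ (Cochain K n)
  | 0 => ⊥
  | n + 1 => LinearMap.range (coboundary K n)

/-- The cohomology `Zⁿ / Bⁿ` of a simplicial set with rational coefficients. -/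
abbrev SCohomology (K : SSet.{u}) (n : ℕ) : Type u :=
  cocycles K n ⧸ (coboundaries K n).submoduleOf (cocycles K n)

theorem mem_cocycles {K : SSet.{u}} {n : ℕ} {f : Cochain K n} :
    f ∈ cocycles K n ↔ coboundary K n f = 0 := Iff.rfl

theorem map_map {K : SSet.{u}} {a b c : SimplexCategory} (f : a ⟶ b) (g : b ⟶ c)
    (σ : K.obj (op c)) : K.map f.op (K.map g.op σ) = K.map (f ≫ g).op σ := by
  simp

/-- The square of the coboundary is zero. -/
theorem coboundary_coboundary (K : SSet.{u}) (n : ℕ) (f : Cochain K n) :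
    coboundary K (n + 1) (coboundary K n f) = 0 := by
  funext σ
  simp only [coboundary, LinearMap.coe_mk, AddHom.coe_mk, Pi.zero_apply, Finset.mul_sum, map_map]
  rw [← Finset.sum_product', Finset.univ_product_univ]
  refine Finset.sum_involution
    (fun x _ => if h : (x.1 : ℕ) ≤ x.2 then (x.2.succ, ⟨x.1, by omega⟩)
      else (⟨x.2, by omega⟩, x.1.pred (fun h0 => h (le_of_eq_of_le (congrArg Fin.val h0) (Nat.zero_le _))))) ?_ ?_ ?_ ?_
  · rintro ⟨i, j⟩ -
    by_cases h : (i : ℕ) ≤ j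
    · have e := SimplexCategory.δ_comp_δ'' (i := i) (j := j) h
      simp only [h, dite_true]
      rw [← e, Fin.val_succ, pow_succ]
      simp only [Fin.castLT]
      ring
    · have hne : i ≠ 0 := by rintro rfl; simp at h
      have e := SimplexCategory.δ_comp_δ' (i := j) (j := i) (by simpa [Fin.lt_def] using h)
      simp only [h, dite_false]
      rw [e]
      have hi : (-1 : ℚ) ^ (i : ℕ) = - (-1 : ℚ) ^ ((i.pred hne : Fin _) : ℕ) := by
        conv_lhs => rw [← Fin.succ_pred i hne, Fin.val_succ, pow_succ]
        ring
      rw [hi]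
      have : (⟨(j : ℕ), by omega⟩ : Fin (n + 3)) = j.castSucc := rfl
      rw [this]
      ring
  · rintro ⟨i, j⟩ - -
    by_cases h : (i : ℕ) ≤ j
    · simp only [h, dite_true, ne_eq, Prod.mk.injEq, not_and]
      intro h1
      have := congrArg Fin.val h1
      simp at this
      omega
    · simp only [h, dite_false, ne_eq, Prod.mk.injEq, not_and]
      intro h1
      have := congrArg Fin.val h1
      simp at this
      omega
  · intros
    exact Finset.mem_univ _
  · rintro ⟨i, j⟩ -
    by_cases h : (i : ℕ) ≤ j
    · have h2 : ¬ ((j : ℕ) + 1 ≤ i) := by omega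
      simp [h, h2]
    · have h2 : (j : ℕ) ≤ i - 1 := by omega
      simp [h, h2]

/-! #### Functoriality -/

/-- Pullback of cochains along a map of simplicial sets. -/
def cochainMap {K : SSet.{u}} {L : SSet.{u}} (F : K ⟶ L) (n : ℕ) :
    Cochain L n →ₗ[ℚ] Cochain K n where
  toFun f σ := f (F.app (op (SimplexCategory.mk n)) σ)
  map_add' _ _ := rfl
  map_smul' _ _ := rfl

theorem coboundary_cochainMap {K L : SSet.{u}} (F : K ⟶ L) (n : ℕ) (f : Cochain L n) :
    coboundary K n (cochainMap F n f) = cochainMap F (n + 1) (coboundary L n f) := by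
  funext σ
  simp only [coboundary, cochainMap, LinearMap.coe_mk, AddHom.coe_mk]
  exact Finset.sum_congr rfl fun i _ => by rw [NatTrans.naturality_apply]

theorem cochainMap_mem_coboundaries {K L : SSet.{u}} (F : K ⟶ L) {n : ℕ} {f : Cochain L n}
    (hf : f ∈ coboundaries L n) : cochainMap F n f ∈ coboundaries K n := by
  cases n with
  | zero =>
    have : f = 0 := hf
    rw [this, map_zero]
    exact zero_mem _
  | succ n =>
    obtain ⟨g, rfl⟩ := hf
    exact ⟨cochainMap F n g, coboundary_cochainMap F n g⟩

theorem cochainMap_mem_cocycles {K L : SSet.{u}} (F : K ⟶ L) {n : ℕ} {f : Cochain L n}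
    (hf : f ∈ cocycles L n) : cochainMap F n f ∈ cocycles K n := by
  rw [mem_cocycles] at hf ⊢
  rw [coboundary_cochainMap, hf, map_zero]

/-- The map induced in cohomology by a map of simplicial sets. -/
def sPullback {K L : SSet.{u}} (F : K ⟶ L) (n : ℕ) : SCohomology L n →ₗ[ℚ] SCohomology K n :=
  Submodule.mapQ _ _
    ((cochainMap F n).restrict fun _ hf => cochainMap_mem_cocycles F hf)
    fun _ hf => cochainMap_mem_coboundaries F hf

/-! #### Cup product -/

/-- The front `p`-face of an `n`-simplex, `i ↦ i`. -/
def front {p q n : ℕ} (h : p + q = n) : SimplexCategory.mk p ⟶ SimplexCategory.mk n :=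
  SimplexCategory.mkHom
    { toFun := fun i => ⟨i, by omega⟩
      monotone' := fun _ _ hij => hij }

/-- The back `q`-face of an `n`-simplex, `i ↦ p + i`. -/
def back {p q n : ℕ} (h : p + q = n) : SimplexCategory.mk q ⟶ SimplexCategory.mk n :=
  SimplexCategory.mkHom
    { toFun := fun i => ⟨p + i, by omega⟩
      monotone' := fun _ _ hij => Nat.add_le_add_left hij p }

/-- The cup product of cochains: `(f ∪ g) σ = f (front p-face of σ) * g (back q-face of σ)`. -/
def cochainCup (K : SSet.{u}) {p q n : ℕ} (h : p + q = n) :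
    Cochain K p →ₗ[ℚ] Cochain K q →ₗ[ℚ] Cochain K n :=
  LinearMap.mk₂ ℚ (fun f g σ => f (K.map (front h).op σ) * g (K.map (back h).op σ))
    (fun _ _ _ => funext fun _ => by simp [add_mul])
    (fun _ _ _ => funext fun _ => by simp [mul_assoc])
    (fun _ _ _ => funext fun _ => by simp [mul_add])
    (fun _ _ _ => funext fun _ => by simp [mul_left_comm])

theorem δ_val {n : ℕ} (j : Fin (n + 2)) (k : Fin (n + 1)) :
    (((SimplexCategory.δ j).toOrderHom k : Fin (n + 2)) : ℕ) =
      if (k : ℕ) < j then (k : ℕ) else k + 1 := by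
  change ((Fin.succAbove j k : Fin (n + 2)) : ℕ) = _
  rw [Fin.succAbove]
  simp only [Fin.lt_def, Fin.val_castSucc]
  split_ifs <;> rfl

theorem hom_ext_val {a b : ℕ} {f g : SimplexCategory.mk a ⟶ SimplexCategory.mk b}
    (h : ∀ k : Fin (a + 1), ((f.toOrderHom k : Fin (b + 1)) : ℕ) = (g.toOrderHom k : Fin (b + 1))) :
    f = g :=
  SimplexCategory.Hom.ext _ _ (OrderHom.ext _ _ (funext fun k => Fin.ext (h k)))

theorem front_δ_of_le {p q n : ℕ} (h : p + q = n) (h' : p + 1 + q = n + 1) (i : Fin (p + 2))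
    (j : Fin (n + 2)) (hij : (j : ℕ) = i) :
    front h ≫ SimplexCategory.δ j = SimplexCategory.δ i ≫ front h' := by
  refine hom_ext_val fun (k : Fin _) => ?_
  change (((SimplexCategory.δ j).toOrderHom (⟨k, by have := k.2; omega⟩ : Fin (n + 1)) : Fin (n + 2)) : ℕ) =
    (((SimplexCategory.δ i).toOrderHom k : Fin (p + 2)) : ℕ)
  rw [δ_val, δ_val, hij]

theorem back_δ_of_le {p q n : ℕ} (h : p + q = n) (h' : p + 1 + q = n + 1)
    (j : Fin (n + 2)) (hj : (j : ℕ) ≤ p) :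
    back h ≫ SimplexCategory.δ j = back h' := by
  refine hom_ext_val fun (k : Fin _) => ?_
  change (((SimplexCategory.δ j).toOrderHom (⟨p + k, by have := k.2; omega⟩ : Fin (n + 1)) : Fin (n + 2)) : ℕ) = p + 1 + k
  rw [δ_val]
  split_ifs with hk
  · simp at hk; omega
  · simp; omega

theorem front_δ_of_gt {p q n : ℕ} (h : p + q = n) (h' : p + (q + 1) = n + 1)
    (j : Fin (n + 2)) (hj : p < (j : ℕ)) :
    front h ≫ SimplexCategory.δ j = front h' := by
  refine hom_ext_val fun (k : Fin _) => ?_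
  change (((SimplexCategory.δ j).toOrderHom (⟨k, by have := k.2; omega⟩ : Fin (n + 1)) : Fin (n + 2)) : ℕ) = k
  rw [δ_val]
  split_ifs with hk
  · rfl
  · simp at hk; omega

theorem back_δ_of_gt {p q n : ℕ} (h : p + q = n) (h' : p + (q + 1) = n + 1) (i : Fin (q + 2))
    (j : Fin (n + 2)) (hij : (j : ℕ) = p + i) :
    back h ≫ SimplexCategory.δ j = SimplexCategory.δ i ≫ back h' := by
  refine hom_ext_val fun (k : Fin _) => ?_
  change (((SimplexCategory.δ j).toOrderHom (⟨p + k, by have := k.2; omega⟩ : Fin (n + 1)) : Fin (n + 2)) : ℕ) =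
    p + (((SimplexCategory.δ i).toOrderHom k : Fin (q + 2)) : ℕ)
  rw [δ_val, δ_val, hij]
  simp only [Nat.add_lt_add_iff_left]
  split_ifs <;> omega

theorem δ_last_front {p q n : ℕ} (h₁ : p + 1 + q = n + 1) (h₂ : p + (q + 1) = n + 1) :
    SimplexCategory.δ (Fin.last (p + 1)) ≫ front h₁ = front h₂ := by
  refine hom_ext_val fun (k : Fin _) => ?_
  change (((SimplexCategory.δ (Fin.last (p + 1))).toOrderHom k : Fin (p + 2)) : ℕ) = k
  rw [δ_val]
  exact if_pos k.2

theorem δ_zero_back {p q n : ℕ} (h₁ : p + 1 + q = n + 1) (h₂ : p + (q + 1) = n + 1) :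
    SimplexCategory.δ 0 ≫ back h₂ = back h₁ := by
  refine hom_ext_val fun (k : Fin _) => ?_
  change p + (((SimplexCategory.δ 0).toOrderHom k : Fin (q + 2)) : ℕ) = p + 1 + k
  rw [δ_val, if_neg (by simp)]
  omega

/-- The Leibniz rule `d (f ∪ g) = d f ∪ g + (-1)^p f ∪ d g`. -/
theorem coboundary_cochainCup (K : SSet.{u}) {p q n : ℕ} (h : p + q = n)
    (h₁ : p + 1 + q = n + 1) (h₂ : p + (q + 1) = n + 1) (f : Cochain K p) (g : Cochain K q) :
    coboundary K n (cochainCup K h f g) =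
      cochainCup K h₁ (coboundary K p f) g +
        (-1 : ℚ) ^ p • cochainCup K h₂ f (coboundary K q g) := by
  funext σ
  simp only [coboundary, cochainCup, LinearMap.coe_mk, AddHom.coe_mk, LinearMap.mk₂_apply,
    Pi.add_apply, Pi.smul_apply, smul_eq_mul, map_map]
  have hn : (p + 1) + (q + 1) = n + 2 := by omega
  rw [← (finCongr hn).sum_comp, Fin.sum_univ_add, Fin.sum_univ_castSucc (n := p + 1),
    Fin.sum_univ_succ (n := q + 1), δ_last_front h₁ h₂, δ_zero_back h₁ h₂]
  have e1 : ∀ i : Fin (p + 1),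
      f (K.map (front h ≫ SimplexCategory.δ (finCongr hn (Fin.castAdd (q + 1) i))).op σ) *
        g (K.map (back h ≫ SimplexCategory.δ (finCongr hn (Fin.castAdd (q + 1) i))).op σ) =
      f (K.map (SimplexCategory.δ i.castSucc ≫ front h₁).op σ) * g (K.map (back h₁).op σ) := by
    intro i
    rw [front_δ_of_le h h₁ i.castSucc _ (by simp), back_δ_of_le h h₁ _ (by simp; omega)]
  have e2 : ∀ i : Fin (q + 1),
      f (K.map (front h ≫ SimplexCategory.δ (finCongr hn (Fin.natAdd (p + 1) i))).op σ) *
        g (K.map (back h ≫ SimplexCategory.δ (finCongr hn (Fin.natAdd (p + 1) i))).op σ) =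
      f (K.map (front h₂).op σ) * g (K.map (SimplexCategory.δ i.succ ≫ back h₂).op σ) := by
    intro i
    rw [front_δ_of_gt h h₂ _ (by simp; omega), back_δ_of_gt h h₂ i.succ _ (by simp; omega)]
  simp only [e1, e2]
  simp only [add_mul, mul_add, Finset.sum_mul, Finset.mul_sum]
  simp only [finCongr_apply, Fin.val_cast, Fin.val_castAdd, Fin.val_natAdd, Fin.val_castSucc,
    Fin.val_succ, Fin.val_last, Fin.val_zero, pow_add, pow_one, pow_zero]
  have s1 : ∀ a b c d x y : ℚ, a = c → b = d → x = - y → a + b = (c + x) + (y + d) := by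
    intro a b c d x y h1 h2 h3
    rw [h1, h2, h3]
    ring
  refine s1 _ _ _ _ _ _ (Finset.sum_congr rfl fun i _ => by ring)
    (Finset.sum_congr rfl fun i _ => by ring) (by ring)

theorem cochainCup_mem_cocycles (K : SSet.{u}) {p q n : ℕ} (h : p + q = n) {f : Cochain K p}
    {g : Cochain K q} (hf : f ∈ cocycles K p) (hg : g ∈ cocycles K q) :
    cochainCup K h f g ∈ cocycles K n := by
  rw [mem_cocycles] at hf hg ⊢
  rw [coboundary_cochainCup K h (by omega) (by omega), hf, hg]
  simp

theorem cochainCup_mem_coboundaries_left (K : SSet.{u}) {p q n : ℕ} (h : p + q = n)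
    {f : Cochain K p} {g : Cochain K q} (hf : f ∈ coboundaries K p) (hg : g ∈ cocycles K q) :
    cochainCup K h f g ∈ coboundaries K n := by
  cases p with
  | zero =>
    have : f = 0 := hf
    simp [this]
  | succ p =>
    obtain ⟨f, rfl⟩ := hf
    obtain _ | n := n
    · omega
    refine ⟨cochainCup K (show p + q = n by omega) f g, ?_⟩
    rw [mem_cocycles] at hg
    rw [coboundary_cochainCup K _ h (by omega), hg]
    simp

theorem cochainCup_mem_coboundaries_right (K : SSet.{u}) {p q n : ℕ} (h : p + q = n)
    {f : Cochain K p} {g : Cochain K q} (hf : f ∈ cocycles K p) (hg : g ∈ coboundaries K q) :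
    cochainCup K h f g ∈ coboundaries K n := by
  cases q with
  | zero =>
    have : g = 0 := hg
    simp [this]
  | succ q =>
    obtain ⟨g, rfl⟩ := hg
    obtain _ | n := n
    · omega
    refine ⟨(-1 : ℚ) ^ p • cochainCup K (show p + q = n by omega) f g, ?_⟩
    rw [mem_cocycles] at hf
    rw [map_smul, coboundary_cochainCup K _ (by omega) h, hf]
    simp [smul_smul, ← mul_pow]

theorem mk_eq_zero {K : SSet.{u}} {n : ℕ} {f : cocycles K n}
    (hf : (f : Cochain K n) ∈ coboundaries K n) :
    (Submodule.Quotient.mk f : SCohomology K n) = 0 :=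
  (Submodule.Quotient.mk_eq_zero _).2 hf

/-- The class of the cup product of two cocycles. -/
def cocycleCup (K : SSet.{u}) {p q n : ℕ} (h : p + q = n) :
    cocycles K p →ₗ[ℚ] cocycles K q →ₗ[ℚ] SCohomology K n :=
  LinearMap.mk₂ ℚ
    (fun f g => Submodule.Quotient.mk ⟨cochainCup K h f g, cochainCup_mem_cocycles K h f.2 g.2⟩)
    (fun f f' g => by
      rw [← Submodule.Quotient.mk_add]
      congr 1
      exact Subtype.ext (by simp))
    (fun r f g => by
      rw [← Submodule.Quotient.mk_smul]
      congr 1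
      exact Subtype.ext (by simp))
    (fun f g g' => by
      rw [← Submodule.Quotient.mk_add]
      congr 1
      exact Subtype.ext (by simp))
    (fun r f g => by
      rw [← Submodule.Quotient.mk_smul]
      congr 1
      exact Subtype.ext (by simp))

/-- The cup product in cohomology, `[f] ∪ [g] = [f ∪ g]`. -/
def sCup (K : SSet.{u}) {p q n : ℕ} (h : p + q = n) :
    SCohomology K p →ₗ[ℚ] SCohomology K q →ₗ[ℚ] SCohomology K n :=
  Submodule.liftQ _
    { toFun := fun f => Submodule.liftQ _ (cocycleCup K h f) fun _ hg =>
        mk_eq_zero (cochainCup_mem_coboundaries_right K h f.2 hg)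
      map_add' := fun f f' => by
        ext g
        exact LinearMap.map_add₂ (cocycleCup K h) f f' g
      map_smul' := fun r f => by
        ext g
        exact LinearMap.map_smul₂ (cocycleCup K h) r f g }
    fun f hf => by
      ext g
      exact mk_eq_zero (cochainCup_mem_coboundaries_left K h hf g.2)

theorem sCup_mk_mk (K : SSet.{u}) {p q n : ℕ} (h : p + q = n) (f : cocycles K p)
    (g : cocycles K q) :
    sCup K h (Submodule.Quotient.mk f) (Submodule.Quotient.mk g) =
      Submodule.Quotient.mk ⟨cochainCup K h f g, cochainCup_mem_cocycles K h f.2 g.2⟩ := rfl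

theorem sPullback_mk {K L : SSet.{u}} (F : K ⟶ L) {n : ℕ} (f : cocycles L n) :
    sPullback F n (Submodule.Quotient.mk f) =
      Submodule.Quotient.mk ⟨cochainMap F n f, cochainMap_mem_cocycles F f.2⟩ := rfl

/-! #### Topological spaces -/

section Topological

variable {X Y W : Type u} [TopologicalSpace X] [TopologicalSpace Y] [TopologicalSpace W]

/-- The singular simplicial set of a topological space. -/
noncomputable abbrev singularSet (X : Type u) [TopologicalSpace X] : SSet.{u} :=
  TopCat.toSSet.obj (TopCat.of X)

/-- The singular cohomology `Hⁿ(X, ℚ)`. -/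
abbrev H (n : ℕ) (X : Type u) [TopologicalSpace X] : Type u := SCohomology (singularSet X) n

/-- The pullback `f^* : Hⁿ(Y, ℚ) → Hⁿ(X, ℚ)` along a continuous map `f : X → Y`. -/
noncomputable def pullback (n : ℕ) (f : C(X, Y)) : H n Y →ₗ[ℚ] H n X :=
  sPullback (TopCat.toSSet.map (TopCat.ofHom f)) n

theorem pullback_id (n : ℕ) : pullback n (ContinuousMap.id X) = LinearMap.id := by
  ext a
  simp only [pullback, LinearMap.comp_apply, Submodule.mkQ_apply, LinearMap.id_apply, sPullback_mk]
  congr 1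

theorem pullback_comp (n : ℕ) (g : C(Y, W)) (f : C(X, Y)) :
    pullback n (g.comp f) = pullback n f ∘ₗ pullback n g := by
  ext a
  simp only [pullback, LinearMap.comp_apply, Submodule.mkQ_apply, sPullback_mk]
  congr 1

/-- The cross product `Hᵖ(X, ℚ) ⊗ H^q(Y, ℚ) → Hⁿ(X × Y, ℚ)` for `p + q = n`,
`a ⊗ b ↦ pr₁^* a ∪ pr₂^* b`. -/
noncomputable def cross {p q n : ℕ} (h : p + q = n) : H p X ⊗[ℚ] H q Y →ₗ[ℚ] H n (X × Y) :=
  TensorProduct.lift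
    ((sCup (singularSet (X × Y)) h).compl₁₂ (pullback p ContinuousMap.fst)
      (pullback q ContinuousMap.snd))

/-- The left action of a group `G` acting on `X` by homeomorphisms on `Hⁿ(X, ℚ)`:
`g` acts as `(g⁻¹)^*`. -/
noncomputable def action (G : Type v) [Group G] (n : ℕ) (X : Type u) [TopologicalSpace X]
    [MulAction G X] [ContinuousConstSMul G X] : Representation ℚ G (H n X) where
  toFun g := pullback n ⟨fun x => g⁻¹ • x, continuous_const_smul _⟩
  map_one' := by
    have : (⟨fun x => (1 : G)⁻¹ • x, continuous_const_smul _⟩ : C(X, X)) = ContinuousMap.id X := by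
      ext x
      simp
    rw [this, pullback_id]
    rfl
  map_mul' g g' := by
    have : (⟨fun x => (g * g')⁻¹ • x, continuous_const_smul _⟩ : C(X, X)) =
        ContinuousMap.comp ⟨fun x => g'⁻¹ • x, continuous_const_smul _⟩
          ⟨fun x => g⁻¹ • x, continuous_const_smul _⟩ := by
      ext x
      simp [mul_smul]
    rw [this, pullback_comp]
    rfl

end Topological

end RatCohomology

/-! ### Surfaces isogenous to a product -/

namespace IsogenousToProduct

open RatCohomology

/-- The genus of a compact Riemann surface, i.e. half of its first Betti number. -/
noncomputable def genus (C : Type u) [TopologicalSpace C] : ℕ := Module.finrank ℚ (H 1 C) / 2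

/-- `U = (H²(C, ℚ) ⊗ H⁰(D, ℚ)) ⊕ (H⁰(C, ℚ) ⊗ H²(D, ℚ))`. -/
abbrev U (C D : Type u) [TopologicalSpace C] [TopologicalSpace D] : Type u :=
  (H 2 C ⊗[ℚ] H 0 D) × (H 0 C ⊗[ℚ] H 2 D)

/-- `Z = (H¹(C, ℚ) ⊗ H¹(D, ℚ))^G`, where `G` acts diagonally. -/
noncomputable abbrev Z (G : Type v) [Group G] (C D : Type u) [TopologicalSpace C]
    [TopologicalSpace D] [MulAction G C] [ContinuousConstSMul G C] [MulAction G D]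
    [ContinuousConstSMul G D] : Submodule ℚ (H 1 C ⊗[ℚ] H 1 D) :=
  ((action G 1 C).tprod (action G 1 D)).invariants

/-- The natural map `U ⊕ Z → H²(C × D, ℚ)` given by the cross products. -/
noncomputable def crossUZ (G : Type v) [Group G] (C D : Type u) [TopologicalSpace C]
    [TopologicalSpace D] [MulAction G C] [ContinuousConstSMul G C] [MulAction G D]
    [ContinuousConstSMul G D] : (U C D × Z G C D) →ₗ[ℚ] H 2 (C × D) :=
  ((cross (p := 2) (q := 0) rfl).coprod (cross (p := 0) (q := 2) rfl)).coprod
    (cross (p := 1) (q := 1) rfl ∘ₗ (Z G C D).subtype)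

/-- `π : C × D → S` exhibits the complex surface `S` as a quotient `(C × D) / G` isogenous to a
higher product, of unmixed type: `C` and `D` have genus at least two, `G` acts on `C` and on `D` by
holomorphic automorphisms, the diagonal action on `C × D` is free, the fibres of the surjection `π`
are the orbits of `G`, and the complex structure of `S` is that of the quotient, i.e. `π` is
locally biholomorphic. -/
structure IsUnmixedHigherQuotient (G : Type v) [Group G] {C D S : Type u}
    [TopologicalSpace C] [ChartedSpace ℂ C] [TopologicalSpace D] [ChartedSpace ℂ D]
    [TopologicalSpace S] [ChartedSpace (ℂ × ℂ) S] [MulAction G C] [MulAction G D]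
    (π : C × D → S) : Prop where
  two_le_genus_left : 2 ≤ genus C
  two_le_genus_right : 2 ≤ genus D
  holomorphic_left : ∀ g : G, ContMDiff 𝓘(ℂ) 𝓘(ℂ) ω (fun x : C => g • x)
  holomorphic_right : ∀ g : G, ContMDiff 𝓘(ℂ) 𝓘(ℂ) ω (fun y : D => g • y)
  free : ∀ (g : G) (x : C × D), g • x = x → g = 1
  surjective : Function.Surjective π
  fibres : ∀ x y : C × D, π x = π y ↔ ∃ g : G, g • x = y
  locally_biholomorphic :
    IsLocalDiffeomorph (𝓘(ℂ).prod 𝓘(ℂ)) 𝓘(ℂ, ℂ × ℂ) ω π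

end IsogenousToProduct

/-! ### Semi-simplicial sets and their rational chains -/

/-! Averaging over the finite group G identifies H²(S, ℚ) with the G-invariants of H²(C × D, ℚ). The
action is free, so π is a covering, the singular simplices of S are the G-orbits of singular
simplices of C × D, and invariant cochains descend (`Transfer.pullback_injective`,
`Transfer.mem_range_pullback`). By Künneth, cross products give an equivariant isomorphism of U ⊕
(H¹(C) ⊗ H¹(D)) with H²(C × D) (`RatCohomology.crossTwo_bijective`,
`RatCohomology.pullback_crossTwo`). The group acts trivially on U: on H⁰ because the curves are path
connected, on H² because holomorphic automorphisms preserve orientation (`Sing.pullback_two`). Hence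
the invariants are the image of U ⊕ Z (`IsogenousToProduct.range_crossUZ`). So π^* and κ are
injective with the same image, and e compares them.

The topology of a compact Riemann surface is derived from singular chains that stay in the ambient
space and carry support conditions. Barycentric subdivision makes chains small with respect to two
open sets (`Sing.exists_small`), which yields excision and Mayer–Vietoris. The local degree of a
relative 2-cycle at a point is the winding number of its boundary in a coordinate. Two holomorphic
coordinates differ by a nonvanishing factor, so the degree does not depend on the coordinate; this
is how the complex structure orients the surface. The complement of a rectangle in ℂ is covered by
two star-shaped sets, which determines the relative homology along a rectangle. Mayer–Vietoris
passes to finite unions of rectangles in a chart, then to compact sets in a chart, then to the whole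
surface (`Sing.good_univ`). The outcome is a cycle of degree one everywhere, of which every 2-cycle
is a rational multiple up to a boundary, and the vanishing of cohomology above degree two.

For Künneth, an n-cochain on K × L is a function from n-simplices of L to n-cochains of K. The
cochains of K are replaced by an arbitrary cosimplicial vector space M, and the claim is that cross
products with a finite basis of the cohomology of L compute the cohomology of such functions;
`Kunneth.Ex` states this as exactness of a mapping cone. M embeds into its shift `Dec M`, which is
homotopy equivalent to the constant M₀, where the claim is the universal coefficient theorem. The
cokernel of the embedding carries the induction on the degree (`Kunneth.ex`). -/

/-- A semi-simplicial set: simplices with face maps satisfying the simplicial identities. -/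
structure SemiSimp where
  /-- The `n`-simplices. -/
  T : ℕ → Type u
  /-- The face maps. -/
  face : ∀ {n : ℕ}, Fin (n + 2) → T (n + 1) → T n
  face_face : ∀ {n : ℕ} (i j : Fin (n + 2)), i ≤ j → ∀ x : T (n + 2),
    face i (face j.succ x) = face j (face i.castSucc x)

namespace SemiSimp

variable (S : SemiSimp.{u})

/-- Rational chains. -/
abbrev Ch (n : ℕ) : Type u := S.T n →₀ ℚ

/-- The boundary of chains. -/
noncomputable def bd (n : ℕ) : S.Ch (n + 1) →ₗ[ℚ] S.Ch n :=
  Finsupp.linearCombination ℚ fun x => ∑ i : Fin (n + 2), (-1 : ℚ) ^ (i : ℕ) •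
    Finsupp.single (S.face i x) (1 : ℚ)

variable {S}

theorem bd_single {n : ℕ} (x : S.T (n + 1)) :
    S.bd n (Finsupp.single x 1) = ∑ i : Fin (n + 2), (-1 : ℚ) ^ (i : ℕ) •
      Finsupp.single (S.face i x) (1 : ℚ) := by
  simp [bd]

/-- The simplicial identity makes the terms (i, j) with j < i and (j, i - 1) equal, and their signs
are opposite. The involution exchanges them. -/
theorem bd_bd {n : ℕ} (z : S.Ch (n + 2)) : S.bd n (S.bd (n + 1) z) = 0 := by
  suffices h : S.bd n ∘ₗ S.bd (n + 1) = 0 from congrArg (fun F => F z) h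
  refine Finsupp.lhom_ext' fun x => LinearMap.ext_ring ?_
  simp only [LinearMap.comp_apply, Finsupp.lsingle_apply, bd_single, map_sum, map_smul,
    LinearMap.zero_apply, Finset.smul_sum, smul_smul]
  rw [← Finset.sum_product', Finset.univ_product_univ]
  refine Finset.sum_involution
    (fun x _ => if h : (x.2 : ℕ) < x.1 then (x.2.castSucc, x.1.pred (fun h0 => by simp [h0] at h))
      else (x.2.succ, ⟨x.1, by omega⟩)) ?_ ?_ ?_ ?_
  · rintro ⟨i, j⟩ -
    by_cases h : (j : ℕ) < i
    · have hne : i ≠ 0 := by rintro rfl; simp at h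
      simp only [h, dite_true]
      have e := S.face_face j (i.pred hne) (by rw [Fin.le_def, Fin.val_pred]; omega) x
      rw [Fin.succ_pred] at e
      rw [e, ← add_smul]
      have hi : (-1 : ℚ) ^ (i : ℕ) = - (-1 : ℚ) ^ ((i.pred hne : Fin _) : ℕ) := by
        conv_lhs => rw [← Fin.succ_pred i hne, Fin.val_succ, pow_succ]
        ring
      rw [hi, Fin.val_castSucc]
      convert! zero_smul ℚ _
      ring
    · simp only [h, dite_false]
      have e := S.face_face ⟨i, by omega⟩ j (by rw [Fin.le_def]; simpa using h) x
      have : (⟨(i : ℕ), by omega⟩ : Fin (n + 2)).castSucc = i := rfl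
      rw [this] at e
      rw [e, ← add_smul, Fin.val_succ, pow_succ]
      convert! zero_smul ℚ _
      ring
  · rintro ⟨i, j⟩ - -
    by_cases h : (j : ℕ) < i
    · simp only [h, dite_true, ne_eq, Prod.mk.injEq, not_and]
      intro h1
      have := congrArg Fin.val h1
      simp at this
      omega
    · simp only [h, dite_false, ne_eq, Prod.mk.injEq, not_and]
      intro h1
      have := congrArg Fin.val h1
      simp at this
      omega
  · intros
    exact Finset.mem_univ _
  · rintro ⟨i, j⟩ -
    by_cases h : (j : ℕ) < i
    · have h2 : ¬ ((i : ℕ) - 1 < j) := by omega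
      simp [h, h2]
    · have h2 : (i : ℕ) < j + 1 := by omega
      simp [h, h2]

/-- The augmentation. -/
noncomputable def eps (S : SemiSimp.{u}) : S.Ch 0 →ₗ[ℚ] ℚ :=
  Finsupp.linearCombination ℚ fun _ => (1 : ℚ)

theorem eps_single (x : S.T 0) : S.eps (Finsupp.single x 1) = 1 := by simp [eps]

theorem eps_bd (z : S.Ch 1) : S.eps (S.bd 0 z) = 0 := by
  suffices h : S.eps ∘ₗ S.bd 0 = 0 from congrArg (fun F => F z) h
  refine Finsupp.lhom_ext' fun x => LinearMap.ext_ring ?_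
  simp [bd_single, eps_single, Fin.sum_univ_two]

/-- Two linear maps agreeing on the simplices in `s` agree on the chains supported in `s`. -/
theorem eq_of_mem_supported {α : Type*} {N : Type*} [AddCommGroup N] [Module ℚ N] {s : Set α}
    {F G : (α →₀ ℚ) →ₗ[ℚ] N} (h : ∀ x ∈ s, F (Finsupp.single x 1) = G (Finsupp.single x 1))
    {z : α →₀ ℚ} (hz : z ∈ Finsupp.supported ℚ ℚ s) : F z = G z := by
  rw [Finsupp.supported_eq_span_single] at hz
  refine LinearMap.eqOn_span (s := (fun i => Finsupp.single i (1 : ℚ)) '' s) ?_ hz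
  rintro _ ⟨x, hx, rfl⟩
  exact h x hx

/-- A linear map sending the simplices in `s` to `P` sends the chains supported in `s` to `P`. -/
theorem map_mem_of_mem_supported {α : Type*} {N : Type*} [AddCommGroup N] [Module ℚ N] {s : Set α}
    {F : (α →₀ ℚ) →ₗ[ℚ] N} {P : Submodule ℚ N} (h : ∀ x ∈ s, F (Finsupp.single x 1) ∈ P)
    {z : α →₀ ℚ} (hz : z ∈ Finsupp.supported ℚ ℚ s) : F z ∈ P := by
  rw [Finsupp.supported_eq_span_single] at hz
  have : Submodule.span ℚ ((fun i => Finsupp.single i (1 : ℚ)) '' s) ≤ P.comap F := by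
    rw [Submodule.span_le]
    rintro _ ⟨x, hx, rfl⟩
    exact h x hx
  exact this hz

/-- A semi-simplicial map. -/
structure Hom (S : SemiSimp.{u}) (S' : SemiSimp.{v}) where
  /-- The map on simplices. -/
  app : ∀ n, S.T n → S'.T n
  comm : ∀ {n : ℕ} (i : Fin (n + 2)) (x : S.T (n + 1)), S'.face i (app (n + 1) x) = app n (S.face i x)

/-- The map of chains induced by a semi-simplicial map. -/
noncomputable def Hom.chain {S : SemiSimp.{u}} {S' : SemiSimp.{v}} (f : Hom S S') (n : ℕ) : S.Ch n →ₗ[ℚ] S'.Ch n :=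
  Finsupp.lmapDomain ℚ ℚ (f.app n)

theorem Hom.chain_single {S : SemiSimp.{u}} {S' : SemiSimp.{v}} (f : Hom S S') (n : ℕ) (x : S.T n) :
    f.chain n (Finsupp.single x 1) = Finsupp.single (f.app n x) 1 := by
  simp [chain]

theorem Hom.bd_chain {S : SemiSimp.{u}} {S' : SemiSimp.{v}} (f : Hom S S') {n : ℕ} (z : S.Ch (n + 1)) :
    S'.bd n (f.chain (n + 1) z) = f.chain n (S.bd n z) := by
  suffices h : S'.bd n ∘ₗ f.chain (n + 1) = f.chain n ∘ₗ S.bd n from congrArg (fun F => F z) h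
  refine Finsupp.lhom_ext' fun x => LinearMap.ext_ring ?_
  simp only [LinearMap.comp_apply, Finsupp.lsingle_apply, chain_single, bd_single, f.comm, map_sum,
    map_smul]

end SemiSimp

/-! ### Singular chains -/

/-- The topological standard simplex. -/
abbrev Simp (n : ℕ) : Type := stdSimplex ℝ (Fin (n + 1))

/-- The inclusion of a face. -/
noncomputable def Simp.face {n : ℕ} (i : Fin (n + 2)) : C(Simp n, Simp (n + 1)) :=
  ⟨stdSimplex.map i.succAbove, stdSimplex.continuous_map _⟩

theorem Simp.face_succAbove {n : ℕ} (i : Fin (n + 2)) (t : Simp n) (j : Fin (n + 1)) :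
    Simp.face i t (i.succAbove j) = t j := by
  simp only [Simp.face, ContinuousMap.coe_mk, stdSimplex.map_coe, FunOnFinite.linearMap_apply_apply]
  rw [Finset.sum_eq_single j]
  · intro b hb hne
    simp only [Finset.mem_filter, Finset.mem_univ, true_and] at hb
    exact absurd (Fin.succAbove_right_injective hb) hne
  · intro h
    simp at h

theorem Simp.face_self {n : ℕ} (i : Fin (n + 2)) (t : Simp n) : Simp.face i t i = 0 := by
  simp only [Simp.face, ContinuousMap.coe_mk, stdSimplex.map_coe, FunOnFinite.linearMap_apply_apply]
  refine Finset.sum_eq_zero fun b hb => ?_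
  simp only [Finset.mem_filter, Finset.mem_univ, true_and] at hb
  exact absurd hb (Fin.succAbove_ne i b)

theorem Simp.face_vertex {n : ℕ} (i : Fin (n + 2)) (j : Fin (n + 1)) :
    Simp.face i (stdSimplex.vertex (S := ℝ) j) = stdSimplex.vertex (S := ℝ) (i.succAbove j) :=
  stdSimplex.map_vertex _ _

theorem Simp.face_comp_face {n : ℕ} (i j : Fin (n + 2)) (hij : i ≤ j) :
    (Simp.face j.succ).comp (Simp.face i) = (Simp.face i.castSucc).comp (Simp.face j) := by
  ext1 t
  simp only [Simp.face, ContinuousMap.comp_apply, ContinuousMap.coe_mk, stdSimplex.map_comp_apply]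
  congr 1
  funext k
  ext
  simp only [Function.comp_apply, Fin.succAbove, Fin.lt_def, Fin.le_def] at *
  split_ifs <;> simp at * <;> omega

/-- The singular semi-simplicial set of a space. -/
@[reducible] noncomputable def sing (X : Type u) [TopologicalSpace X] : SemiSimp.{u} where
  T n := C(Simp n, X)
  face i σ := σ.comp (Simp.face i)
  face_face i j hij σ := by
    rw [ContinuousMap.comp_assoc, ContinuousMap.comp_assoc, Simp.face_comp_face i j hij]

namespace Sing

open SemiSimp

variable {X : Type u} {Y : Type v} [TopologicalSpace X] [TopologicalSpace Y]

/-- Singular chains with support in a set. -/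
def supp (V : Set X) (n : ℕ) : Submodule ℚ ((sing X).Ch n) :=
  Finsupp.supported ℚ ℚ {σ : C(Simp n, X) | ∀ t, σ t ∈ V}

theorem supp_mono {V W : Set X} (h : V ⊆ W) (n : ℕ) : supp V n ≤ supp W n :=
  Finsupp.supported_mono fun _ hσ t => h (hσ t)

theorem mem_supp_univ {n : ℕ} (z : (sing X).Ch n) : z ∈ supp (Set.univ : Set X) n := by
  simp [supp]

theorem single_mem_supp {V : Set X} {n : ℕ} {σ : C(Simp n, X)} (h : ∀ t, σ t ∈ V) :
    (Finsupp.single σ 1 : (sing X).Ch n) ∈ supp V n :=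
  Finsupp.single_mem_supported ℚ _ h

/-- Chains of subspaces are ambient chains with a condition on each simplex, so a chain lying in
both sets lies in the intersection. Mayer–Vietoris then needs no induced maps between subspaces. -/
theorem supp_inter (V W : Set X) (n : ℕ) : supp (V ∩ W) n = supp V n ⊓ supp W n := by
  rw [supp, supp, supp, ← Finsupp.supported_inter]
  congr 1
  ext σ
  simp [forall_and]

theorem eq_zero_of_mem_supp_empty {n : ℕ} {z : (sing X).Ch n} (h : z ∈ supp (∅ : Set X) n) :
    z = 0 := by
  have : {σ : C(Simp n, X) | ∀ t, σ t ∈ (∅ : Set X)} = ∅ := by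
    ext σ
    simp
  rw [supp, this, Finsupp.supported_empty] at h
  simpa using h

theorem bd_mem_supp {V : Set X} {n : ℕ} {z : (sing X).Ch (n + 1)} (h : z ∈ supp V (n + 1)) :
    (sing X).bd n z ∈ supp V n := by
  refine map_mem_of_mem_supported (fun σ hσ => ?_) h
  rw [bd_single]
  exact Submodule.sum_mem _ fun i _ => Submodule.smul_mem _ _ (single_mem_supp fun t => hσ _)

theorem mem_sup_of_forall {V W : Set X} {n : ℕ} {z : (sing X).Ch n} {s : Set C(Simp n, X)}
    (h : z ∈ Finsupp.supported ℚ ℚ s) (hs : ∀ σ ∈ s, (∀ t, σ t ∈ V) ∨ ∀ t, σ t ∈ W) :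
    z ∈ supp V n ⊔ supp W n := by
  rw [supp, supp, ← Finsupp.supported_union]
  exact Finsupp.supported_mono hs h

/-- A chain in the union of two disjoint open sets is a sum of chains in these sets. -/
theorem mem_sup_of_disjoint {V W : Set X} (hV : IsOpen V) (hW : IsOpen W) (hd : V ∩ W = ∅) {n : ℕ}
    {z : (sing X).Ch n} (h : z ∈ supp (V ∪ W) n) : z ∈ supp V n ⊔ supp W n := by
  refine mem_sup_of_forall h fun σ hσ => ?_
  have hr : IsPreconnected (Set.range σ) := isPreconnected_range σ.continuous
  have hsub : Set.range σ ⊆ V ∪ W := by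
    rintro _ ⟨t, rfl⟩
    exact hσ t
  have := hr.subset_or_subset hV hW (Set.disjoint_iff_inter_eq_empty.2 hd) hsub
  simpa [Set.range_subset_iff] using this

/-! ### Push-forward along functions continuous on the support of a chain -/

section push

open Classical in
/-- Push-forward of a simplex along a function, zero if the result is discontinuous. -/
noncomputable def pushSimplex (f : X → Y) {n : ℕ} (σ : C(Simp n, X)) : (sing Y).Ch n :=
  if h : Continuous (f ∘ σ) then Finsupp.single ⟨f ∘ σ, h⟩ 1 else 0

/-- Push-forward of chains along a function, to be used on chains supported in a set on which the
function is continuous. -/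
noncomputable def push (f : X → Y) (n : ℕ) : (sing X).Ch n →ₗ[ℚ] (sing Y).Ch n :=
  Finsupp.linearCombination ℚ (pushSimplex f)

theorem continuous_comp {f : X → Y} {V : Set X} (hf : ContinuousOn f V) {n : ℕ} {σ : C(Simp n, X)}
    (hσ : ∀ t, σ t ∈ V) : Continuous (f ∘ σ) :=
  hf.comp_continuous σ.continuous hσ

theorem push_single {f : X → Y} {n : ℕ} {σ : C(Simp n, X)} (h : Continuous (f ∘ σ)) :
    push f n (Finsupp.single σ 1) = Finsupp.single ⟨f ∘ σ, h⟩ 1 := by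
  simp [push, pushSimplex, h]

theorem push_mem_supp {f : X → Y} {V : Set X} (hf : ContinuousOn f V) {W : Set Y}
    (hm : Set.MapsTo f V W) {n : ℕ} {z : (sing X).Ch n} (h : z ∈ supp V n) :
    push f n z ∈ supp W n := by
  refine map_mem_of_mem_supported (fun σ hσ => ?_) h
  rw [push_single (continuous_comp hf hσ)]
  exact single_mem_supp fun t => hm (hσ t)

/-- The support condition matters: a simplex with discontinuous composite is sent to zero, although
some of its faces may have continuous composites. -/
theorem bd_push {f : X → Y} {V : Set X} (hf : ContinuousOn f V) {n : ℕ} {z : (sing X).Ch (n + 1)}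
    (h : z ∈ supp V (n + 1)) : (sing Y).bd n (push f (n + 1) z) = push f n ((sing X).bd n z) := by
  refine eq_of_mem_supported (F := (sing Y).bd n ∘ₗ push f (n + 1))
    (G := push f n ∘ₗ (sing X).bd n) (fun σ hσ => ?_) h
  simp only [LinearMap.comp_apply]
  rw [push_single (continuous_comp hf hσ), bd_single, bd_single]
  simp only [map_sum, map_smul]
  refine Finset.sum_congr rfl fun i _ => ?_
  rw [push_single (continuous_comp hf (fun t => hσ (Simp.face i t)))]
  rfl

theorem push_congr {f g : X → Y} {V : Set X} (hf : ContinuousOn g V) (hfg : Set.EqOn f g V) {n : ℕ} {z : (sing X).Ch n}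
    (h : z ∈ supp V n) : push f n z = push g n z := by
  refine eq_of_mem_supported (fun σ hσ => ?_) h
  rw [push_single (continuous_comp (hf.congr hfg) hσ), push_single (continuous_comp hf hσ)]
  congr 1
  exact ContinuousMap.ext fun t => hfg (hσ t)

/-- Continuity of `g` plays no role, because both sides are zero on a simplex whose composite is
discontinuous. -/
theorem push_push {Z : Type*} [TopologicalSpace Z] {f : X → Y} {g : Y → Z} {V : Set X}
    (hf : ContinuousOn f V) {n : ℕ} {z : (sing X).Ch n} (h : z ∈ supp V n) :
    push g n (push f n z) = push (g ∘ f) n z := by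
  refine eq_of_mem_supported (F := push g n ∘ₗ push f n) (fun σ hσ => ?_) h
  rw [LinearMap.comp_apply, push_single (continuous_comp hf hσ)]
  simp only [push, Finsupp.linearCombination_single, one_smul, pushSimplex]
  rfl

theorem push_id {n : ℕ} (z : (sing X).Ch n) : push id n z = z := by
  refine eq_of_mem_supported (F := push id n) (G := LinearMap.id) (fun σ _ => ?_) (mem_supp_univ z)
  rw [push_single (f := id) (σ := σ) σ.continuous]
  rfl

theorem push_eqOn_id {f : X → X} {V : Set X} (hf : Set.EqOn f id V) {n : ℕ} {z : (sing X).Ch n}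
    (h : z ∈ supp V n) : push f n z = z := by
  rw [push_congr continuousOn_id hf h, push_id]

end push

/-! #### Cones -/

section cone

variable {E : Type*} [NormedAddCommGroup E] [NormedSpace ℝ E]

theorem Simp.sum_succ {n : ℕ} (t : Simp (n + 1)) : ∑ i : Fin (n + 1), t i.succ = 1 - t 0 := by
  have := stdSimplex.sum_eq_one t
  rw [Fin.sum_univ_succ] at this
  linarith

/-- The projection of a simplex, minus a vertex, to the opposite face. -/
noncomputable def Simp.tail {n : ℕ} (t : Simp (n + 1)) (h : t 0 ≠ 1) : Simp n :=
  ⟨fun i => t i.succ / (1 - t 0), fun i => div_nonneg (stdSimplex.zero_le t _)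
    (by have := stdSimplex.le_one t 0; linarith), by
      rw [← Finset.sum_div, Simp.sum_succ, div_self (sub_ne_zero.2 (Ne.symm h))]⟩

open Classical in
/-- The cone with apex `p` on a function on a simplex. -/
noncomputable def coneFun (p : E) {n : ℕ} (σ : Simp n → E) (t : Simp (n + 1)) : E :=
  if h : t 0 = 1 then p else p + (1 - t 0) • (σ (Simp.tail t h) - p)

/-- Away from the apex the formula is visibly continuous. At the apex the projection to the base has
no limit, but the base simplex is bounded by compactness and the factor 1 - t₀ tends to zero. -/
theorem continuous_coneFun (p : E) {n : ℕ} (σ : C(Simp n, E)) : Continuous (coneFun p σ) := by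
  rw [continuous_iff_continuousAt]
  intro t
  have hev : ∀ i, Continuous fun s : Simp (n + 1) => s i := fun i =>
    (continuous_apply i).comp continuous_subtype_val
  by_cases h : t 0 = 1
  · obtain ⟨M, hM⟩ := isCompact_univ.exists_bound_of_continuousOn
      (f := fun s : Simp n => σ s - p) (by fun_prop)
    have hp : coneFun p σ t = p := by simp [coneFun, h]
    rw [ContinuousAt, hp, tendsto_iff_norm_sub_tendsto_zero]
    have hb : ∀ s : Simp (n + 1), ‖coneFun p σ s - p‖ ≤ (1 - s 0) * |M| := by
      intro s
      have h1 := stdSimplex.le_one s 0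
      by_cases hs : s 0 = 1
      · simp [coneFun, hs]
      · rw [coneFun, dif_neg hs, add_sub_cancel_left, norm_smul, Real.norm_of_nonneg (by linarith)]
        exact mul_le_mul_of_nonneg_left ((hM _ (Set.mem_univ _)).trans (le_abs_self M)) (by linarith)
    refine squeeze_zero (fun _ => norm_nonneg _) hb ?_
    have : Continuous fun s : Simp (n + 1) => (1 - s 0) * |M| :=
      (continuous_const.sub (hev 0)).mul continuous_const
    have := this.tendsto t
    simpa [h] using this
  · have ho : IsOpen {s : Simp (n + 1) | s 0 ≠ 1} := isOpen_ne_fun (hev 0) continuous_const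
    refine ContinuousOn.continuousAt (s := {s : Simp (n + 1) | s 0 ≠ 1}) ?_ (ho.mem_nhds h)
    rw [continuousOn_iff_continuous_domRestrict]
    have : Set.domRestrict {s : Simp (n + 1) | s 0 ≠ 1} (coneFun p σ) =
        fun s => p + (1 - s.1 0) • (σ (Simp.tail s.1 s.2) - p) := by
      funext s
      simp only [Set.domRestrict_apply, coneFun]
      exact dif_neg s.2
    rw [this]
    have h0 : Continuous fun s : {s : Simp (n + 1) | s 0 ≠ 1} => s.1 0 :=
      (hev 0).comp continuous_subtype_val
    have ht : Continuous fun s : {s : Simp (n + 1) | s 0 ≠ 1} => Simp.tail s.1 s.2 := by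
      refine Continuous.subtype_mk (continuous_pi fun i => ?_) _
      exact ((hev i.succ).comp continuous_subtype_val).div (continuous_const.sub h0)
        fun s => sub_ne_zero.2 (Ne.symm s.2)
    exact continuous_const.add ((continuous_const.sub h0).smul
      ((σ.continuous.comp ht).sub continuous_const))

/-- The cone with apex `p` on a singular simplex. -/
noncomputable def coneSimplex (p : E) {n : ℕ} (σ : C(Simp n, E)) : C(Simp (n + 1), E) :=
  ⟨coneFun p σ, continuous_coneFun p σ⟩

theorem coneSimplex_mem {p : E} {V : Set E} (hV : StarConvex ℝ p V) (hp : p ∈ V) {n : ℕ}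
    {σ : C(Simp n, E)} (hσ : ∀ t, σ t ∈ V) (t : Simp (n + 1)) : coneSimplex p σ t ∈ V := by
  change coneFun p σ t ∈ V
  by_cases h : t 0 = 1
  · rw [coneFun, dif_pos h]
    exact hp
  · rw [coneFun, dif_neg h]
    have h1 := stdSimplex.le_one t 0
    have h0 := stdSimplex.zero_le t 0
    have := hV (hσ (Simp.tail t h)) h0 (by linarith : 0 ≤ 1 - t 0) (by ring)
    convert this using 1
    rw [smul_sub, sub_smul, sub_smul, one_smul, one_smul]
    abel

theorem coneSimplex_face_zero (p : E) {n : ℕ} (σ : C(Simp n, E)) :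
    (sing E).face 0 (coneSimplex p σ) = σ := by
  refine ContinuousMap.ext fun t => ?_
  change coneFun p σ (Simp.face 0 t) = σ t
  have h0 : Simp.face 0 t 0 = 0 := Simp.face_self 0 t
  have hne : Simp.face 0 t 0 ≠ 1 := by rw [h0]; exact zero_ne_one
  have ht : Simp.tail (Simp.face 0 t) hne = t := by
    ext i
    change Simp.face 0 t i.succ / (1 - Simp.face 0 t 0) = t i
    rw [h0, sub_zero, div_one]
    simpa using Simp.face_succAbove 0 t i
  rw [coneFun, dif_neg hne, ht, h0]
  simp

theorem coneSimplex_face_succ (p : E) {n : ℕ} (σ : C(Simp (n + 1), E)) (i : Fin (n + 2)) :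
    (sing E).face i.succ (coneSimplex p σ) = coneSimplex p ((sing E).face i σ) := by
  refine ContinuousMap.ext fun t => ?_
  change coneFun p σ (Simp.face i.succ t) = coneFun p (σ ∘ Simp.face i) t
  have h0 : Simp.face i.succ t 0 = t 0 := by
    have := Simp.face_succAbove i.succ t 0
    rwa [Fin.succ_succAbove_zero] at this
  by_cases h : t 0 = 1
  · rw [coneFun, coneFun, dif_pos h, dif_pos (h0.trans h)]
  · have hne : Simp.face i.succ t 0 ≠ 1 := by rwa [h0]
    have ht : Simp.tail (Simp.face i.succ t) hne = Simp.face i (Simp.tail t h) := by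
      ext k
      change Simp.face i.succ t k.succ / (1 - Simp.face i.succ t 0) = Simp.face i (Simp.tail t h) k
      rw [h0]
      by_cases hk : k = i
      · rw [hk, Simp.face_self, Simp.face_self, zero_div]
      · obtain ⟨j, rfl⟩ := Fin.exists_succAbove_eq hk
        rw [Simp.face_succAbove, ← Fin.succ_succAbove_succ, Simp.face_succAbove]
        rfl
    rw [coneFun, coneFun, dif_neg h, dif_neg hne, ht, h0]
    rfl

theorem coneSimplex_face_one (p : E) (σ : C(Simp 0, E)) :
    (sing E).face 1 (coneSimplex p σ) = ContinuousMap.const _ p := by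
  refine ContinuousMap.ext fun t => ?_
  change coneFun p σ (Simp.face 1 t) = p
  have h0 : Simp.face 1 t 0 = 1 := by
    have := Simp.face_succAbove 1 t 0
    rw [show (1 : Fin 2).succAbove 0 = 0 from rfl] at this
    rw [this]
    simp
  rw [coneFun, dif_pos h0]

/-- The cone operator on chains. -/
noncomputable def cone (p : E) (n : ℕ) : (sing E).Ch n →ₗ[ℚ] (sing E).Ch (n + 1) :=
  Finsupp.lmapDomain ℚ ℚ (coneSimplex p)

theorem cone_single (p : E) {n : ℕ} (σ : C(Simp n, E)) :
    cone p n (Finsupp.single σ 1) = Finsupp.single (coneSimplex p σ) 1 := by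
  simp [cone]

/-- The zero-simplex at a point. -/
noncomputable def pt (p : X) : (sing X).Ch 0 := Finsupp.single (ContinuousMap.const _ p) 1

theorem pt_mem_supp {V : Set X} {p : X} (hp : p ∈ V) : pt p ∈ supp V 0 :=
  single_mem_supp fun _ => hp

theorem eps_pt (p : X) : (sing X).eps (pt p) = 1 := eps_single _

theorem cone_mem_supp {p : E} {V : Set E} (hV : StarConvex ℝ p V) (hp : p ∈ V) {n : ℕ}
    {z : (sing E).Ch n} (h : z ∈ supp V n) : cone p n z ∈ supp V (n + 1) := by
  refine map_mem_of_mem_supported (fun σ hσ => ?_) h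
  rw [cone_single]
  exact single_mem_supp (coneSimplex_mem hV hp hσ)

/-- The face opposite the apex returns the simplex, and the remaining faces are cones on its faces
with the index, hence the sign, shifted by one. -/
theorem bd_cone (p : E) {n : ℕ} (z : (sing E).Ch (n + 1)) :
    (sing E).bd (n + 1) (cone p (n + 1) z) = z - cone p n ((sing E).bd n z) := by
  suffices h : (sing E).bd (n + 1) ∘ₗ cone p (n + 1) = LinearMap.id - cone p n ∘ₗ (sing E).bd n from
    congrArg (fun F => F z) h
  refine Finsupp.lhom_ext' fun σ => LinearMap.ext_ring ?_
  change (sing E).bd (n + 1) (cone p (n + 1) (Finsupp.single σ 1)) =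
    Finsupp.single σ 1 - cone p n ((sing E).bd n (Finsupp.single σ 1))
  rw [cone_single, bd_single, bd_single, map_sum, Fin.sum_univ_succ, coneSimplex_face_zero,
    Fin.val_zero, pow_zero, one_smul, sub_eq_add_neg, ← Finset.sum_neg_distrib]
  congr 1
  refine Finset.sum_congr rfl fun i _ => ?_
  rw [coneSimplex_face_succ, map_smul, cone_single, Fin.val_succ, pow_succ, mul_neg_one, neg_smul]

/-- In degree zero the second face of the cone is the apex itself, so the contraction holds only up
to the augmentation. -/
theorem bd_cone_zero (p : E) (z : (sing E).Ch 0) :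
    (sing E).bd 0 (cone p 0 z) = z - (sing E).eps z • pt p := by
  suffices h : (sing E).bd 0 ∘ₗ cone p 0 = LinearMap.id - (sing E).eps.smulRight (pt p) from
    congrArg (fun F => F z) h
  refine Finsupp.lhom_ext' fun σ => LinearMap.ext_ring ?_
  change (sing E).bd 0 (cone p 0 (Finsupp.single σ 1)) =
    Finsupp.single σ 1 - (sing E).eps (Finsupp.single σ 1) • pt p
  rw [cone_single, bd_single, Fin.sum_univ_two, eps_single, coneSimplex_face_zero,
    coneSimplex_face_one, Fin.val_zero, pow_zero, one_smul, Fin.val_one, pow_one, neg_smul, one_smul,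
    sub_eq_add_neg, pt, one_smul]

/-- Star-shaped sets are acyclic in positive degrees. -/
theorem exists_bd_of_starConvex {p : E} {V : Set E} (hV : StarConvex ℝ p V) (hp : p ∈ V) {n : ℕ}
    {z : (sing E).Ch (n + 1)} (h : z ∈ supp V (n + 1)) (hz : (sing E).bd n z = 0) :
    ∃ w ∈ supp V (n + 2), (sing E).bd (n + 1) w = z :=
  ⟨cone p (n + 1) z, cone_mem_supp hV hp h, by rw [bd_cone, hz, map_zero, sub_zero]⟩

/-- The zeroth homology of star-shaped sets. -/
theorem exists_bd_of_starConvex_zero {p : E} {V : Set E} (hV : StarConvex ℝ p V) (hp : p ∈ V)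
    {z : (sing E).Ch 0} (h : z ∈ supp V 0) :
    ∃ w ∈ supp V 1, (sing E).bd 0 w = z - (sing E).eps z • pt p :=
  ⟨cone p 0 z, cone_mem_supp hV hp h, bd_cone_zero p z⟩

end cone

end Sing

/-! ### Barycentric subdivision of linear chains -/

/-- The semi-simplicial set of vertex sequences. -/
@[reducible] def lin (A : Type u) : SemiSimp.{u} where
  T n := Fin (n + 1) → A
  face i x := x ∘ i.succAbove
  face_face i j hij x := by
    funext k
    simp only [Function.comp_apply]
    congr 1
    ext
    simp only [Fin.succAbove, Fin.lt_def, Fin.le_def] at *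
    split_ifs <;> simp at * <;> omega

namespace Lin

open SemiSimp

variable {A : Type u} {B : Type v}

/-- The cone operator on linear chains. -/
noncomputable def cone (p : A) (n : ℕ) : (lin A).Ch n →ₗ[ℚ] (lin A).Ch (n + 1) :=
  Finsupp.lmapDomain ℚ ℚ fun x => (Fin.cons p x : Fin (n + 1 + 1) → A)

theorem cone_single (p : A) {n : ℕ} (x : Fin (n + 1) → A) :
    cone p n (Finsupp.single x 1) = Finsupp.single (Fin.cons p x : Fin (n + 1 + 1) → A) 1 := by
  simp [cone]

theorem face_zero_cons (p : A) {n : ℕ} (x : Fin (n + 1) → A) :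
    (lin A).face 0 (Fin.cons p x : Fin (n + 1 + 1) → A) = x := by
  funext k
  simp

theorem face_succ_cons (p : A) {n : ℕ} (x : Fin (n + 1 + 1) → A) (i : Fin (n + 2)) :
    (lin A).face i.succ (Fin.cons p x : Fin (n + 1 + 1 + 1) → A) =
      (Fin.cons p ((lin A).face i x) : Fin (n + 1 + 1) → A) := by
  funext k
  refine Fin.cases ?_ (fun k => ?_) k
  · simp
  · simp

theorem bd_cone (p : A) {n : ℕ} (z : (lin A).Ch (n + 1)) :
    (lin A).bd (n + 1) (cone p (n + 1) z) = z - cone p n ((lin A).bd n z) := by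
  suffices h : (lin A).bd (n + 1) ∘ₗ cone p (n + 1) = LinearMap.id - cone p n ∘ₗ (lin A).bd n from
    congrArg (fun F => F z) h
  refine Finsupp.lhom_ext' fun x => LinearMap.ext_ring ?_
  change (lin A).bd (n + 1) (cone p (n + 1) (Finsupp.single x 1)) =
    Finsupp.single x 1 - cone p n ((lin A).bd n (Finsupp.single x 1))
  rw [cone_single, bd_single, bd_single, map_sum, Fin.sum_univ_succ, face_zero_cons,
    Fin.val_zero, pow_zero, one_smul, sub_eq_add_neg, ← Finset.sum_neg_distrib]
  congr 1
  refine Finset.sum_congr rfl fun i _ => ?_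
  rw [face_succ_cons, map_smul, cone_single, Fin.val_succ, pow_succ, mul_neg_one, neg_smul]

theorem bd_cone_zero (p : A) {z : (lin A).Ch 0} (hz : (lin A).eps z = 0) :
    (lin A).bd 0 (cone p 0 z) = z := by
  suffices h : (lin A).bd 0 ∘ₗ cone p 0 = LinearMap.id -
      (lin A).eps.smulRight (Finsupp.single (fun _ => p : Fin 1 → A) (1 : ℚ)) by
    have := congrArg (fun F => F z) h
    simpa [hz] using this
  refine Finsupp.lhom_ext' fun x => LinearMap.ext_ring ?_
  change (lin A).bd 0 (cone p 0 (Finsupp.single x 1)) =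
    Finsupp.single x 1 - (lin A).eps (Finsupp.single x 1) • Finsupp.single (fun _ => p : Fin 1 → A) (1 : ℚ)
  have h1 : (lin A).face 1 (Fin.cons p x : Fin (0 + 1 + 1) → A) = fun _ => p := by
    funext k
    fin_cases k
    rfl
  rw [cone_single, bd_single, Fin.sum_univ_two, eps_single, face_zero_cons, h1,
    Fin.val_zero, pow_zero, one_smul, Fin.val_one, pow_one, neg_smul, one_smul,
    sub_eq_add_neg]

variable (b : ∀ {n : ℕ}, (Fin (n + 1) → A) → A) (b' : ∀ {n : ℕ}, (Fin (n + 1) → B) → B)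

/-- Barycentric subdivision, for a choice `b` of barycentres. -/
noncomputable def sd : (n : ℕ) → (lin A).Ch n →ₗ[ℚ] (lin A).Ch n
  | 0 => LinearMap.id
  | n + 1 => Finsupp.linearCombination ℚ fun x =>
      cone (b x) n (sd n ((lin A).bd n (Finsupp.single x 1)))

/-- The chain homotopy between the identity and barycentric subdivision. -/
noncomputable def htpy : (n : ℕ) → (lin A).Ch n →ₗ[ℚ] (lin A).Ch (n + 1)
  | 0 => 0
  | n + 1 => Finsupp.linearCombination ℚ fun x =>
      cone (b x) (n + 1) (Finsupp.single x 1 - htpy n ((lin A).bd n (Finsupp.single x 1)))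

theorem sd_single {n : ℕ} (x : Fin (n + 1 + 1) → A) : sd b (n + 1) (Finsupp.single x 1) =
    cone (b x) n (sd b n ((lin A).bd n (Finsupp.single x 1))) := by
  simp [sd]

theorem htpy_single {n : ℕ} (x : Fin (n + 1 + 1) → A) : htpy b (n + 1) (Finsupp.single x 1) =
    cone (b x) (n + 1) (Finsupp.single x 1 - htpy b n ((lin A).bd n (Finsupp.single x 1))) := by
  simp [htpy]

theorem bd_sd : ∀ {n : ℕ} (z : (lin A).Ch (n + 1)),
    (lin A).bd n (sd b (n + 1) z) = sd b n ((lin A).bd n z)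
  | 0, z => by
    suffices h : (lin A).bd 0 ∘ₗ sd b 1 = sd b 0 ∘ₗ (lin A).bd 0 from congrArg (fun F => F z) h
    refine Finsupp.lhom_ext' fun x => LinearMap.ext_ring ?_
    change (lin A).bd 0 (sd b 1 (Finsupp.single x 1)) = sd b 0 ((lin A).bd 0 (Finsupp.single x 1))
    rw [sd_single, bd_cone_zero]
    exact eps_bd _
  | n + 1, z => by
    suffices h : (lin A).bd (n + 1) ∘ₗ sd b (n + 2) = sd b (n + 1) ∘ₗ (lin A).bd (n + 1) from
      congrArg (fun F => F z) h
    refine Finsupp.lhom_ext' fun x => LinearMap.ext_ring ?_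
    change (lin A).bd (n + 1) (sd b (n + 2) (Finsupp.single x 1)) =
      sd b (n + 1) ((lin A).bd (n + 1) (Finsupp.single x 1))
    rw [sd_single, bd_cone, bd_sd, bd_bd, map_zero, map_zero, sub_zero]

/-- With h(x) = b(x)·(x - h∂x), the cone formula gives ∂h(x) = x - h∂x - b(x)·(∂x - ∂h∂x). By
induction ∂h∂x = ∂x - sd ∂x, so the last cone is b(x)·sd ∂x = sd x. -/
theorem bd_htpy : ∀ {n : ℕ} (z : (lin A).Ch (n + 1)),
    (lin A).bd (n + 1) (htpy b (n + 1) z) = z - sd b (n + 1) z - htpy b n ((lin A).bd n z)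
  | n, z => by
    suffices h : (lin A).bd (n + 1) ∘ₗ htpy b (n + 1) =
        LinearMap.id - sd b (n + 1) - htpy b n ∘ₗ (lin A).bd n from congrArg (fun F => F z) h
    refine Finsupp.lhom_ext' fun x => LinearMap.ext_ring ?_
    change (lin A).bd (n + 1) (htpy b (n + 1) (Finsupp.single x 1)) =
      Finsupp.single x 1 - sd b (n + 1) (Finsupp.single x 1) -
        htpy b n ((lin A).bd n (Finsupp.single x 1))
    rw [htpy_single, bd_cone, sd_single, map_sub]
    have key : (lin A).bd n (htpy b n ((lin A).bd n (Finsupp.single x 1))) =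
        (lin A).bd n (Finsupp.single x 1) - sd b n ((lin A).bd n (Finsupp.single x 1)) := by
      cases n with
      | zero => simp [htpy, sd]
      | succ n => rw [bd_htpy, bd_bd, map_zero, sub_zero]
    rw [key, sub_sub_cancel]
    abel

/-- The map of linear chains induced by a map of sets. -/
def mapHom (φ : A → B) : Hom (lin A) (lin B) where
  app _ x := φ ∘ x
  comm _ _ := rfl

theorem chain_cone (φ : A → B) (p : A) {n : ℕ} (z : (lin A).Ch n) :
    (mapHom φ).chain (n + 1) (cone p n z) = cone (φ p) n ((mapHom φ).chain n z) := by
  suffices h : (mapHom φ).chain (n + 1) ∘ₗ cone p n = cone (φ p) n ∘ₗ (mapHom φ).chain n from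
    congrArg (fun F => F z) h
  refine Finsupp.lhom_ext' fun x => LinearMap.ext_ring ?_
  change (mapHom φ).chain (n + 1) (cone p n (Finsupp.single x 1)) =
    cone (φ p) n ((mapHom φ).chain n (Finsupp.single x 1))
  rw [cone_single, Hom.chain_single, Hom.chain_single, cone_single]
  congr 1
  funext k
  refine Fin.cases ?_ (fun k => ?_) k <;> simp [mapHom]

/-- Naturality serves two purposes: for affine maps between simplices it makes singular subdivision
compatible with faces, and for the inclusion of a simplex into a normed space it transfers the mesh
estimate. -/
theorem chain_sd (φ : A → B) (hφ : ∀ {n : ℕ} (x : Fin (n + 1) → A), φ (b x) = b' (φ ∘ x)) :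
    ∀ {n : ℕ} (z : (lin A).Ch n), (mapHom φ).chain n (sd b n z) = sd b' n ((mapHom φ).chain n z)
  | 0, z => rfl
  | n + 1, z => by
    suffices h : (mapHom φ).chain (n + 1) ∘ₗ sd b (n + 1) = sd b' (n + 1) ∘ₗ (mapHom φ).chain (n + 1)
      from congrArg (fun F => F z) h
    refine Finsupp.lhom_ext' fun x => LinearMap.ext_ring ?_
    change (mapHom φ).chain (n + 1) (sd b (n + 1) (Finsupp.single x 1)) =
      sd b' (n + 1) ((mapHom φ).chain (n + 1) (Finsupp.single x 1))
    rw [sd_single, chain_cone, chain_sd φ hφ, ← Hom.bd_chain, Hom.chain_single, sd_single, hφ]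
    rfl

theorem chain_htpy (φ : A → B) (hφ : ∀ {n : ℕ} (x : Fin (n + 1) → A), φ (b x) = b' (φ ∘ x)) :
    ∀ {n : ℕ} (z : (lin A).Ch n),
      (mapHom φ).chain (n + 1) (htpy b n z) = htpy b' n ((mapHom φ).chain n z)
  | 0, z => by simp [htpy]
  | n + 1, z => by
    suffices h : (mapHom φ).chain (n + 2) ∘ₗ htpy b (n + 1) =
        htpy b' (n + 1) ∘ₗ (mapHom φ).chain (n + 1) from congrArg (fun F => F z) h
    refine Finsupp.lhom_ext' fun x => LinearMap.ext_ring ?_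
    change (mapHom φ).chain (n + 2) (htpy b (n + 1) (Finsupp.single x 1)) =
      htpy b' (n + 1) ((mapHom φ).chain (n + 1) (Finsupp.single x 1))
    rw [htpy_single, chain_cone, map_sub, chain_htpy φ hφ, ← Hom.bd_chain, Hom.chain_single,
      htpy_single, hφ]
    rfl

/-! ### The mesh of iterated subdivisions -/

section mesh

variable {E : Type*} [NormedAddCommGroup E] [NormedSpace ℝ E]

/-- The barycentre of a sequence of points. -/
noncomputable def bary {n : ℕ} (x : Fin (n + 1) → E) : E := ((n : ℝ) + 1)⁻¹ • ∑ i, x i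

theorem bary_mem_convexHull {n : ℕ} (x : Fin (n + 1) → E) :
    bary x ∈ convexHull ℝ (Set.range x) := by
  rw [bary, Finset.smul_sum]
  refine (convex_convexHull ℝ _).sum_mem (fun _ _ => by positivity) ?_
    fun i _ => subset_convexHull ℝ _ ⟨i, rfl⟩
  simp only [Finset.sum_const, Finset.card_univ, Fintype.card_fin, nsmul_eq_mul]
  push_cast
  exact mul_inv_cancel₀ (by positivity)

/-- Among the n + 2 differences averaged in the barycentre minus a vertex, the one for that vertex
is zero; the other n + 1 are bounded by D. -/
theorem dist_bary_le {n : ℕ} (x : Fin (n + 2) → E) {D : ℝ} (hx : ∀ i j, dist (x i) (x j) ≤ D)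
    (j : Fin (n + 2)) : dist (x j) (bary x) ≤ ((n : ℝ) + 1) / (n + 2) * D := by
  have h2 : ((n : ℝ) + 2) ≠ 0 := by positivity
  have h : bary x - x j = ((n : ℝ) + 2)⁻¹ • ∑ i : Fin (n + 1), (x (j.succAbove i) - x j) := by
    rw [bary, Fin.sum_univ_succAbove _ j, Finset.sum_sub_distrib]
    simp only [Finset.sum_const, Finset.card_univ, Fintype.card_fin]
    have : ((↑(n + 1) : ℝ) + 1) = (n : ℝ) + 2 := by push_cast; ring
    have e : x j = ((n : ℝ) + 2)⁻¹ • (((n : ℝ) + 2) • x j) := by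
      rw [smul_smul, inv_mul_cancel₀ h2, one_smul]
    rw [this, ← Nat.cast_smul_eq_nsmul ℝ]
    push_cast
    rw [← sub_eq_zero] at e ⊢
    rw [← neg_eq_zero, ← e]
    module
  rw [dist_comm, dist_eq_norm, h, norm_smul, norm_inv, Real.norm_of_nonneg (by positivity : (0:ℝ) ≤ n + 2)]
  have : ‖∑ i : Fin (n + 1), (x (j.succAbove i) - x j)‖ ≤ ((n : ℝ) + 1) * D := by
    refine (norm_sum_le_of_le _ fun i _ => (dist_eq_norm (x (j.succAbove i)) (x j)) ▸ hx _ _).trans ?_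
    simp
  calc _ ≤ ((n : ℝ) + 2)⁻¹ * (((n : ℝ) + 1) * D) := by gcongr
    _ = _ := by field_simp

/-- An edge of the subdivision lies in the subdivision of a face, where the constant is smaller, or
joins the barycentre to a point of the convex hull. That hull is in the ball of `dist_bary_le`
because balls are convex. -/
theorem sd_single_mem : ∀ {n : ℕ} (x : Fin (n + 1) → E) {D : ℝ}, 0 ≤ D →
    (∀ i j, dist (x i) (x j) ≤ D) → sd (fun {_} => bary) n (Finsupp.single x 1) ∈
      Finsupp.supported ℚ ℚ {y : Fin (n + 1) → E | (∀ i, y i ∈ convexHull ℝ (Set.range x)) ∧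
        ∀ i j, dist (y i) (y j) ≤ (n : ℝ) / (n + 1) * D}
  | 0, x, D, hD, hx => by
    refine Finsupp.single_mem_supported ℚ _ ⟨fun i => subset_convexHull ℝ _ ⟨i, rfl⟩, fun i j => ?_⟩
    rw [show i = j from Fin.ext (by omega)]
    simp
  | n + 1, x, D, hD, hx => by
    rw [sd_single]
    have h1 : sd (fun {_} => bary) n ((lin E).bd n (Finsupp.single x 1)) ∈
      Finsupp.supported ℚ ℚ {y : Fin (n + 1) → E | (∀ i, y i ∈ convexHull ℝ (Set.range x)) ∧
        ∀ i j, dist (y i) (y j) ≤ (n : ℝ) / (n + 1) * D} := by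
      rw [bd_single, map_sum]
      refine Submodule.sum_mem _ fun i _ => ?_
      rw [map_smul]
      refine Submodule.smul_mem _ _ ?_
      refine Finsupp.supported_mono ?_ (sd_single_mem ((lin E).face i x) hD fun _ _ => hx _ _)
      rintro y ⟨hy, hy'⟩
      refine ⟨fun k => convexHull_mono ?_ (hy k), hy'⟩
      exact Set.range_comp_subset_range i.succAbove x
    refine map_mem_of_mem_supported (fun y hy => ?_) h1
    rw [cone_single]
    have hle : (n : ℝ) / (n + 1) * D ≤ ((n : ℝ) + 1) / (n + 2) * D := by
      refine mul_le_mul_of_nonneg_right ?_ hD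
      rw [div_le_div_iff₀ (by positivity) (by positivity)]
      nlinarith
    have hb : ∀ i, dist (y i) (bary x) ≤ ((n : ℝ) + 1) / (n + 2) * D := by
      intro i
      have : convexHull ℝ (Set.range x) ⊆ Metric.closedBall (bary x) (((n : ℝ) + 1) / (n + 2) * D) := by
        refine convexHull_min ?_ (convex_closedBall _ _)
        rintro _ ⟨j, rfl⟩
        exact dist_bary_le x hx j
      exact this (hy.1 i)
    have hc : (((n + 1 : ℕ) : ℝ)) / ((n + 1 : ℕ) + 1) = ((n : ℝ) + 1) / (n + 2) := by
      push_cast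
      ring
    refine Finsupp.single_mem_supported ℚ _ ⟨?_, ?_⟩
    · intro i
      refine Fin.cases ?_ (fun k => ?_) i
      · exact bary_mem_convexHull x
      · exact hy.1 k
    · intro i j
      rw [hc]
      refine Fin.cases ?_ (fun k => ?_) i <;> refine Fin.cases ?_ (fun l => ?_) j
      · simp only [dist_self]
        positivity
      · simp only [Fin.cons_zero, Fin.cons_succ]
        rw [dist_comm]
        exact hb l
      · exact hb k
      · exact (hy.2 k l).trans hle

theorem sd_pow_single_mem {n : ℕ} (x : Fin (n + 1) → E) {D : ℝ} (hD : 0 ≤ D)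
    (hx : ∀ i j, dist (x i) (x j) ≤ D) (k : ℕ) :
    ((sd (fun {_} => bary) n) ^ k : Module.End ℚ ((lin E).Ch n)) (Finsupp.single x 1) ∈
      Finsupp.supported ℚ ℚ {y : Fin (n + 1) → E |
        ∀ i j, dist (y i) (y j) ≤ ((n : ℝ) / (n + 1)) ^ k * D} := by
  induction k with
  | zero => exact Finsupp.single_mem_supported ℚ _ (by simpa using hx)
  | succ k ih =>
    rw [pow_succ' (sd _ n), Module.End.mul_apply]
    refine map_mem_of_mem_supported (fun y hy => ?_) ih
    refine Finsupp.supported_mono ?_ (sd_single_mem y (by positivity) hy)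
    rintro w ⟨-, hw⟩ i j
    refine (hw i j).trans (le_of_eq ?_)
    ring

end mesh

end Lin

/-! ### Small singular chains -/

namespace Sing

open SemiSimp

variable {X : Type u} [TopologicalSpace X]

/-- The barycentre of points in a standard simplex. -/
noncomputable def simpBary {m n : ℕ} (x : Fin (n + 1) → Simp m) : Simp m :=
  ⟨Lin.bary fun i => (x i).1, by
    have h := Lin.bary_mem_convexHull fun i => (x i).1
    refine convexHull_min ?_ (convex_stdSimplex ℝ _) h
    rintro _ ⟨i, rfl⟩
    exact (x i).2⟩

/-- The affine simplex with given vertices in a standard simplex. -/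
noncomputable def aff {m n : ℕ} (x : Fin (n + 1) → Simp m) : C(Simp n, Simp m) :=
  ⟨fun t => ⟨∑ i, t i • (x i).1,
    (convex_stdSimplex ℝ _).sum_mem (fun i _ => stdSimplex.zero_le t i) (stdSimplex.sum_eq_one t)
      fun i _ => (x i).2⟩, by
    refine Continuous.subtype_mk (continuous_finsetSum _ fun i _ => ?_) _
    exact ((continuous_apply i).comp continuous_subtype_val).smul continuous_const⟩

theorem coe_aff {m n : ℕ} (x : Fin (n + 1) → Simp m) (t : Simp n) :
    (aff x t).1 = ∑ i, t i • (x i).1 := rfl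

theorem aff_face {m n : ℕ} (x : Fin (n + 2) → Simp m) (i : Fin (n + 2)) :
    (aff x).comp (Simp.face i) = aff (x ∘ i.succAbove) := by
  refine ContinuousMap.ext fun t => Subtype.ext ?_
  rw [ContinuousMap.comp_apply, coe_aff, coe_aff, Fin.sum_univ_succAbove _ i, Simp.face_self,
    zero_smul, zero_add]
  simp only [Simp.face_succAbove, Function.comp_apply]

theorem aff_bary {m n k : ℕ} (x : Fin (n + 1) → Simp m) (y : Fin (k + 1) → Simp n) :
    aff x (simpBary y) = simpBary (aff x ∘ y) := by
  refine Subtype.ext ?_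
  have h1 : ∀ i, simpBary y i = ((k : ℝ) + 1)⁻¹ * ∑ j, y j i := fun i => by
    change ((((k : ℝ) + 1)⁻¹ • ∑ j, (y j).1) i) = _
    rw [Pi.smul_apply, Finset.sum_apply, smul_eq_mul]
    rfl
  have h2 : (simpBary (aff x ∘ y)).1 = ((k : ℝ) + 1)⁻¹ • ∑ j, (aff x (y j)).1 := rfl
  rw [coe_aff, h2]
  simp only [coe_aff, h1]
  rw [Finset.sum_comm, Finset.smul_sum]
  refine Finset.sum_congr rfl fun i _ => ?_
  rw [← Finset.sum_smul, smul_smul]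

theorem aff_comp {m n k : ℕ} (x : Fin (n + 1) → Simp m) (y : Fin (k + 1) → Simp n) :
    (aff x).comp (aff y) = aff (aff x ∘ y) := by
  refine ContinuousMap.ext fun t => Subtype.ext ?_
  rw [ContinuousMap.comp_apply, coe_aff, coe_aff]
  simp only [Function.comp_apply, coe_aff]
  simp only [Finset.smul_sum, smul_smul]
  rw [Finset.sum_comm]
  refine Finset.sum_congr rfl fun i _ => ?_
  rw [← Finset.sum_smul]
  congr 1
  change (∑ j, t j • (y j).1) i = _
  rw [Finset.sum_apply]
  rfl

/-- The vertices of the standard simplex. -/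
noncomputable def vert (n : ℕ) : Fin (n + 1) → Simp n := fun i => stdSimplex.vertex (S := ℝ) i

theorem aff_vert_eq {m n : ℕ} (x : Fin (n + 1) → Simp m) : aff x ∘ vert n = x := by
  funext i
  refine Subtype.ext ?_
  rw [Function.comp_apply, coe_aff, Finset.sum_eq_single i]
  · simp [vert]
  · intro j _ hj
    simp [vert, Pi.single_eq_of_ne hj]
  · simp

theorem aff_vert (n : ℕ) : aff (vert n) = ContinuousMap.id _ := by
  refine ContinuousMap.ext fun t => Subtype.ext ?_
  rw [coe_aff]
  funext j
  rw [Finset.sum_apply, Finset.sum_eq_single j]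
  · simp [vert]
    rfl
  · intro i _ hi
    simp [vert, Pi.single_eq_of_ne hi.symm]
  · simp

/-- The singular simplices obtained by composing a simplex with affine simplices. -/
noncomputable def affHom {m : ℕ} (σ : C(Simp m, X)) : Hom (lin (Simp m)) (sing X) where
  app _ x := σ.comp (aff x)
  comm i x := by
    change (σ.comp (aff x)).comp (Simp.face i) = _
    rw [ContinuousMap.comp_assoc, aff_face]

theorem affHom_mem_supp {V : Set X} {m : ℕ} {σ : C(Simp m, X)} (hσ : ∀ t, σ t ∈ V) {n : ℕ}
    (z : (lin (Simp m)).Ch n) : (affHom σ).chain n z ∈ supp V n := by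
  refine map_mem_of_mem_supported (s := Set.univ) (fun x _ => ?_) (by simp)
  rw [Hom.chain_single]
  exact single_mem_supp fun t => hσ _

theorem affHom_vert {m : ℕ} (σ : C(Simp m, X)) :
    (affHom σ).chain m (Finsupp.single (vert m) 1) = Finsupp.single σ 1 := by
  rw [Hom.chain_single]
  congr 1
  change σ.comp (aff (vert m)) = σ
  rw [aff_vert, ContinuousMap.comp_id]

theorem affHom_comp {m n k : ℕ} (σ : C(Simp m, X)) (x : Fin (n + 1) → Simp m)
    (z : (lin (Simp n)).Ch k) :
    (affHom (σ.comp (aff x))).chain k z = (affHom σ).chain k ((Lin.mapHom (aff x)).chain k z) := by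
  suffices h : (affHom (σ.comp (aff x))).chain k = (affHom σ).chain k ∘ₗ (Lin.mapHom (aff x)).chain k
    from congrArg (fun F => F z) h
  refine Finsupp.lhom_ext' fun y => LinearMap.ext_ring ?_
  change (affHom (σ.comp (aff x))).chain k (Finsupp.single y 1) =
    (affHom σ).chain k ((Lin.mapHom (aff x)).chain k (Finsupp.single y 1))
  rw [Hom.chain_single, Hom.chain_single, Hom.chain_single]
  congr 1
  change (σ.comp (aff x)).comp (aff y) = σ.comp (aff (aff x ∘ y))
  rw [ContinuousMap.comp_assoc, aff_comp]

/-- Barycentric subdivision of singular chains. -/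
noncomputable def sd (n : ℕ) : (sing X).Ch n →ₗ[ℚ] (sing X).Ch n :=
  Finsupp.linearCombination ℚ fun σ : C(Simp n, X) =>
    (affHom σ).chain n (Lin.sd (fun {_} => simpBary) n (Finsupp.single (vert n) 1))

/-- The chain homotopy between the identity and barycentric subdivision. -/
noncomputable def htpy (n : ℕ) : (sing X).Ch n →ₗ[ℚ] (sing X).Ch (n + 1) :=
  Finsupp.linearCombination ℚ fun σ : C(Simp n, X) =>
    (affHom σ).chain (n + 1) (Lin.htpy (fun {_} => simpBary) n (Finsupp.single (vert n) 1))

theorem sd_single {n : ℕ} (σ : C(Simp n, X)) : sd n (Finsupp.single σ 1) =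
    (affHom σ).chain n (Lin.sd (fun {_} => simpBary) n (Finsupp.single (vert n) 1)) := by
  simp [sd]

theorem htpy_single {n : ℕ} (σ : C(Simp n, X)) : htpy n (Finsupp.single σ 1) =
    (affHom σ).chain (n + 1) (Lin.htpy (fun {_} => simpBary) n (Finsupp.single (vert n) 1)) := by
  simp [htpy]

/-- Singular subdivision is the subdivision of the identity simplex transported along σ. Affine maps
preserve barycentres, so transporting any linear chain is consistent with this definition. -/
theorem sd_affHom {m n : ℕ} (σ : C(Simp m, X)) (z : (lin (Simp m)).Ch n) :
    sd n ((affHom σ).chain n z) = (affHom σ).chain n (Lin.sd (fun {_} => simpBary) n z) := by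
  refine eq_of_mem_supported (s := Set.univ) (F := sd n ∘ₗ (affHom σ).chain n)
    (G := (affHom σ).chain n ∘ₗ Lin.sd (fun {_} => simpBary) n) (fun x _ => ?_) (by simp)
  rw [LinearMap.comp_apply, LinearMap.comp_apply, Hom.chain_single]
  change sd n (Finsupp.single (σ.comp (aff x)) 1) = _
  rw [sd_single, affHom_comp, Lin.chain_sd (fun {_} => simpBary) (fun {_} => simpBary) _
    (fun y => aff_bary x y), Hom.chain_single]
  change (affHom σ).chain n (Lin.sd (fun {_} => simpBary) n (Finsupp.single (aff x ∘ vert n) 1)) = _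
  rw [aff_vert_eq]

theorem htpy_affHom {m n : ℕ} (σ : C(Simp m, X)) (z : (lin (Simp m)).Ch n) :
    htpy n ((affHom σ).chain n z) = (affHom σ).chain (n + 1) (Lin.htpy (fun {_} => simpBary) n z) := by
  refine eq_of_mem_supported (s := Set.univ) (F := htpy n ∘ₗ (affHom σ).chain n)
    (G := (affHom σ).chain (n + 1) ∘ₗ Lin.htpy (fun {_} => simpBary) n) (fun x _ => ?_) (by simp)
  rw [LinearMap.comp_apply, LinearMap.comp_apply, Hom.chain_single]
  change htpy n (Finsupp.single (σ.comp (aff x)) 1) = _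
  rw [htpy_single, affHom_comp, Lin.chain_htpy (fun {_} => simpBary) (fun {_} => simpBary) _
    (fun y => aff_bary x y), Hom.chain_single]
  change (affHom σ).chain (n + 1)
    (Lin.htpy (fun {_} => simpBary) n (Finsupp.single (aff x ∘ vert n) 1)) = _
  rw [aff_vert_eq]

theorem bd_sd {n : ℕ} (z : (sing X).Ch (n + 1)) :
    (sing X).bd n (sd (n + 1) z) = sd n ((sing X).bd n z) := by
  refine eq_of_mem_supported (F := (sing X).bd n ∘ₗ sd (n + 1)) (G := sd n ∘ₗ (sing X).bd n)
    (fun σ _ => ?_) (mem_supp_univ z)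
  rw [LinearMap.comp_apply, LinearMap.comp_apply, sd_single, Hom.bd_chain, Lin.bd_sd, ← sd_affHom,
    ← Hom.bd_chain, affHom_vert]

theorem bd_htpy {n : ℕ} (z : (sing X).Ch (n + 1)) :
    (sing X).bd (n + 1) (htpy (n + 1) z) = z - sd (n + 1) z - htpy n ((sing X).bd n z) := by
  refine eq_of_mem_supported (F := (sing X).bd (n + 1) ∘ₗ htpy (n + 1))
    (G := LinearMap.id - sd (n + 1) - htpy n ∘ₗ (sing X).bd n)
    (fun σ _ => ?_) (mem_supp_univ z)
  rw [LinearMap.comp_apply, LinearMap.sub_apply, LinearMap.sub_apply, LinearMap.comp_apply,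
    LinearMap.id_apply, htpy_single, Hom.bd_chain, Lin.bd_htpy, map_sub, map_sub, affHom_vert,
    sd_single, ← htpy_affHom, ← Hom.bd_chain, affHom_vert]

theorem sd_mem_supp {V : Set X} {n : ℕ} {z : (sing X).Ch n} (h : z ∈ supp V n) :
    sd n z ∈ supp V n := by
  refine map_mem_of_mem_supported (fun σ hσ => ?_) h
  rw [sd_single]
  exact affHom_mem_supp hσ _

theorem htpy_mem_supp {V : Set X} {n : ℕ} {z : (sing X).Ch n} (h : z ∈ supp V n) :
    htpy n z ∈ supp V (n + 1) := by
  refine map_mem_of_mem_supported (fun σ hσ => ?_) h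
  rw [htpy_single]
  exact affHom_mem_supp hσ _

theorem sd_mem_sup {U V : Set X} {n : ℕ} {z : (sing X).Ch n} (h : z ∈ supp U n ⊔ supp V n) :
    sd n z ∈ supp U n ⊔ supp V n := by
  obtain ⟨a, ha, b, hb, rfl⟩ := Submodule.mem_sup.1 h
  rw [map_add]
  exact Submodule.add_mem_sup (sd_mem_supp ha) (sd_mem_supp hb)

theorem htpy_mem_sup {U V : Set X} {n : ℕ} {z : (sing X).Ch n} (h : z ∈ supp U n ⊔ supp V n) :
    htpy n z ∈ supp U (n + 1) ⊔ supp V (n + 1) := by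
  obtain ⟨a, ha, b, hb, rfl⟩ := Submodule.mem_sup.1 h
  rw [map_add]
  exact Submodule.add_mem_sup (htpy_mem_supp ha) (htpy_mem_supp hb)

theorem sd_pow_affHom {m n : ℕ} (σ : C(Simp m, X)) (z : (lin (Simp m)).Ch n) (k : ℕ) :
    (sd n)^[k] ((affHom σ).chain n z) =
      (affHom σ).chain n ((Lin.sd (fun {_} => simpBary) n)^[k] z) := by
  induction k generalizing z with
  | zero => rfl
  | succ k ih => rw [Function.iterate_succ_apply, Function.iterate_succ_apply, sd_affHom, ih]

theorem lin_sd_iterate_mem {n : ℕ} (k : ℕ) :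
    (Lin.sd (fun {_} => simpBary) n)^[k] (Finsupp.single (vert n) 1 : (lin (Simp n)).Ch n) ∈
      Finsupp.supported ℚ ℚ {y : Fin (n + 1) → Simp n |
        ∀ i j, dist (y i) (y j) ≤ ((n : ℝ) / (n + 1)) ^ k} := by
  have hc : ∀ z : (lin (Simp n)).Ch n,
      (Lin.mapHom (Subtype.val : Simp n → Fin (n + 1) → ℝ)).chain n
        ((Lin.sd (fun {_} => simpBary) n)^[k] z) =
      ((Lin.sd (fun {_} => Lin.bary) n) ^ k : Module.End ℚ _)
        ((Lin.mapHom (Subtype.val : Simp n → Fin (n + 1) → ℝ)).chain n z) := by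
    rw [Module.End.coe_pow]
    induction k with
    | zero => intro z; rfl
    | succ k ih =>
      intro z
      rw [Function.iterate_succ_apply, Function.iterate_succ_apply, ih]
      congr 1
      exact Lin.chain_sd (fun {_} => simpBary) (fun {_} => Lin.bary) _ (fun y => rfl) z
  have h1 := Lin.sd_pow_single_mem (fun i => (vert n i).1) zero_le_one
    (fun i j => (Metric.dist_le_diam_of_mem (bounded_stdSimplex _) (vert n i).2 (vert n j).2).trans
      diam_stdSimplex_le) k
  have h2 := hc (Finsupp.single (vert n) 1)
  rw [Hom.chain_single] at h2
  change _ = ((Lin.sd (fun {_} => Lin.bary) n) ^ k : Module.End ℚ _)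
    (Finsupp.single (fun i => (vert n i).1) 1) at h2
  rw [← h2] at h1
  rw [Finsupp.mem_supported] at h1 ⊢
  intro y hy
  -- Injectivity excludes cancellation: every simplex of the chain survives in the image chain,
  -- where the mesh bound is known.
  have hinj : Function.Injective ((Lin.mapHom (Subtype.val : Simp n → Fin (n + 1) → ℝ)).app n) := by
    intro x x' hx
    funext i
    exact Subtype.ext (congrFun hx i)
  have hy' : (Lin.mapHom (Subtype.val : Simp n → Fin (n + 1) → ℝ)).app n y ∈
      ((Lin.mapHom (Subtype.val : Simp n → Fin (n + 1) → ℝ)).chain n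
        ((Lin.sd (fun {_} => simpBary) n)^[k] (Finsupp.single (vert n) 1))).support := by
    rw [Finsupp.mem_support_iff]
    change (Finsupp.mapDomain _ _) _ ≠ 0
    rw [Finsupp.mapDomain_apply hinj]
    exact Finsupp.mem_support_iff.1 hy
  intro i j
  exact (h1 hy' i j).trans_eq (mul_one _)

theorem aff_mem_closedBall {m n : ℕ} (x : Fin (n + 1) → Simp m) {r : ℝ}
    (hx : ∀ i j, dist (x i) (x j) ≤ r) (t : Simp n) : dist (aff x t) (x 0) ≤ r := by
  have : (aff x t).1 ∈ Metric.closedBall (x 0).1 r := by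
    rw [coe_aff]
    exact (convex_closedBall _ _).sum_mem (fun i _ => stdSimplex.zero_le t i)
      (stdSimplex.sum_eq_one t) fun i _ => hx i 0
  exact this

/-- The mesh eventually drops below a Lebesgue number of the cover of the simplex by the preimages
of U and V. The bound holds for all larger exponents, so that finitely many simplices can share one
exponent. -/
theorem exists_sd_iterate_single_mem {U V : Set X} (hU : IsOpen U) (hV : IsOpen V) {n : ℕ}
    {σ : C(Simp n, X)} (hσ : ∀ t, σ t ∈ U ∪ V) :
    ∃ k, ∀ l, k ≤ l → (sd n)^[l] (Finsupp.single σ 1) ∈ supp U n ⊔ supp V n := by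
  obtain ⟨δ, hδ, hball⟩ := lebesgue_number_lemma_of_metric (s := (Set.univ : Set (Simp n)))
    (c := fun b : Bool => σ ⁻¹' (if b then U else V)) isCompact_univ
    (fun b => by
      cases b
      · exact hV.preimage σ.continuous
      · exact hU.preimage σ.continuous)
    (fun t _ => by
      rcases hσ t with h | h
      · exact Set.mem_iUnion.2 ⟨true, h⟩
      · exact Set.mem_iUnion.2 ⟨false, h⟩)
  have hlt : (n : ℝ) / (n + 1) < 1 := by
    rw [div_lt_one (by positivity)]
    linarith
  obtain ⟨k, hk⟩ := exists_pow_lt_of_lt_one hδ hlt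
  refine ⟨k, fun l hl => ?_⟩
  rw [← affHom_vert σ, sd_pow_affHom]
  refine map_mem_of_mem_supported (fun y hy => ?_) (lin_sd_iterate_mem l)
  rw [Hom.chain_single]
  have hr : ((n : ℝ) / (n + 1)) ^ l < δ :=
    (pow_le_pow_of_le_one (by positivity) hlt.le hl).trans_lt hk
  obtain ⟨b, hb⟩ := hball (y 0) (Set.mem_univ _)
  have hmem : ∀ t, aff y t ∈ σ ⁻¹' (if b then U else V) := fun t =>
    hb ((aff_mem_closedBall y hy t).trans_lt hr)
  cases b
  · exact Submodule.mem_sup_right (single_mem_supp hmem)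
  · exact Submodule.mem_sup_left (single_mem_supp hmem)

theorem exists_sd_iterate_mem {U V : Set X} (hU : IsOpen U) (hV : IsOpen V) {n : ℕ}
    {z : (sing X).Ch n} (hz : z ∈ supp (U ∪ V) n) :
    ∃ k, (sd n)^[k] z ∈ supp U n ⊔ supp V n := by
  have key : ∀ z ∈ supp (U ∪ V) n, ∃ k, ∀ l, k ≤ l →
      ((sd n) ^ l : Module.End ℚ ((sing X).Ch n)) z ∈ supp U n ⊔ supp V n := by
    intro z hz
    rw [supp, Finsupp.supported_eq_span_single] at hz
    induction hz using Submodule.span_induction with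
    | mem z hz =>
      obtain ⟨σ, hσ, rfl⟩ := hz
      obtain ⟨k, hk⟩ := exists_sd_iterate_single_mem hU hV hσ
      refine ⟨k, fun l hl => ?_⟩
      rw [Module.End.coe_pow]
      exact hk l hl
    | zero => exact ⟨0, fun l _ => by rw [map_zero]; exact zero_mem _⟩
    | add x y _ _ hx hy =>
      obtain ⟨k, hk⟩ := hx
      obtain ⟨k', hk'⟩ := hy
      refine ⟨max k k', fun l hl => ?_⟩
      rw [map_add]
      exact add_mem (hk l ((le_max_left _ _).trans hl)) (hk' l ((le_max_right _ _).trans hl))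
    | smul a x _ hx =>
      obtain ⟨k, hk⟩ := hx
      refine ⟨k, fun l hl => ?_⟩
      rw [map_smul]
      exact Submodule.smul_mem _ _ (hk l hl)
  obtain ⟨k, hk⟩ := key z hz
  refine ⟨k, ?_⟩
  have := hk k le_rfl
  rwa [Module.End.coe_pow] at this

/-- A chain in the union of two open sets, whose boundary is a sum of chains in these sets, is a sum
of chains in these sets up to a boundary. -/
theorem exists_small {U V : Set X} (hU : IsOpen U) (hV : IsOpen V) {n : ℕ}
    {z : (sing X).Ch (n + 1)} (hz : z ∈ supp (U ∪ V) (n + 1))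
    (hbd : (sing X).bd n z ∈ supp U n ⊔ supp V n) :
    ∃ t ∈ supp (U ∪ V) (n + 2), ∃ a ∈ supp U (n + 1), ∃ b ∈ supp V (n + 1),
      z = a + b + (sing X).bd (n + 1) t := by
  have hbdk : ∀ k, (sing X).bd n ((sd (n + 1))^[k] z) ∈ supp U n ⊔ supp V n := by
    intro k
    induction k with
    | zero => exact hbd
    | succ k ih =>
      rw [Function.iterate_succ_apply', bd_sd]
      exact sd_mem_sup ih
  have hk : ∀ k, (sd (n + 1))^[k] z ∈ supp (U ∪ V) (n + 1) := by
    intro k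
    induction k with
    | zero => exact hz
    | succ k ih =>
      rw [Function.iterate_succ_apply']
      exact sd_mem_supp ih
  -- Each subdivision changes z by a boundary and by the homotopy applied to the boundary of z; the
  -- latter is small because this boundary is small and stays so.
  have main : ∀ k, ∃ t ∈ supp (U ∪ V) (n + 2),
      z - (sing X).bd (n + 1) t - (sd (n + 1))^[k] z ∈ supp U (n + 1) ⊔ supp V (n + 1) := by
    intro k
    induction k with
    | zero => exact ⟨0, zero_mem _, by simp⟩
    | succ k ih =>
      obtain ⟨t, ht, h⟩ := ih
      refine ⟨t + htpy (n + 1) ((sd (n + 1))^[k] z), add_mem ht (htpy_mem_supp (hk k)), ?_⟩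
      have e := bd_htpy ((sd (n + 1))^[k] z)
      rw [Function.iterate_succ_apply', map_add, e]
      have := add_mem h (htpy_mem_sup (hbdk k))
      convert this using 1
      abel
  obtain ⟨k, hsmall⟩ := exists_sd_iterate_mem hU hV hz
  obtain ⟨t, ht, h⟩ := main k
  obtain ⟨a, ha, b, hb, hab⟩ := Submodule.mem_sup.1 (add_mem h hsmall)
  exact ⟨t, ht, a, ha, b, hb, by rw [hab]; abel⟩

end Sing

/-! ### Winding numbers of singular one-chains -/

namespace Sing

open SemiSimp

variable {X : Type u} {Y : Type v} [TopologicalSpace X] [TopologicalSpace Y]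

instance (n : ℕ) : ContractibleSpace (Simp n) :=
  (convex_stdSimplex ℝ (Fin (n + 1))).contractibleSpace ⟨_, (vert n 0).2⟩

instance (n : ℕ) : LocallyPathConnectedSpace (Simp n) :=
  (convex_stdSimplex ℝ (Fin (n + 1))).locallyPathConnectedSpace

theorem exists_log {n : ℕ} (g : C(Simp n, ℂ)) (hg : ∀ t, g t ≠ 0) :
    ∃ L : C(Simp n, ℂ), ∀ t, Complex.exp (L t) = g t := by
  obtain ⟨L, ⟨-, hL⟩, -⟩ := Complex.isCoveringMapOn_exp.existsUnique_continuousMap_lifts g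
    (a₀ := vert n 0) (Complex.exp_log (hg _)) hg
  exact ⟨L, fun t => congrFun hL t⟩

/-- Two lifts through the covering `exp`, made equal at one point by a constant, agree on the
connected simplex. Winding numbers therefore do not depend on the chosen logarithm. -/
theorem sub_eq_sub_of_exp_eq {n : ℕ} {L L' : C(Simp n, ℂ)}
    (h : ∀ t, Complex.exp (L t) = Complex.exp (L' t)) (s t : Simp n) : L t - L s = L' t - L' s := by
  have : (L : Simp n → ℂ) = fun r => L' r + (L s - L' s) := by
    refine Complex.isCoveringMap_exp.eq_of_comp_eq L.continuous (by fun_prop) ?_ s (by ring)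
    funext r
    refine Subtype.ext ?_
    change Complex.exp (L r) = Complex.exp (L' r + (L s - L' s))
    rw [Complex.exp_add, Complex.exp_sub, h s, div_self (Complex.exp_ne_zero _), mul_one, h r]
  rw [congrFun this t]
  ring

open Classical in
/-- The winding number about the origin of the composition of a path with a function. -/
noncomputable def windSimplex (f : X → ℂ) (σ : C(Simp 1, X)) : ℂ :=
  if h : ∃ L : C(Simp 1, ℂ), ∀ t, Complex.exp (L t) = f (σ t) then
    (2 * Real.pi * Complex.I)⁻¹ * (h.choose (vert 1 1) - h.choose (vert 1 0)) else 0

/-- The winding number about the origin of the composition of a one-chain with a function. -/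
noncomputable def wind (f : X → ℂ) : (sing X).Ch 1 →ₗ[ℚ] ℂ :=
  Finsupp.linearCombination ℚ (windSimplex f)

theorem wind_single {f : X → ℂ} {σ : C(Simp 1, X)} (L : C(Simp 1, ℂ))
    (hL : ∀ t, Complex.exp (L t) = f (σ t)) :
    wind f (Finsupp.single σ 1) = (2 * Real.pi * Complex.I)⁻¹ * (L (vert 1 1) - L (vert 1 0)) := by
  have h : ∃ L : C(Simp 1, ℂ), ∀ t, Complex.exp (L t) = f (σ t) := ⟨L, hL⟩
  rw [wind, Finsupp.linearCombination_single, one_smul, windSimplex, dif_pos h]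
  congr 1
  exact sub_eq_sub_of_exp_eq (fun t => (h.choose_spec t).trans (hL t).symm) _ _

theorem exists_log_comp {f : X → ℂ} {V : Set X} (hf : ContinuousOn f V) (h0 : ∀ x ∈ V, f x ≠ 0)
    {n : ℕ} {σ : C(Simp n, X)} (hσ : ∀ t, σ t ∈ V) :
    ∃ L : C(Simp n, ℂ), ∀ t, Complex.exp (L t) = f (σ t) :=
  exists_log ⟨f ∘ σ, continuous_comp hf hσ⟩ fun t => h0 _ (hσ t)

/-- A logarithm exists on the whole triangle, and its increments along the three edges cancel. -/
theorem wind_bd {f : X → ℂ} {V : Set X} (hf : ContinuousOn f V) (h0 : ∀ x ∈ V, f x ≠ 0)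
    {z : (sing X).Ch 2} (hz : z ∈ supp V 2) : wind f ((sing X).bd 1 z) = 0 := by
  refine eq_of_mem_supported (F := wind f ∘ₗ (sing X).bd 1) (G := 0) (fun σ hσ => ?_) hz
  obtain ⟨L, hL⟩ := exists_log_comp hf h0 hσ
  rw [LinearMap.comp_apply, bd_single, map_sum]
  have hw : ∀ i : Fin 3, wind f ((-1 : ℚ) ^ (i : ℕ) • Finsupp.single ((sing X).face i σ) (1 : ℚ)) =
      (-1 : ℂ) ^ (i : ℕ) * ((2 * Real.pi * Complex.I)⁻¹ *
        (L (vert 2 (i.succAbove 1)) - L (vert 2 (i.succAbove 0)))) := by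
    intro i
    rw [map_smul]
    have e := wind_single (f := f) (σ := σ.comp (Simp.face i)) (L.comp (Simp.face i))
      (fun t => hL (Simp.face i t))
    change _ • wind f (Finsupp.single (σ.comp (Simp.face i)) 1) = _
    rw [e, Rat.smul_def]
    push_cast
    congr 3
    · exact congrArg L (Simp.face_vertex i 1)
    · exact congrArg L (Simp.face_vertex i 0)
  rw [Finset.sum_congr rfl fun i _ => hw i, Fin.sum_univ_three]
  have e1 : (1 : Fin 3).succAbove (1 : Fin 2) = 2 := rfl
  have e2 : (1 : Fin 3).succAbove (0 : Fin 2) = 0 := rfl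
  have e3 : (2 : Fin 3).succAbove (1 : Fin 2) = 1 := rfl
  have e4 : (2 : Fin 3).succAbove (0 : Fin 2) = 0 := rfl
  have e5 : (0 : Fin 3).succAbove (1 : Fin 2) = 2 := rfl
  have e6 : (0 : Fin 3).succAbove (0 : Fin 2) = 1 := rfl
  rw [e1, e2, e3, e4, e5, e6]
  simp only [Fin.val_zero, Fin.val_one, Fin.val_two, LinearMap.zero_apply]
  ring

theorem wind_mul {f g : X → ℂ} {V : Set X} (hf : ContinuousOn f V) (hf0 : ∀ x ∈ V, f x ≠ 0)
    (hg : ContinuousOn g V) (hg0 : ∀ x ∈ V, g x ≠ 0) {z : (sing X).Ch 1} (hz : z ∈ supp V 1) :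
    wind (fun x => f x * g x) z = wind f z + wind g z := by
  refine eq_of_mem_supported (G := wind f + wind g) (fun σ hσ => ?_) hz
  obtain ⟨L, hL⟩ := exists_log_comp hf hf0 hσ
  obtain ⟨M, hM⟩ := exists_log_comp hg hg0 hσ
  rw [LinearMap.add_apply, wind_single L hL, wind_single M hM, wind_single (L + M) (fun t => by
    rw [ContinuousMap.add_apply, Complex.exp_add, hL, hM])]
  simp only [ContinuousMap.add_apply]
  ring

theorem wind_congr {f g : X → ℂ} {V : Set X} (hfg : Set.EqOn f g V) (hf : ContinuousOn f V)
    (hf0 : ∀ x ∈ V, f x ≠ 0) {z : (sing X).Ch 1} (hz : z ∈ supp V 1) : wind f z = wind g z := by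
  refine eq_of_mem_supported (fun σ hσ => ?_) hz
  obtain ⟨L, hL⟩ := exists_log_comp hf hf0 hσ
  rw [wind_single L hL, wind_single L fun t => (hL t).trans (hfg (hσ t))]

theorem wind_push {h : X → Y} {f : Y → ℂ} {V : Set X} (hh : ContinuousOn h V)
    (hf : ContinuousOn (f ∘ h) V) (hf0 : ∀ x ∈ V, f (h x) ≠ 0) {z : (sing X).Ch 1}
    (hz : z ∈ supp V 1) : wind f (push h 1 z) = wind (f ∘ h) z := by
  refine eq_of_mem_supported (F := wind f ∘ₗ push h 1) (fun σ hσ => ?_) hz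
  obtain ⟨L, hL⟩ := exists_log_comp hf hf0 hσ
  rw [LinearMap.comp_apply, push_single (continuous_comp hh hσ)]
  exact (wind_single (σ := ⟨h ∘ σ, continuous_comp hh hσ⟩) L hL).trans
    (wind_single (f := f ∘ h) (σ := σ) L hL).symm

/-- Evaluation of a function on zero-chains. -/
noncomputable def eval₀ (l : X → ℂ) : (sing X).Ch 0 →ₗ[ℚ] ℂ :=
  Finsupp.linearCombination ℚ fun σ : C(Simp 0, X) => l (σ (vert 0 0))

theorem eval₀_pt (l : X → ℂ) (p : X) : eval₀ l (pt p) = l p := by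
  simp [eval₀, pt]

/-- A logarithm on all of V reduces a winding number to values at the end points, which makes
explicit loops computable. -/
theorem wind_exp {f l : X → ℂ} {V : Set X} (hl : ContinuousOn l V)
    (hfl : ∀ x ∈ V, Complex.exp (l x) = f x) {z : (sing X).Ch 1} (hz : z ∈ supp V 1) :
    wind f z = (2 * Real.pi * Complex.I)⁻¹ * eval₀ l ((sing X).bd 0 z) := by
  refine eq_of_mem_supported (G := ((2 * Real.pi * Complex.I)⁻¹ : ℂ) • (eval₀ l ∘ₗ (sing X).bd 0))
    (fun σ hσ => ?_) hz
  rw [wind_single ⟨l ∘ σ, continuous_comp hl hσ⟩ fun t => hfl _ (hσ t), LinearMap.smul_apply,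
    LinearMap.comp_apply, bd_single, Fin.sum_univ_two, map_add, map_smul, map_smul, smul_eq_mul]
  have e : ∀ i : Fin 2, eval₀ l (Finsupp.single ((sing X).face i σ) 1) =
      l (σ (vert 1 (i.succAbove 0))) := by
    intro i
    simp only [eval₀, Finsupp.linearCombination_single, one_smul]
    exact congrArg (fun t => l (σ t)) (Simp.face_vertex i 0)
  rw [e, e]
  simp only [ContinuousMap.coe_mk, Function.comp_apply, Fin.val_zero, Fin.val_one, pow_zero,
    pow_one, one_smul, neg_smul]
  rw [sub_eq_add_neg]
  rfl

/-! ### The homology of a union of two star-shaped sets -/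

section union

variable {E : Type*} [NormedAddCommGroup E] [NormedSpace ℝ E] {U V N S : Set E} {p q a b : E}

/-- The loop from `a` to `b` through `q` and back through `p`. -/
noncomputable def loop (p q a b : E) : (sing E).Ch 1 :=
  cone p 0 (pt b - pt a) + cone q 0 (pt a - pt b)

theorem bd_cone_pt_sub (p a b : E) : (sing E).bd 0 (cone p 0 (pt b - pt a)) = pt b - pt a := by
  rw [bd_cone_zero, map_sub, eps_pt, eps_pt, sub_self, zero_smul, sub_zero]

theorem bd_loop (p q a b : E) : (sing E).bd 0 (loop p q a b) = 0 := by
  rw [loop, map_add, bd_cone_pt_sub, bd_cone_pt_sub]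
  abel

/-- The first homology of the union of two star-shaped open sets, whose intersection is the disjoint
union of two star-shaped open sets. -/
theorem exists_eq_loop_add_bd (hU : IsOpen U) (hV : IsOpen V) (hN : IsOpen N) (hS : IsOpen S)
    (hUV : U ∩ V = N ∪ S) (hNS : N ∩ S = ∅) (sU : StarConvex ℝ p U) (hp : p ∈ U)
    (sV : StarConvex ℝ q V) (hq : q ∈ V) (sN : StarConvex ℝ a N) (ha : a ∈ N)
    (sS : StarConvex ℝ b S) (hb : b ∈ S) {z : (sing E).Ch 1} (hz : z ∈ supp (U ∪ V) 1)
    (hbd : (sing E).bd 0 z = 0) :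
    ∃ r : ℚ, ∃ t ∈ supp (U ∪ V) 2, z = r • loop p q a b + (sing E).bd 1 t := by
  obtain ⟨t, ht, z₁, h₁, z₂, h₂, rfl⟩ := exists_small hU hV hz (by rw [hbd]; exact zero_mem _)
  rw [map_add, map_add, bd_bd, add_zero] at hbd
  have hN' : N ⊆ U ∩ V := hUV ▸ Set.subset_union_left
  have hS' : S ⊆ U ∩ V := hUV ▸ Set.subset_union_right
  -- The Mayer–Vietoris connecting map: the boundary of the U-part is minus that of the V-part,
  -- hence lives on the intersection.
  have hx : (sing E).bd 0 z₁ ∈ supp (N ∪ S) 0 := by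
    rw [← hUV, supp_inter]
    refine ⟨bd_mem_supp h₁, ?_⟩
    rw [eq_neg_of_add_eq_zero_left hbd]
    exact neg_mem (bd_mem_supp h₂)
  obtain ⟨n, hn, s, hs, hns⟩ := Submodule.mem_sup.1 (mem_sup_of_disjoint hN hS hNS hx)
  have heps : (sing E).eps n + (sing E).eps s = 0 := by
    rw [← map_add, hns, eps_bd]
  obtain ⟨y, hy, hyn⟩ := exists_bd_of_starConvex_zero sN ha hn
  obtain ⟨y', hy', hys⟩ := exists_bd_of_starConvex_zero sS hb hs
  have hyU : y + y' ∈ supp (U ∩ V) 1 := add_mem (supp_mono hN' _ hy) (supp_mono hS' _ hy')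
  have hyU' := supp_mono Set.inter_subset_left _ hyU
  have hyV' := supp_mono Set.inter_subset_right _ hyU
  -- The N- and S-parts have opposite augmentations, so ∂z₁ is homologous in U ∩ V to r (b - a).
  -- This is the boundary of r times the half of the loop in U, and the two corrected halves bound
  -- in the star-shaped sets.
  set r := (sing E).eps s with hr
  have hen : (sing E).eps n = - r := eq_neg_of_add_eq_zero_left heps
  have hc₁ : cone p 0 (pt b - pt a) ∈ supp U 1 := cone_mem_supp sU hp
    (sub_mem (pt_mem_supp (hS' hb).1) (pt_mem_supp (hN' ha).1))
  have hc₂ : cone q 0 (pt a - pt b) ∈ supp V 1 := cone_mem_supp sV hq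
    (sub_mem (pt_mem_supp (hN' ha).2) (pt_mem_supp (hS' hb).2))
  have hxy : (sing E).bd 0 (y + y') = (sing E).bd 0 z₁ - r • (pt b - pt a) := by
    rw [map_add, hyn, hys, hen, ← hns]
    module
  obtain ⟨w₁, hw₁, e₁⟩ := exists_bd_of_starConvex sU hp
    (z := z₁ - r • cone p 0 (pt b - pt a) - (y + y'))
    (sub_mem (sub_mem h₁ (Submodule.smul_mem _ _ hc₁)) hyU')
    (by rw [map_sub, map_sub, hxy, map_smul, bd_cone_pt_sub, sub_self])
  obtain ⟨w₂, hw₂, e₂⟩ := exists_bd_of_starConvex sV hq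
    (z := z₂ - r • cone q 0 (pt a - pt b) + (y + y'))
    (add_mem (sub_mem h₂ (Submodule.smul_mem _ _ hc₂)) hyV')
    (by
      rw [map_add, map_sub, hxy, map_smul, bd_cone_pt_sub, eq_neg_of_add_eq_zero_right hbd]
      module)
  refine ⟨r, w₁ + w₂ + t, add_mem (add_mem (supp_mono Set.subset_union_left _ hw₁)
    (supp_mono Set.subset_union_right _ hw₂)) ht, ?_⟩
  rw [map_add, map_add, e₁, e₂, loop]
  module

/-- The higher homology of the union of two star-shaped open sets, whose intersection is the
disjoint union of two star-shaped open sets. -/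
theorem exists_bd_of_union (hU : IsOpen U) (hV : IsOpen V) (hN : IsOpen N) (hS : IsOpen S)
    (hUV : U ∩ V = N ∪ S) (hNS : N ∩ S = ∅) (sU : StarConvex ℝ p U) (hp : p ∈ U)
    (sV : StarConvex ℝ q V) (hq : q ∈ V) (sN : StarConvex ℝ a N) (ha : a ∈ N)
    (sS : StarConvex ℝ b S) (hb : b ∈ S) {i : ℕ} {z : (sing E).Ch (i + 2)}
    (hz : z ∈ supp (U ∪ V) (i + 2)) (hbd : (sing E).bd (i + 1) z = 0) :
    ∃ t ∈ supp (U ∪ V) (i + 3), z = (sing E).bd (i + 2) t := by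
  obtain ⟨t, ht, z₁, h₁, z₂, h₂, rfl⟩ := exists_small hU hV hz (by rw [hbd]; exact zero_mem _)
  rw [map_add, map_add, bd_bd, add_zero] at hbd
  have hN' : N ⊆ U ∩ V := hUV ▸ Set.subset_union_left
  have hS' : S ⊆ U ∩ V := hUV ▸ Set.subset_union_right
  have hx : (sing E).bd (i + 1) z₁ ∈ supp (N ∪ S) (i + 1) := by
    rw [← hUV, supp_inter]
    refine ⟨bd_mem_supp h₁, ?_⟩
    rw [eq_neg_of_add_eq_zero_left hbd]
    exact neg_mem (bd_mem_supp h₂)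
  obtain ⟨n, hn, s, hs, hns⟩ := Submodule.mem_sup.1 (mem_sup_of_disjoint hN hS hNS hx)
  have hsum : (sing E).bd i n + (sing E).bd i s = 0 := by
    rw [← map_add, hns, bd_bd]
  -- Since ∂n = -∂s, this chain is supported both in N and in S, which are disjoint.
  have hn0 : (sing E).bd i n = 0 := by
    refine eq_zero_of_mem_supp_empty ?_
    rw [← hNS, supp_inter]
    refine ⟨bd_mem_supp hn, ?_⟩
    rw [eq_neg_of_add_eq_zero_left hsum]
    exact neg_mem (bd_mem_supp hs)
  have hs0 : (sing E).bd i s = 0 := by rwa [hn0, zero_add] at hsum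
  obtain ⟨y, hy, hyn⟩ := exists_bd_of_starConvex sN ha hn hn0
  obtain ⟨y', hy', hys⟩ := exists_bd_of_starConvex sS hb hs hs0
  have hyU : y + y' ∈ supp (U ∩ V) (i + 2) := add_mem (supp_mono hN' _ hy) (supp_mono hS' _ hy')
  have hxy : (sing E).bd (i + 1) (y + y') = (sing E).bd (i + 1) z₁ := by
    rw [map_add, hyn, hys, hns]
  obtain ⟨w₁, hw₁, e₁⟩ := exists_bd_of_starConvex sU hp (z := z₁ - (y + y'))
    (sub_mem h₁ (supp_mono Set.inter_subset_left _ hyU)) (by rw [map_sub, hxy, sub_self])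
  obtain ⟨w₂, hw₂, e₂⟩ := exists_bd_of_starConvex sV hq (z := z₂ + (y + y'))
    (add_mem h₂ (supp_mono Set.inter_subset_right _ hyU))
    (by rw [map_add, hxy, add_comm ((sing E).bd (i + 1) z₂), hbd])
  refine ⟨w₁ + w₂ + t, add_mem (add_mem (supp_mono Set.subset_union_left _ hw₁)
    (supp_mono Set.subset_union_right _ hw₂)) ht, ?_⟩
  rw [map_add, map_add, e₁, e₂]
  abel

end union

/-! ### The homology of the complement of a rectangle -/

section rect

variable {a b c d : ℝ}

/-- The complement is a union of two L-shaped regions, star-shaped about the upper left and lower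
right corner points, which meet in two opposite quadrants. This is the configuration of
`exists_eq_loop_add_bd` and `exists_bd_of_union`. -/
theorem rect_compl (a b c d : ℝ) : (Set.Icc a b ×ℂ Set.Icc c d)ᶜ =
    {z : ℂ | z.re < a} ∪ {z | d < z.im} ∪ ({z | b < z.re} ∪ {z | z.im < c}) := by
  ext z
  simp only [Set.mem_compl_iff, Complex.mem_reProdIm, Set.mem_Icc, Set.mem_union, Set.mem_ofPred_eq,
    not_and_or, not_le]
  tauto

theorem rect_inter (hab : a ≤ b) (hcd : c ≤ d) :
    ({z : ℂ | z.re < a} ∪ {z | d < z.im}) ∩ ({z | b < z.re} ∪ {z | z.im < c}) =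
      ({z | b < z.re} ∩ {z | d < z.im}) ∪ ({z | z.re < a} ∩ {z | z.im < c}) := by
  ext z
  simp only [Set.mem_inter_iff, Set.mem_union, Set.mem_ofPred_eq]
  constructor
  · rintro ⟨h1 | h1, h2 | h2⟩
    · linarith
    · exact Or.inr ⟨h1, h2⟩
    · exact Or.inl ⟨h2, h1⟩
    · linarith
  · rintro (⟨h1, h2⟩ | ⟨h1, h2⟩)
    · exact ⟨Or.inr h2, Or.inl h1⟩
    · exact ⟨Or.inl h1, Or.inr h2⟩

theorem rect_inter_inter (hab : a ≤ b) :
    ({z : ℂ | b < z.re} ∩ {z | d < z.im}) ∩ ({z | z.re < a} ∩ {z | z.im < c}) = ∅ := by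
  ext z
  simp only [Set.mem_inter_iff, Set.mem_ofPred_eq, Set.mem_empty_iff_false, iff_false]
  rintro ⟨⟨h1, -⟩, h2, -⟩
  linarith

/-- A loop winding once around a rectangle. -/
noncomputable def rectLoop (a b c d : ℝ) : (sing ℂ).Ch 1 :=
  loop (⟨a - 1, d + 1⟩ : ℂ) ⟨b + 1, c - 1⟩ ⟨b + 1, d + 1⟩ ⟨a - 1, c - 1⟩

theorem starConvex_rect_left (a d : ℝ) :
    StarConvex ℝ (⟨a - 1, d + 1⟩ : ℂ) ({z : ℂ | z.re < a} ∪ {z | d < z.im}) :=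
  StarConvex.union ((convex_halfSpace_re_lt a).starConvex (by simp))
    ((convex_halfSpace_im_gt d).starConvex (by simp))

theorem starConvex_rect_right (b c : ℝ) :
    StarConvex ℝ (⟨b + 1, c - 1⟩ : ℂ) ({z : ℂ | b < z.re} ∪ {z | z.im < c}) :=
  StarConvex.union ((convex_halfSpace_re_gt b).starConvex (by simp))
    ((convex_halfSpace_im_lt c).starConvex (by simp))

theorem isOpen_re_lt (a : ℝ) : IsOpen {z : ℂ | z.re < a} := isOpen_lt Complex.continuous_re continuous_const
theorem isOpen_lt_re (a : ℝ) : IsOpen {z : ℂ | a < z.re} := isOpen_lt continuous_const Complex.continuous_re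
theorem isOpen_im_lt (a : ℝ) : IsOpen {z : ℂ | z.im < a} := isOpen_lt Complex.continuous_im continuous_const
theorem isOpen_lt_im (a : ℝ) : IsOpen {z : ℂ | a < z.im} := isOpen_lt continuous_const Complex.continuous_im

theorem exists_eq_rectLoop_add_bd (hab : a ≤ b) (hcd : c ≤ d) {z : (sing ℂ).Ch 1}
    (hz : z ∈ supp (Set.Icc a b ×ℂ Set.Icc c d)ᶜ 1) (hbd : (sing ℂ).bd 0 z = 0) :
    ∃ r : ℚ, ∃ t ∈ supp (Set.Icc a b ×ℂ Set.Icc c d)ᶜ 2,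
      z = r • rectLoop a b c d + (sing ℂ).bd 1 t := by
  rw [rect_compl] at hz ⊢
  exact exists_eq_loop_add_bd ((isOpen_re_lt a).union (isOpen_lt_im d))
    ((isOpen_lt_re b).union (isOpen_im_lt c)) ((isOpen_lt_re b).inter (isOpen_lt_im d))
    ((isOpen_re_lt a).inter (isOpen_im_lt c)) (rect_inter hab hcd) (rect_inter_inter hab)
    (starConvex_rect_left a d) (by simp) (starConvex_rect_right b c) (by simp)
    (((convex_halfSpace_re_gt b).inter (convex_halfSpace_im_gt d)).starConvex (by simp)) (by simp)
    (((convex_halfSpace_re_lt a).inter (convex_halfSpace_im_lt c)).starConvex (by simp)) (by simp)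
    hz hbd

theorem exists_bd_of_rect (hab : a ≤ b) (hcd : c ≤ d) {i : ℕ} {z : (sing ℂ).Ch (i + 2)}
    (hz : z ∈ supp (Set.Icc a b ×ℂ Set.Icc c d)ᶜ (i + 2)) (hbd : (sing ℂ).bd (i + 1) z = 0) :
    ∃ t ∈ supp (Set.Icc a b ×ℂ Set.Icc c d)ᶜ (i + 3), z = (sing ℂ).bd (i + 2) t := by
  rw [rect_compl] at hz ⊢
  exact exists_bd_of_union (a := (⟨b + 1, d + 1⟩ : ℂ)) (b := ⟨a - 1, c - 1⟩) ((isOpen_re_lt a).union (isOpen_lt_im d))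
    ((isOpen_lt_re b).union (isOpen_im_lt c)) ((isOpen_lt_re b).inter (isOpen_lt_im d))
    ((isOpen_re_lt a).inter (isOpen_im_lt c)) (rect_inter hab hcd) (rect_inter_inter hab)
    (starConvex_rect_left a d) (by simp) (starConvex_rect_right b c) (by simp)
    (((convex_halfSpace_re_gt b).inter (convex_halfSpace_im_gt d)).starConvex (by simp)) (by simp)
    (((convex_halfSpace_re_lt a).inter (convex_halfSpace_im_lt c)).starConvex (by simp)) (by simp)
    hz hbd

theorem rectLoop_mem :
    rectLoop a b c d ∈ supp (Set.Icc a b ×ℂ Set.Icc c d)ᶜ 1 := by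
  rw [rect_compl]
  refine add_mem (supp_mono Set.subset_union_left _ (cone_mem_supp (starConvex_rect_left a d)
    (by simp) (sub_mem (pt_mem_supp ?_) (pt_mem_supp ?_))))
    (supp_mono Set.subset_union_right _ (cone_mem_supp (starConvex_rect_right b c)
    (by simp) (sub_mem (pt_mem_supp ?_) (pt_mem_supp ?_)))) <;> simp

theorem bd_rectLoop : (sing ℂ).bd 0 (rectLoop a b c d) = 0 := bd_loop _ _ _ _

theorem wind_rectLoop {x : ℂ} (hx : x ∈ Set.Icc a b ×ℂ Set.Icc c d) :
    wind (fun z => z - x) (rectLoop a b c d) = 1 := by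
  obtain ⟨⟨h1, h2⟩, h3, h4⟩ : (a ≤ x.re ∧ x.re ≤ b) ∧ c ≤ x.im ∧ x.im ≤ d := hx
  -- Multiplication by u sends the diagonal ray from x to the upper left onto the negative real
  -- axis. The lower right region avoids this ray, so the principal logarithm of u (z - x) is
  -- continuous there; -u plays the same role for the upper left region.
  set u : ℂ := 1 + Complex.I with hu
  have hu0 : u ≠ 0 := by
    intro h
    have := congrArg Complex.re h
    simp [hu] at this
  have hre : ∀ w : ℂ, (u * w).re = w.re - w.im := by intro w; simp [hu]
  have him : ∀ w : ℂ, (u * w).im = w.re + w.im := by intro w; simp [hu]; ring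
  have key : ∀ (p s t : ℂ) (v : ℂ) (V : Set ℂ), v ≠ 0 → StarConvex ℝ p V → p ∈ V → s ∈ V → t ∈ V →
      (∀ z ∈ V, v * (z - x) ∈ Complex.slitPlane) →
      wind (fun z => z - x) (cone p 0 (pt t - pt s)) = (2 * Real.pi * Complex.I)⁻¹ *
        (Complex.log (v * (t - x)) - Complex.log (v * (s - x))) := by
    intro p s t v V hv sV hp hs ht hV
    rw [wind_exp (V := V) (l := fun z => Complex.log (v * (z - x)) - Complex.log v), bd_cone_pt_sub,
      map_sub, eval₀_pt, eval₀_pt]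
    · ring
    · refine ContinuousOn.sub (ContinuousOn.clog (by fun_prop) hV) continuousOn_const
    · intro z hz
      have : v * (z - x) ≠ 0 := Complex.slitPlane_ne_zero (hV z hz)
      rw [Complex.exp_sub, Complex.exp_log this, Complex.exp_log hv]
      field_simp
    · exact cone_mem_supp sV hp (sub_mem (pt_mem_supp ht) (pt_mem_supp hs))
  rw [rectLoop, loop, map_add,
    key _ _ _ (-u) ({z : ℂ | z.re < a} ∪ {z | d < z.im}) (neg_ne_zero.2 hu0)
      (starConvex_rect_left a d) (by simp) (by simp) (by simp) ?_,
    key _ _ _ u ({z : ℂ | b < z.re} ∪ {z | z.im < c}) hu0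
      (starConvex_rect_right b c) (by simp) (by simp) (by simp) ?_]
  · set P : ℂ := ⟨b + 1, d + 1⟩ - x with hP
    set Q : ℂ := ⟨a - 1, c - 1⟩ - x with hQ
    have hPi : 0 < (u * P).im := by
      rw [him]
      simp only [hP, Complex.sub_re, Complex.sub_im]
      linarith
    have hQi : (u * Q).im < 0 := by
      rw [him]
      simp only [hQ, Complex.sub_re, Complex.sub_im]
      linarith
    -- The two branches differ by -πi at P and by πi at Q, so the total change along the loop is
    -- 2πi.
    have l1 : Complex.log (-u * P) = Complex.log (u * P) - Real.pi * Complex.I := by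
      rw [neg_mul, Complex.log, Complex.log, norm_neg, Complex.arg_neg_eq_arg_sub_pi_of_im_pos hPi]
      push_cast
      ring
    have l2 : Complex.log (-u * Q) = Complex.log (u * Q) + Real.pi * Complex.I := by
      rw [neg_mul, Complex.log, Complex.log, norm_neg, Complex.arg_neg_eq_arg_add_pi_of_im_neg hQi]
      push_cast
      ring
    rw [l1, l2]
    have hpi : (2 * Real.pi * Complex.I : ℂ) ≠ 0 := Complex.two_pi_I_ne_zero
    rw [← mul_add, inv_mul_eq_iff_eq_mul₀ hpi]
    ring
  · intro z hz
    rw [Complex.mem_slitPlane_iff, hre, him]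
    simp only [Complex.sub_re, Complex.sub_im]
    by_contra hcon
    push Not at hcon
    obtain ⟨k1, k2⟩ := hcon
    rcases hz with hz | hz <;> simp only [Set.mem_ofPred_eq] at hz <;> linarith
  · intro z hz
    rw [neg_mul, Complex.mem_slitPlane_iff, Complex.neg_re, Complex.neg_im, hre, him]
    simp only [Complex.sub_re, Complex.sub_im]
    by_contra hcon
    push Not at hcon
    obtain ⟨k1, k2⟩ := hcon
    rcases hz with hz | hz <;> simp only [Set.mem_ofPred_eq] at hz <;> linarith

end rect

end Sing

/-! ### The local degree of relative two-cycles of a Riemann surface -/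

namespace Sing

open SemiSimp

/-! ### Excision for singular chains -/

section excision

variable {X : Type u} [TopologicalSpace X]

/-- Smallness for the cover by U and the complement of A moves a relative cycle into U: surjectivity
of excision. -/
theorem exists_excision {A U : Set X} (hA : IsClosed A) (hU : IsOpen U) (hAU : A ⊆ U) {n : ℕ}
    {z : (sing X).Ch (n + 1)} (hz : (sing X).bd n z ∈ supp Aᶜ n) :
    ∃ z' ∈ supp U (n + 1), ∃ w, ∃ t ∈ supp Aᶜ (n + 1), z = z' + (sing X).bd (n + 1) w + t := by
  have huniv : U ∪ Aᶜ = Set.univ := by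
    rw [Set.eq_univ_iff_forall]
    intro x
    by_cases hx : x ∈ A
    · exact Or.inl (hAU hx)
    · exact Or.inr hx
  obtain ⟨w, -, z', hz', t, ht, e⟩ := exists_small hU hA.isOpen_compl (z := z)
    (huniv ▸ mem_supp_univ z) (Submodule.mem_sup_right hz)
  exact ⟨z', hz', w, t, ht, by rw [e]; abel⟩

/-- Injectivity of excision: the bounding chain w has small boundary z - t, so it can itself be
split, and its part off A contributes to m. -/
theorem exists_excision_bd {A U : Set X} (hA : IsClosed A) (hU : IsOpen U) (hAU : A ⊆ U) {n : ℕ}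
    {z t : (sing X).Ch (n + 1)} {w : (sing X).Ch (n + 2)} (hz : z ∈ supp U (n + 1))
    (ht : t ∈ supp Aᶜ (n + 1)) (e : z = (sing X).bd (n + 1) w + t) :
    ∃ w' ∈ supp U (n + 2), ∃ m ∈ supp (U ∩ Aᶜ) (n + 1), z = (sing X).bd (n + 1) w' + m := by
  have huniv : U ∪ Aᶜ = Set.univ := by
    rw [Set.eq_univ_iff_forall]
    intro x
    by_cases hx : x ∈ A
    · exact Or.inl (hAU hx)
    · exact Or.inr hx
  obtain ⟨s, -, w', hw', t', ht', e'⟩ := exists_small hU hA.isOpen_compl (z := w)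
    (huniv ▸ mem_supp_univ w) (by
      rw [eq_sub_of_add_eq e.symm]
      exact sub_mem (Submodule.mem_sup_left hz) (Submodule.mem_sup_right ht))
  refine ⟨w', hw', (sing X).bd (n + 1) t' + t, ?_, ?_⟩
  · rw [supp_inter]
    refine ⟨?_, add_mem (bd_mem_supp ht') ht⟩
    have : (sing X).bd (n + 1) t' + t = z - (sing X).bd (n + 1) w' := by
      rw [e, e', map_add, map_add, bd_bd]
      abel
    rw [this]
    exact sub_mem hz (bd_mem_supp hw')
  · rw [e, e', map_add, map_add, bd_bd]
    abel

end excision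

/-! ### Local degree as a winding number in a coordinate -/

section degree

variable {M : Type u} [TopologicalSpace M] [ChartedSpace ℂ M]

/-- The chart at `x`, centred at `x`. -/
noncomputable def cchart (x : M) : M → ℂ := fun y => chartAt ℂ x y - chartAt ℂ x x

/-- A function on `U` vanishing at most at `x`, which near `x` is a coordinate centred at `x`, up to
a unit. -/
structure IsCoord (x : M) (U : Set M) (f : M → ℂ) : Prop where
  continuousOn : ContinuousOn f U
  ne_zero : ∀ y ∈ U, y ≠ x → f y ≠ 0
  exists_unit : ∃ O, IsOpen O ∧ x ∈ O ∧ ∃ k : M → ℂ, ContinuousOn k O ∧ (∀ y ∈ O, k y ≠ 0) ∧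
    ∀ y ∈ O, f y = k y * cchart x y

theorem isCoord_cchart (x : M) : IsCoord x (chartAt ℂ x).source (cchart x) where
  continuousOn := (chartAt ℂ x).continuousOn.sub continuousOn_const
  ne_zero y hy hne := by
    rw [cchart, sub_ne_zero]
    exact fun h => hne ((chartAt ℂ x).injOn hy (mem_chart_source ℂ x) h)
  exists_unit := ⟨Set.univ, isOpen_univ, trivial, 1, continuousOn_const, fun _ _ => one_ne_zero,
    fun _ _ => (one_mul _).symm⟩

variable (M) in
/-- The relative two-chain `z` has local degree `q` at `x`. -/
def HasDeg (x : M) (z : (sing M).Ch 2) (q : ℂ) : Prop :=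
  (sing M).bd 1 z ∈ supp {x}ᶜ 1 ∧ ∃ z' ∈ supp (chartAt ℂ x).source 2, ∃ w, ∃ t ∈ supp {x}ᶜ 2,
    z = z' + (sing M).bd 2 w + t ∧ wind (cchart x) ((sing M).bd 1 z') = q

omit [ChartedSpace ℂ M] in
theorem bd_mem_of_eq {x : M} {z z' t : (sing M).Ch 2} {w : (sing M).Ch 3}
    (hz : (sing M).bd 1 z ∈ supp {x}ᶜ 1) (ht : t ∈ supp {x}ᶜ 2) (e : z = z' + (sing M).bd 2 w + t) :
    (sing M).bd 1 z' ∈ supp {x}ᶜ 1 := by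
  have : (sing M).bd 1 z' = (sing M).bd 1 z - (sing M).bd 1 t := by
    rw [e, map_add, map_add, bd_bd]
    abel
  rw [this]
  exact sub_mem hz (bd_mem_supp ht)

variable [T2Space M]

/-- Two representatives differ by a relative boundary, which excision places in U. The boundary of
the difference thus bounds in U minus x, where f does not vanish. -/
theorem IsCoord.wind_eq_of_subset {x : M} {U O : Set M} {f : M → ℂ} (h : IsCoord x U f)
    (hU : IsOpen U) (hxU : x ∈ U) (hO : O ⊆ U) {z' o t t' : (sing M).Ch 2} {w w' : (sing M).Ch 3}
    (hz' : z' ∈ supp U 2) (ho : o ∈ supp O 2) (ht : t ∈ supp {x}ᶜ 2) (ht' : t' ∈ supp {x}ᶜ 2)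
    (e : z' + (sing M).bd 2 w + t = o + (sing M).bd 2 w' + t') :
    wind f ((sing M).bd 1 z') = wind f ((sing M).bd 1 o) := by
  obtain ⟨w₁, hw₁, m, hm, e₁⟩ := exists_excision_bd (A := {x}) (U := U) isClosed_singleton hU
    (Set.singleton_subset_iff.2 hxU) (z := z' - o) (t := t' - t) (w := w' - w)
    (sub_mem hz' (supp_mono hO _ ho)) (sub_mem ht' ht) (by
      rw [map_sub]
      rw [← sub_eq_zero] at e ⊢
      rw [← e]
      abel)
  rw [← sub_eq_zero, ← map_sub, ← map_sub, e₁, map_add, bd_bd, zero_add]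
  exact wind_bd (h.continuousOn.mono Set.inter_subset_left) (fun y hy => h.ne_zero y hy.1 hy.2) hm

/-- The degree may be computed in any coordinate. -/
theorem IsCoord.hasDeg {x : M} {U : Set M} {f : M → ℂ} (h : IsCoord x U f)
    (hU : IsOpen U) (hxU : x ∈ U) {z z' t : (sing M).Ch 2} {w : (sing M).Ch 3}
    (hz : (sing M).bd 1 z ∈ supp {x}ᶜ 1) (hz' : z' ∈ supp U 2)
    (ht : t ∈ supp {x}ᶜ 2) (e : z = z' + (sing M).bd 2 w + t) :
    HasDeg M x z (wind f ((sing M).bd 1 z')) := by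
  obtain ⟨O', hO', hxO', k, hk, hk0, hkf⟩ := h.exists_unit
  set O : Set M := U ∩ (chartAt ℂ x).source ∩ O' with hOdef
  have hO : IsOpen O := (hU.inter (chartAt ℂ x).open_source).inter hO'
  have hxO : x ∈ O := ⟨⟨hxU, mem_chart_source ℂ x⟩, hxO'⟩
  -- The representative is shrunk to a neighbourhood where f is a unit times the preferred
  -- coordinate.
  obtain ⟨o, ho, w', t', ht', e'⟩ := exists_excision isClosed_singleton hO
    (Set.singleton_subset_iff.2 hxO) hz
  refine ⟨hz, o, supp_mono (fun y hy => hy.1.2) _ ho, w', t', ht', e', ?_⟩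
  rw [h.wind_eq_of_subset hU hxU (fun y hy => hy.1.1) hz' ho ht ht' (e.symm.trans e')]
  have hbo : (sing M).bd 1 o ∈ supp (O ∩ {x}ᶜ) 1 := by
    rw [supp_inter]
    exact ⟨bd_mem_supp ho, bd_mem_of_eq hz ht' e'⟩
  have hc := isCoord_cchart x
  have hkO : ContinuousOn k O := hk.mono fun y hy => hy.2
  have hcO : ContinuousOn (cchart x) O := hc.continuousOn.mono fun y hy => hy.1.2
  have e1 : wind f ((sing M).bd 1 o) = wind (fun y => k y * cchart x y) ((sing M).bd 1 o) :=
    wind_congr (fun y hy => hkf y hy.1.2)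
      (h.continuousOn.mono fun y hy => hy.1.1.1) (fun y hy => h.ne_zero y hy.1.1.1 hy.2) hbo
  -- The chain o lies where the unit k has no zero, not even at x, so the boundary of o has winding
  -- number zero under k.
  rw [e1, wind_mul (hkO.mono Set.inter_subset_left) (fun y hy => hk0 y hy.1.2)
    (hcO.mono Set.inter_subset_left) (fun y hy => hc.ne_zero y hy.1.1.2 hy.2) hbo,
    wind_bd hkO (fun y hy => hk0 y hy.2) ho, zero_add]

theorem HasDeg.unique {x : M} {z : (sing M).Ch 2} {q q' : ℂ} (h : HasDeg M x z q)
    (h' : HasDeg M x z q') : q = q' := by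
  obtain ⟨hz, z', hz', w, t, ht, e, rfl⟩ := h
  obtain ⟨-, y', hy', w', t', ht', e', rfl⟩ := h'
  exact (isCoord_cchart x).wind_eq_of_subset (chartAt ℂ x).open_source (mem_chart_source ℂ x)
    le_rfl hz' hy' ht ht' (e.symm.trans e')

omit [T2Space M] in
theorem HasDeg.add {x : M} {z z' : (sing M).Ch 2} {q q' : ℂ} (h : HasDeg M x z q)
    (h' : HasDeg M x z' q') : HasDeg M x (z + z') (q + q') := by
  obtain ⟨hz, y, hy, w, t, ht, e, rfl⟩ := h
  obtain ⟨hz', y', hy', w', t', ht', e', rfl⟩ := h'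
  refine ⟨?_, y + y', add_mem hy hy', w + w', t + t', add_mem ht ht', ?_, ?_⟩
  · rw [map_add]
    exact add_mem hz hz'
  · rw [e, e', map_add]
    abel
  · rw [map_add, map_add]

omit [T2Space M] in
theorem HasDeg.smul {x : M} {z : (sing M).Ch 2} {q : ℂ} (h : HasDeg M x z q) (r : ℚ) :
    HasDeg M x (r • z) (r * q) := by
  obtain ⟨hz, y, hy, w, t, ht, e, rfl⟩ := h
  refine ⟨?_, r • y, Submodule.smul_mem _ _ hy, r • w, r • t, Submodule.smul_mem _ _ ht, ?_, ?_⟩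
  · rw [map_smul]
    exact Submodule.smul_mem _ _ hz
  · rw [e, map_smul, smul_add, smul_add]
  · rw [map_smul, map_smul, Rat.smul_def]

omit [T2Space M] in
theorem HasDeg.sub {x : M} {z z' : (sing M).Ch 2} {q q' : ℂ} (h : HasDeg M x z q)
    (h' : HasDeg M x z' q') : HasDeg M x (z - z') (q - q') := by
  have := h.add (h'.smul (-1))
  convert this using 1
  · module
  · push_cast
    ring

omit [T2Space M] in
theorem hasDeg_of_eq {x : M} {t : (sing M).Ch 2} {w : (sing M).Ch 3} (ht : t ∈ supp {x}ᶜ 2) :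
    HasDeg M x ((sing M).bd 2 w + t) 0 := by
  refine ⟨?_, 0, zero_mem _, w, t, ht, by rw [zero_add], by rw [map_zero, map_zero]⟩
  rw [map_add, bd_bd, zero_add]
  exact bd_mem_supp ht

end degree

/-! #### Holomorphic coordinates -/

section holomorphic

variable {M : Type u} [TopologicalSpace M] [ChartedSpace ℂ M] [IsManifold 𝓘(ℂ) ω M]

/-- A holomorphic left inverse forces the derivative of f in the chart to be nonzero. The difference
quotient, completed by this derivative at x, is then the required continuous unit. -/
theorem isCoord_of_mdifferentiableAt {x : M} {f : M → ℂ} {h : ℂ → M} {U : Set M} (hU : IsOpen U)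
    (hxU : x ∈ U) (hf : ContinuousOn f U) (hinj : ∀ y ∈ U, y ≠ x → f y ≠ f x)
    (hd : MDifferentiableAt 𝓘(ℂ) 𝓘(ℂ) f x) (hd' : MDifferentiableAt 𝓘(ℂ) 𝓘(ℂ) h (f x))
    (hfh : ∀ᶠ y in nhds x, h (f y) = y) : IsCoord x U (fun y => f y - f x) := by
  set φ := chartAt ℂ x with hφ
  have hx : x ∈ φ.source := mem_chart_source ℂ x
  have hsx : φ.symm (φ x) = x := φ.left_inv hx
  have : IsManifold 𝓘(ℂ) 1 M := IsManifold.of_le (n := ω) le_top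
  set F : ℂ → ℂ := f ∘ φ.symm with hF
  have hFx : F (φ x) = f x := by simp [hF, hsx]
  have hFd : DifferentiableAt ℂ F (φ x) := by
    rw [← mdifferentiableAt_iff_differentiableAt]
    refine MDifferentiableAt.comp (I' := 𝓘(ℂ)) (φ x) ?_ ?_
    · rwa [hsx]
    · exact mdifferentiableAt_atlas_symm (chart_mem_atlas ℂ x) (φ.map_source hx)
  have hGd : DifferentiableAt ℂ (φ ∘ h) (F (φ x)) := by
    rw [← mdifferentiableAt_iff_differentiableAt, hFx]
    refine MDifferentiableAt.comp (I' := 𝓘(ℂ)) (f x) ?_ hd'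
    rw [hfh.self_of_nhds]
    exact mdifferentiableAt_atlas (chart_mem_atlas ℂ x) hx
  have hcomp : (φ ∘ h) ∘ F =ᶠ[nhds (φ x)] id := by
    have hc : Filter.Tendsto φ.symm (nhds (φ x)) (nhds x) := by
      have := (φ.continuousAt_symm (φ.map_source hx)).tendsto
      rwa [hsx] at this
    filter_upwards [hc.eventually hfh, φ.open_target.mem_nhds (φ.map_source hx)] with y hy hyt
    simp only [hF, Function.comp_apply, hy, id]
    exact φ.right_inv hyt
  have hne : deriv F (φ x) ≠ 0 := by
    intro h0
    have h1 := (hGd.hasDerivAt.comp (φ x) hFd.hasDerivAt)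
    rw [h0, mul_zero] at h1
    have h2 := h1.congr_of_eventuallyEq hcomp.symm
    exact zero_ne_one (h2.unique (hasDerivAt_id _))
  set O := U ∩ φ.source with hO
  have hOo : IsOpen O := hU.inter φ.open_source
  have him : IsOpen (φ '' O) := φ.isOpen_image_of_subset_source hOo Set.inter_subset_right
  have hFc : ContinuousOn F (φ '' O) := by
    refine hf.comp (φ.continuousOn_symm.mono ?_) ?_
    · rintro _ ⟨y, hy, rfl⟩
      exact φ.map_source hy.2
    · rintro _ ⟨y, hy, rfl⟩
      rw [φ.left_inv hy.2]
      exact hy.1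
  have hkey : ∀ y ∈ O, f y - f x = dslope F (φ x) (φ y) * cchart x y := by
    intro y hy
    have := sub_smul_dslope F (φ x) (φ y)
    rw [hFx, hF, Function.comp_apply, φ.left_inv hy.2] at this
    rw [← this, smul_eq_mul, mul_comm]
    rfl
  refine ⟨hf.sub continuousOn_const, fun y hy hne => sub_ne_zero.2 (hinj y hy hne), O, hOo,
    ⟨hxU, hx⟩, fun y => dslope F (φ x) (φ y), ?_, ?_, hkey⟩
  · refine ContinuousOn.comp (t := φ '' O) ?_ (φ.continuousOn.mono Set.inter_subset_right)
      (Set.mapsTo_image _ _)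
    exact (continuousOn_dslope (him.mem_nhds ⟨x, ⟨hxU, hx⟩, rfl⟩)).2 ⟨hFc, hFd⟩
  · intro y hy
    by_cases hyx : y = x
    · change dslope F (φ x) (φ y) ≠ 0
      rw [hyx, dslope_same]
      exact hne
    · intro h0
      have := hkey y hy
      simp only at h0
      rw [h0, zero_mul] at this
      exact hinj y hy.1 hyx (sub_eq_zero.1 this)

/-- Every chart gives a coordinate at every point of its source. -/
theorem isCoord_chart {p x : M} (hx : x ∈ (chartAt ℂ p).source) :
    IsCoord x (chartAt ℂ p).source (fun y => chartAt ℂ p y - chartAt ℂ p x) := by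
  have : IsManifold 𝓘(ℂ) 1 M := IsManifold.of_le (n := ω) le_top
  refine isCoord_of_mdifferentiableAt (h := (chartAt ℂ p).symm) (chartAt ℂ p).open_source hx
    (chartAt ℂ p).continuousOn (fun y hy hne h => hne ((chartAt ℂ p).injOn hy hx h))
    (mdifferentiableAt_atlas (chart_mem_atlas ℂ p) hx)
    (mdifferentiableAt_atlas_symm (chart_mem_atlas ℂ p) ((chartAt ℂ p).map_source hx)) ?_
  filter_upwards [(chartAt ℂ p).open_source.mem_nhds hx] with y hy
  exact (chartAt ℂ p).left_inv hy

variable [T2Space M]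

/-- Holomorphic automorphisms preserve the degree. -/
theorem HasDeg.push {g g' : M → M} (hg : ContMDiff 𝓘(ℂ) 𝓘(ℂ) ω g)
    (hg' : ContMDiff 𝓘(ℂ) 𝓘(ℂ) ω g') (h1 : ∀ y, g' (g y) = y) (h2 : ∀ y, g (g' y) = y) {x : M}
    {z : (sing M).Ch 2} {q : ℂ} (h : HasDeg M x z q) : HasDeg M (g x) (push g 2 z) q := by
  have : IsManifold 𝓘(ℂ) 1 M := IsManifold.of_le (n := ω) le_top
  obtain ⟨hz, z', hz', w, t, ht, e, rfl⟩ := h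
  set φ := chartAt ℂ x with hφ
  have hx : x ∈ φ.source := mem_chart_source ℂ x
  have hgc : ContinuousOn g Set.univ := hg.continuous.continuousOn
  have hmaps : Set.MapsTo g {x}ᶜ {g x}ᶜ := fun y hy hyx => hy (by
    have := congrArg g' (show g y = g x from hyx)
    rwa [h1, h1] at this)
  have hU : IsOpen (g' ⁻¹' φ.source) := φ.open_source.preimage hg'.continuous
  -- The centred chart at x, transported by the inverse of g, is a coordinate at g x. Composed with
  -- g it is the chart at x again, so the two winding numbers coincide.
  have hc : IsCoord (g x) (g' ⁻¹' φ.source) (fun y => φ (g' y) - φ (g' (g x))) := by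
    refine isCoord_of_mdifferentiableAt (f := φ ∘ g') (h := g ∘ φ.symm) hU (by simpa [h1] using hx)
      (φ.continuousOn.comp hg'.continuous.continuousOn fun y hy => hy) ?_ ?_ ?_ ?_
    · intro y hy hne heq
      have := φ.injOn hy (show g' (g x) ∈ φ.source by rwa [h1]) heq
      have := congrArg g this
      rw [h2, h2] at this
      exact hne this
    · refine MDifferentiableAt.comp (I' := 𝓘(ℂ)) (g x) ?_ (hg'.mdifferentiable (by simp) _)
      rw [h1]
      exact mdifferentiableAt_atlas (chart_mem_atlas ℂ x) hx
    · refine MDifferentiableAt.comp (I' := 𝓘(ℂ)) _ (hg.mdifferentiable (by simp) _) ?_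
      simp only [Function.comp_apply, h1]
      exact mdifferentiableAt_atlas_symm (chart_mem_atlas ℂ x) (φ.map_source hx)
    · filter_upwards [hU.mem_nhds (show g x ∈ g' ⁻¹' φ.source by simpa [h1] using hx)] with y hy
      simp only [Function.comp_apply]
      rw [φ.left_inv hy, h2]
  have hbz' := bd_mem_of_eq hz ht e
  have key := hc.hasDeg (z := Sing.push g 2 z) (z' := Sing.push g 2 z') (t := Sing.push g 2 t)
    (w := Sing.push g 3 w) hU
    (by simpa [h1] using hx) (by
      rw [bd_push hgc (mem_supp_univ z)]
      exact push_mem_supp (hgc.mono (Set.subset_univ _)) hmaps hz)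
    (push_mem_supp (hgc.mono (Set.subset_univ _)) (fun y hy => by simpa [h1] using hy) hz')
    (push_mem_supp (hgc.mono (Set.subset_univ _)) hmaps ht)
    (by rw [e, map_add, map_add, bd_push hgc (mem_supp_univ w)])
  convert key using 1
  rw [bd_push hgc (mem_supp_univ z')]
  have hb : (sing M).bd 1 z' ∈ supp (φ.source ∩ {x}ᶜ) 1 := by
    rw [supp_inter]
    exact ⟨bd_mem_supp hz', hbz'⟩
  rw [wind_push (V := φ.source ∩ {x}ᶜ) (hgc.mono (Set.subset_univ _)) ?_ ?_ hb]
  · refine congrArg (fun f => wind f ((sing M).bd 1 z')) (funext fun y => ?_)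
    simp only [Function.comp_apply, h1]
    rfl
  · refine ContinuousOn.congr (f := cchart x)
      ((isCoord_cchart x).continuousOn.mono Set.inter_subset_left) fun y hy => ?_
    simp only [Function.comp_apply, h1]
    rfl
  · intro y hy
    rw [h1, h1]
    exact (isCoord_cchart x).ne_zero y hy.1 hy.2

end holomorphic

end Sing

/-! ### The fundamental class of a compact Riemann surface -/

namespace Sing

open SemiSimp

/-! ### Gluing relative classes along closed sets -/

section good

variable {M : Type u} [TopologicalSpace M] [ChartedSpace ℂ M]

/-- The relative homology of `(M, Aᶜ)` vanishes above degree two, its classes of degree two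
are determined by their local degrees, and there is a class of degree one along `A`. -/
structure Good (A : Set M) : Prop where
  vanish : ∀ (i : ℕ) (z : (sing M).Ch (i + 3)), (sing M).bd (i + 2) z ∈ supp Aᶜ (i + 2) →
    ∃ w, ∃ t ∈ supp Aᶜ (i + 3), z = (sing M).bd (i + 3) w + t
  unique : ∀ z : (sing M).Ch 2, (sing M).bd 1 z ∈ supp Aᶜ 1 → (∀ x ∈ A, HasDeg M x z 0) →
    ∃ w, ∃ t ∈ supp Aᶜ 2, z = (sing M).bd 2 w + t
  exist : ∃ z : (sing M).Ch 2, (sing M).bd 1 z ∈ supp Aᶜ 1 ∧ ∀ x ∈ A, HasDeg M x z 1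

omit [ChartedSpace ℂ M] in
/-- The Mayer–Vietoris argument for relative cycles. -/
theorem exists_bd_union {A B : Set M} (hA : IsClosed A) (hB : IsClosed B) {n : ℕ}
    (hAB : ∀ z : (sing M).Ch (n + 2), (sing M).bd (n + 1) z ∈ supp (A ∩ B)ᶜ (n + 1) →
      ∃ w, ∃ t ∈ supp (A ∩ B)ᶜ (n + 2), z = (sing M).bd (n + 2) w + t)
    {z u v : (sing M).Ch (n + 1)} {a b : (sing M).Ch (n + 2)}
    (hu : u ∈ supp Aᶜ (n + 1)) (hv : v ∈ supp Bᶜ (n + 1)) (ha : z = (sing M).bd (n + 1) a + u)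
    (hb : z = (sing M).bd (n + 1) b + v) :
    ∃ w, ∃ t ∈ supp (A ∪ B)ᶜ (n + 1), z = (sing M).bd (n + 1) w + t := by
  have hsup : (sing M).bd (n + 1) (a - b) ∈ supp Aᶜ (n + 1) ⊔ supp Bᶜ (n + 1) := by
    have : (sing M).bd (n + 1) (a - b) = v - u := by
      rw [map_sub, sub_eq_sub_iff_add_eq_add, ← ha, hb]
      abel
    rw [this]
    exact sub_mem (Submodule.mem_sup_right hv) (Submodule.mem_sup_left hu)
  -- The two bounding chains differ by a relative cycle along A ∩ B, which is trivial by the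
  -- hypothesis one degree up. Splitting its remainder t into parts off A and off B corrects a and b
  -- to a common chain.
  obtain ⟨w, t, ht, e⟩ := hAB (a - b) (sup_le (supp_mono (by simp) _) (supp_mono (by simp) _) hsup)
  rw [Set.compl_inter] at ht
  have hbt : (sing M).bd (n + 1) t = (sing M).bd (n + 1) (a - b) := by
    rw [e, map_add, bd_bd, zero_add]
  obtain ⟨s, -, u', hu', v', hv', e'⟩ := exists_small hA.isOpen_compl hB.isOpen_compl ht
    (hbt ▸ hsup)
  have key : u + (sing M).bd (n + 1) u' = v - (sing M).bd (n + 1) v' := by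
    have h1 : (sing M).bd (n + 1) a - (sing M).bd (n + 1) b =
        (sing M).bd (n + 1) u' + (sing M).bd (n + 1) v' := by
      rw [← map_sub, ← hbt, e', map_add, map_add, bd_bd, add_zero]
    have h2 : (sing M).bd (n + 1) a + u = (sing M).bd (n + 1) b + v := ha.symm.trans hb
    rw [← sub_eq_zero] at h1 h2 ⊢
    have : u + (sing M).bd (n + 1) u' - (v - (sing M).bd (n + 1) v') =
      ((sing M).bd (n + 1) a + u - ((sing M).bd (n + 1) b + v)) -
      ((sing M).bd (n + 1) a - (sing M).bd (n + 1) b -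
        ((sing M).bd (n + 1) u' + (sing M).bd (n + 1) v')) := by abel
    rw [this, h1, h2, sub_zero]
  refine ⟨a - u', u + (sing M).bd (n + 1) u', ?_, ?_⟩
  · rw [Set.compl_union, supp_inter]
    refine ⟨add_mem hu (bd_mem_supp hu'), ?_⟩
    rw [key]
    exact sub_mem hv (bd_mem_supp hv')
  · rw [ha, map_sub]
    abel

/-- The first two properties follow from Mayer–Vietoris. For existence, the classes along A and B
have the same degree on A ∩ B, so uniqueness makes their difference trivial there, and the error is
shared between the two. -/
theorem Good.union {A B : Set M} (hA : IsClosed A) (hB : IsClosed B) (gA : Good A) (gB : Good B)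
    (gAB : Good (A ∩ B)) : Good (A ∪ B) := by
  have lA : ∀ n, supp (A ∪ B)ᶜ n ≤ supp Aᶜ n := fun n =>
    supp_mono (Set.compl_subset_compl.2 Set.subset_union_left) n
  have lB : ∀ n, supp (A ∪ B)ᶜ n ≤ supp Bᶜ n := fun n =>
    supp_mono (Set.compl_subset_compl.2 Set.subset_union_right) n
  refine ⟨fun i z hz => ?_, fun z hz hd => ?_, ?_⟩
  · obtain ⟨a, u, hu, ha⟩ := gA.vanish i z (lA _ hz)
    obtain ⟨b, v, hv, hb⟩ := gB.vanish i z (lB _ hz)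
    exact exists_bd_union hA hB (gAB.vanish (i + 1)) hu hv ha hb
  · obtain ⟨a, u, hu, ha⟩ := gA.unique z (lA _ hz) fun x hx => hd x (Or.inl hx)
    obtain ⟨b, v, hv, hb⟩ := gB.unique z (lB _ hz) fun x hx => hd x (Or.inr hx)
    exact exists_bd_union hA hB (gAB.vanish 0) hu hv ha hb
  · obtain ⟨a, ha, hda⟩ := gA.exist
    obtain ⟨b, hb, hdb⟩ := gB.exist
    have hsup : (sing M).bd 1 (a - b) ∈ supp Aᶜ 1 ⊔ supp Bᶜ 1 := by
      rw [map_sub]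
      exact sub_mem (Submodule.mem_sup_left ha) (Submodule.mem_sup_right hb)
    obtain ⟨w, t, ht, e⟩ := gAB.unique (a - b)
      (sup_le (supp_mono (by simp) _) (supp_mono (by simp) _) hsup)
      (fun x hx => by simpa using (hda x hx.1).sub (hdb x hx.2))
    rw [Set.compl_inter] at ht
    have hbt : (sing M).bd 1 t = (sing M).bd 1 (a - b) := by rw [e, map_add, bd_bd, zero_add]
    obtain ⟨s, -, u', hu', v', hv', e'⟩ := exists_small hA.isOpen_compl hB.isOpen_compl ht
      (hbt ▸ hsup)
    -- One chain seen from both sides: off its correction it is a along A and b along B.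
    have key : a - u' = b + ((sing M).bd 2 (w + s) + v') := by
      rw [e'] at e
      rw [map_add, ← sub_eq_zero]
      rw [← sub_eq_zero] at e
      rw [← e]
      abel
    have hx : ∀ {A : Set M} {x : M} {n : ℕ}, x ∈ A → supp Aᶜ n ≤ supp {x}ᶜ n := fun h =>
      supp_mono (Set.compl_subset_compl.2 (Set.singleton_subset_iff.2 h)) _
    refine ⟨a - u', ?_, ?_⟩
    · rw [Set.compl_union, supp_inter]
      constructor
      · rw [map_sub]
        exact sub_mem ha (bd_mem_supp hu')
      · rw [key, map_add, map_add, bd_bd, zero_add]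
        exact add_mem hb (bd_mem_supp hv')
    · rintro x (hxA | hxB)
      · have := (hda x hxA).sub (hasDeg_of_eq (w := 0) (hx hxA hu'))
        rwa [map_zero, zero_add, sub_zero] at this
      · rw [key]
        have := (hdb x hxB).add (hasDeg_of_eq (w := w + s) (hx hxB hv'))
        rwa [add_zero] at this

theorem good_empty : Good (∅ : Set M) where
  vanish i z _ := ⟨0, z, by rw [Set.compl_empty]; exact mem_supp_univ z, by rw [map_zero, zero_add]⟩
  unique z _ _ := ⟨0, z, by rw [Set.compl_empty]; exact mem_supp_univ z, by rw [map_zero, zero_add]⟩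
  exist := ⟨0, by rw [map_zero]; exact zero_mem _, fun x hx => hx.elim⟩

/-- Intersecting one member with the union of the n others gives again a union of n members, as the
family is closed under intersections. The induction is on the number of sets, because the list
changes. -/
theorem good_sUnion {Rs : Set (Set M)} (hcl : ∀ A ∈ Rs, IsClosed A) (hgood : ∀ A ∈ Rs, Good A)
    (hinter : ∀ A ∈ Rs, ∀ B ∈ Rs, A ∩ B ∈ Rs) :
    ∀ (n : ℕ) (l : List (Set M)), l.length = n → (∀ A ∈ l, A ∈ Rs) → Good (⋃ A ∈ l, A) := by
  intro n
  induction n with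
  | zero =>
    intro l hl _
    rw [List.length_eq_zero_iff.1 hl]
    simpa using good_empty
  | succ n ih =>
    rintro (_ | ⟨A, l⟩) hl h
    · simp at hl
    · have hA : A ∈ Rs := h A (by simp)
      have hl' : ∀ B ∈ l, B ∈ Rs := fun B hB => h B (by simp [hB])
      have hlen : l.length = n := by simpa using hl
      have e : (⋃ B ∈ A :: l, B) = A ∪ ⋃ B ∈ l, B := by simp
      have e' : A ∩ (⋃ B ∈ l, B) = ⋃ B ∈ l.map (A ∩ ·), B := by
        ext x
        simp
      rw [e]
      refine Good.union (hcl A hA) ?_ (hgood A hA) (ih l hlen hl') ?_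
      · exact l.finite_toSet.isClosed_biUnion fun B hB => hcl B (hl' B hB)
      · rw [e']
        refine ih _ (by simpa using hlen) fun B hB => ?_
        obtain ⟨B', hB', rfl⟩ := List.mem_map.1 hB
        exact hinter A hA B' (hl' B' hB')

variable (M) in
theorem good_sUnion_finite {Rs : Set (Set M)} (hcl : ∀ A ∈ Rs, IsClosed A) (hgood : ∀ A ∈ Rs, Good A)
    (hinter : ∀ A ∈ Rs, ∀ B ∈ Rs, A ∩ B ∈ Rs) {ι : Type*} (s : Finset ι) (f : ι → Set M)
    (hf : ∀ i ∈ s, f i ∈ Rs) : Good (⋃ i ∈ s, f i) := by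
  have := good_sUnion hcl hgood hinter _ (s.toList.map f) rfl (by simpa using hf)
  simpa using this

end good

/-! ### Relative homology along a rectangle in a chart -/

section chartRect

variable {M : Type u} [TopologicalSpace M] [ChartedSpace ℂ M]

/-- The compact subset of the source of a chart which corresponds to a rectangle. -/
def chartRect (p : M) (a b c d : ℝ) : Set M :=
  (chartAt ℂ p).source ∩ chartAt ℂ p ⁻¹' (Set.Icc a b ×ℂ Set.Icc c d)

variable {p : M} {a b c d : ℝ}

theorem isCompact_chartRect (h : Set.Icc a b ×ℂ Set.Icc c d ⊆ (chartAt ℂ p).target) :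
    IsCompact (chartRect p a b c d) := by
  have : chartRect p a b c d = (chartAt ℂ p).symm '' (Set.Icc a b ×ℂ Set.Icc c d) := by
    rw [(chartAt ℂ p).symm.image_eq_target_inter_inv_preimage h]
    rfl
  rw [this]
  exact (isCompact_Icc.reProdIm isCompact_Icc).image_of_continuousOn
    ((chartAt ℂ p).continuousOn_symm.mono h)

theorem mapsTo_chart : Set.MapsTo (chartAt ℂ p) ((chartAt ℂ p).source ∩ (chartRect p a b c d)ᶜ)
    ((chartAt ℂ p).target ∩ (Set.Icc a b ×ℂ Set.Icc c d)ᶜ) := fun _ hy =>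
  ⟨(chartAt ℂ p).map_source hy.1, fun h => hy.2 ⟨hy.1, h⟩⟩

theorem mapsTo_chart_symm : Set.MapsTo (chartAt ℂ p).symm
    ((chartAt ℂ p).target ∩ (Set.Icc a b ×ℂ Set.Icc c d)ᶜ)
    ((chartAt ℂ p).source ∩ (chartRect p a b c d)ᶜ) := fun y hy =>
  ⟨(chartAt ℂ p).map_target hy.1, fun h => hy.2 (by
    have := h.2
    rwa [Set.mem_preimage, (chartAt ℂ p).right_inv hy.1] at this)⟩

theorem isClosed_rect : IsClosed (Set.Icc a b ×ℂ Set.Icc c d) :=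
  (isCompact_Icc.reProdIm isCompact_Icc).isClosed

theorem wind_sub_bd {R : Set ℂ} {x : ℂ} (hx : x ∈ R) {t : (sing ℂ).Ch 2} (ht : t ∈ supp Rᶜ 2) :
    wind (fun y => y - x) ((sing ℂ).bd 1 t) = 0 := by
  refine wind_bd (V := Rᶜ) (continuousOn_id.sub continuousOn_const) (fun y hy => ?_) ht
  refine sub_ne_zero.2 fun h => hy ?_
  rwa [show y = x from h]

/-- Cycles of positive degree bound in ℂ, so the pushed chain is homologous to τ, a chain off the
rectangle. Excision brings the bounding chain into the target of the chart, from where it is carried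
back. -/
theorem exists_bd_of_push (h : Set.Icc a b ×ℂ Set.Icc c d ⊆ (chartAt ℂ p).target) {n : ℕ}
    {z : (sing M).Ch (n + 1)} (hz : z ∈ supp (chartAt ℂ p).source (n + 1))
    {τ : (sing ℂ).Ch (n + 1)} (hτ : τ ∈ supp (Set.Icc a b ×ℂ Set.Icc c d)ᶜ (n + 1))
    (e : (sing ℂ).bd n (push (chartAt ℂ p) (n + 1) z) = (sing ℂ).bd n τ) :
    ∃ w, ∃ t ∈ supp (chartRect p a b c d)ᶜ (n + 1), z = (sing M).bd (n + 1) w + t := by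
  set φ := chartAt ℂ p
  have hφ : ContinuousOn φ φ.source := φ.continuousOn
  have hψ : ContinuousOn φ.symm φ.target := φ.continuousOn_symm
  obtain ⟨s, -, hs⟩ := exists_bd_of_starConvex (p := (0 : ℂ)) (V := Set.univ)
    (starConvex_univ 0) trivial (z := push φ (n + 1) z - τ) (mem_supp_univ _) (by
      rw [map_sub, e, sub_self])
  obtain ⟨w', hw', m, hm, e'⟩ := exists_excision_bd isClosed_rect φ.open_target h
    (push_mem_supp hφ φ.mapsTo hz) hτ (by rw [hs, sub_add_cancel])
  refine ⟨push φ.symm (n + 2) w', push φ.symm (n + 1) m,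
    supp_mono Set.inter_subset_right _ (push_mem_supp (hψ.mono Set.inter_subset_left)
      mapsTo_chart_symm hm), ?_⟩
  rw [bd_push hψ hw', ← map_add, ← e', push_push hφ hz]
  exact (push_eqOn_id (fun y hy => φ.left_inv hy) hz).symm

variable [T2Space M]

theorem isClosed_chartRect (h : Set.Icc a b ×ℂ Set.Icc c d ⊆ (chartAt ℂ p).target) :
    IsClosed (chartRect p a b c d) := (isCompact_chartRect h).isClosed

theorem exists_excision_chartRect (h : Set.Icc a b ×ℂ Set.Icc c d ⊆ (chartAt ℂ p).target) {n : ℕ}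
    {z : (sing M).Ch (n + 2)} (hz : (sing M).bd (n + 1) z ∈ supp (chartRect p a b c d)ᶜ (n + 1)) :
    ∃ z' ∈ supp (chartAt ℂ p).source (n + 2), ∃ w, ∃ t ∈ supp (chartRect p a b c d)ᶜ (n + 2),
      z = z' + (sing M).bd (n + 2) w + t ∧
      (sing M).bd (n + 1) z' ∈ supp ((chartAt ℂ p).source ∩ (chartRect p a b c d)ᶜ) (n + 1) ∧
      (sing ℂ).bd (n + 1) (push (chartAt ℂ p) (n + 2) z') ∈
        supp (Set.Icc a b ×ℂ Set.Icc c d)ᶜ (n + 1) := by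
  obtain ⟨z', hz', w, t, ht, e⟩ := exists_excision (isClosed_chartRect h) (chartAt ℂ p).open_source
    Set.inter_subset_left hz
  have hb : (sing M).bd (n + 1) z' ∈
      supp ((chartAt ℂ p).source ∩ (chartRect p a b c d)ᶜ) (n + 1) := by
    rw [supp_inter]
    refine ⟨bd_mem_supp hz', ?_⟩
    have : (sing M).bd (n + 1) z' = (sing M).bd (n + 1) z - (sing M).bd (n + 1) t := by
      rw [e, map_add, map_add, bd_bd]
      abel
    rw [this]
    exact sub_mem hz (bd_mem_supp ht)
  refine ⟨z', hz', w, t, ht, e, hb, ?_⟩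
  rw [bd_push (chartAt ℂ p).continuousOn hz']
  exact supp_mono Set.inter_subset_right _ (push_mem_supp
    ((chartAt ℂ p).continuousOn.mono Set.inter_subset_left) mapsTo_chart hb)

variable [IsManifold 𝓘(ℂ) ω M]

theorem hasDeg_push {x : M} (hx : x ∈ (chartAt ℂ p).source) {z z' t : (sing M).Ch 2}
    {w : (sing M).Ch 3} (hz : (sing M).bd 1 z ∈ supp {x}ᶜ 1)
    (hz' : z' ∈ supp (chartAt ℂ p).source 2) (ht : t ∈ supp {x}ᶜ 2)
    (e : z = z' + (sing M).bd 2 w + t) :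
    HasDeg M x z (wind (fun y => y - chartAt ℂ p x)
      ((sing ℂ).bd 1 (push (chartAt ℂ p) 2 z'))) := by
  convert (isCoord_chart hx).hasDeg (chartAt ℂ p).open_source hx hz hz' ht e using 1
  rw [bd_push (chartAt ℂ p).continuousOn hz']
  have hb : (sing M).bd 1 z' ∈ supp ((chartAt ℂ p).source ∩ {x}ᶜ) 1 := by
    rw [supp_inter]
    exact ⟨bd_mem_supp hz', bd_mem_of_eq hz ht e⟩
  refine wind_push (f := fun y => y - chartAt ℂ p x)
    ((chartAt ℂ p).continuousOn.mono Set.inter_subset_left)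
    (ContinuousOn.sub ((chartAt ℂ p).continuousOn.mono Set.inter_subset_left) continuousOn_const)
    ?_ hb
  intro y hy
  exact sub_ne_zero.2 fun h => hy.2 ((chartAt ℂ p).injOn hy.1 hx h)

omit [T2Space M] [IsManifold 𝓘(ℂ) ω M] in
theorem supp_chartRect_le {x : M} (hx : x ∈ chartRect p a b c d) (n : ℕ) :
    supp (chartRect p a b c d)ᶜ n ≤ supp {x}ᶜ n :=
  supp_mono (Set.compl_subset_compl.2 (Set.singleton_subset_iff.2 hx)) n

/-- The degree is constant along a rectangle, is rational and determines the relative cycle. -/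
theorem exists_rat_hasDeg (h : Set.Icc a b ×ℂ Set.Icc c d ⊆ (chartAt ℂ p).target) (hab : a ≤ b)
    (hcd : c ≤ d) {z : (sing M).Ch 2} (hz : (sing M).bd 1 z ∈ supp (chartRect p a b c d)ᶜ 1) :
    ∃ r : ℚ, (∀ x ∈ chartRect p a b c d, HasDeg M x z r) ∧
      (r = 0 → ∃ w, ∃ t ∈ supp (chartRect p a b c d)ᶜ 2, z = (sing M).bd 2 w + t) := by
  obtain ⟨z', hz', w, t, ht, e, hb, hb'⟩ := exists_excision_chartRect h hz
  obtain ⟨r, τ, hτ, er⟩ := exists_eq_rectLoop_add_bd hab hcd hb' (bd_bd _)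
  refine ⟨r, fun x hx => ?_, ?_⟩
  · have hle := supp_chartRect_le hx
    convert hasDeg_push hx.1 (hle _ hz) hz' (hle _ ht) e using 1
    rw [er, map_add, map_smul, wind_rectLoop hx.2, wind_sub_bd hx.2 hτ,
      add_zero, Rat.smul_def, mul_one]
  · rintro rfl
    rw [zero_smul, zero_add ((sing ℂ).bd 1 τ)] at er
    obtain ⟨w', t', ht', e'⟩ := exists_bd_of_push h hz' hτ er
    refine ⟨w' + w, t' + t, add_mem ht' ht, ?_⟩
    rw [e, map_add]
    conv_lhs => rw [e']
    abel

/-- The chart and excision reduce to chains in ℂ whose boundary avoids the rectangle. These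
boundaries are classified by the homology of the complement: zero in higher degrees, generated in
degree one by `rectLoop`, which winds once around each point of the rectangle. -/
theorem good_chartRect (h : Set.Icc a b ×ℂ Set.Icc c d ⊆ (chartAt ℂ p).target) (hab : a ≤ b)
    (hcd : c ≤ d) : Good (chartRect p a b c d) := by
  refine ⟨fun i z hz => ?_, fun z hz hd => ?_, ?_⟩
  · obtain ⟨z', hz', w, t, ht, e, hb, hb'⟩ := exists_excision_chartRect h hz
    obtain ⟨τ, hτ, er⟩ := exists_bd_of_rect hab hcd hb' (bd_bd _)
    obtain ⟨w', t', ht', e'⟩ := exists_bd_of_push h hz' hτ er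
    refine ⟨w' + w, t' + t, add_mem ht' ht, ?_⟩
    rw [e, map_add]
    conv_lhs => rw [e']
    abel
  · obtain ⟨r, h1, h2⟩ := exists_rat_hasDeg h hab hcd hz
    refine h2 ?_
    have hm : (⟨a, c⟩ : ℂ) ∈ Set.Icc a b ×ℂ Set.Icc c d :=
      ⟨Set.left_mem_Icc.2 hab, Set.left_mem_Icc.2 hcd⟩
    have hx : (chartAt ℂ p).symm ⟨a, c⟩ ∈ chartRect p a b c d := by
      refine ⟨(chartAt ℂ p).map_target (h hm), ?_⟩
      rw [Set.mem_preimage, (chartAt ℂ p).right_inv (h hm)]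
      exact hm
    have := (h1 _ hx).unique (hd _ hx)
    exact_mod_cast this
  · set φ := chartAt ℂ p with hφ
    have hψ : ContinuousOn φ.symm φ.target := φ.continuousOn_symm
    -- A chain bounded by the loop, cut down to the target of the chart, represents the class of
    -- degree one.
    obtain ⟨δ, -, hδ⟩ := exists_bd_of_starConvex (p := (0 : ℂ)) (V := Set.univ)
      (starConvex_univ 0) trivial (z := rectLoop a b c d) (mem_supp_univ _) bd_rectLoop
    obtain ⟨δ', hδ', w, t, ht, e⟩ := exists_excision isClosed_rect φ.open_target h
      (z := δ) (hδ ▸ rectLoop_mem)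
    have hbd : (sing ℂ).bd 1 δ' = rectLoop a b c d - (sing ℂ).bd 1 t := by
      rw [← hδ, e, map_add, map_add, bd_bd]
      abel
    have hbm : (sing ℂ).bd 1 δ' ∈ supp (φ.target ∩ (Set.Icc a b ×ℂ Set.Icc c d)ᶜ) 1 := by
      rw [supp_inter]
      refine ⟨bd_mem_supp hδ', ?_⟩
      rw [hbd]
      exact sub_mem rectLoop_mem (bd_mem_supp ht)
    have hz' := push_mem_supp hψ φ.mapsTo_symm hδ'
    have hbz : (sing M).bd 1 (push φ.symm 2 δ') ∈ supp (chartRect p a b c d)ᶜ 1 := by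
      rw [bd_push hψ hδ']
      exact supp_mono Set.inter_subset_right _ (push_mem_supp (hψ.mono Set.inter_subset_left)
        mapsTo_chart_symm hbm)
    refine ⟨push φ.symm 2 δ', hbz, fun x hx => ?_⟩
    convert hasDeg_push hx.1 (supp_chartRect_le hx _ hbz) hz' (zero_mem _) (w := 0)
      (by rw [map_zero, add_zero, add_zero]) using 1
    rw [push_push hψ hδ', push_eqOn_id (f := φ ∘ φ.symm) (V := φ.target) (fun y hy => φ.right_inv hy) hδ', hbd,
      map_sub, wind_rectLoop hx.2, wind_sub_bd hx.2 ht,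
      sub_zero]

end chartRect

/-! ### From rectangles to compact sets and to the whole surface -/

section compact

variable {M : Type u} [TopologicalSpace M] [ChartedSpace ℂ M] [T2Space M]

theorem exists_rect_subset {O : Set ℂ} (hO : IsOpen O) {x : ℂ} (hx : x ∈ O) :
    ∃ a b c d : ℝ, a ≤ b ∧ c ≤ d ∧ Set.Icc a b ×ℂ Set.Icc c d ⊆ O ∧
      Set.Icc a b ×ℂ Set.Icc c d ∈ nhds x := by
  obtain ⟨ε, hε, hb⟩ := Metric.isOpen_iff.1 hO x hx
  -- The norm is at most the sum of the absolute values of the real and imaginary parts, here 2ε/3 <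
  -- ε.
  refine ⟨x.re - ε / 3, x.re + ε / 3, x.im - ε / 3, x.im + ε / 3, by linarith, by linarith, ?_, ?_⟩
  · rintro y ⟨⟨h1, h2⟩, h3, h4⟩
    refine hb ?_
    rw [Metric.mem_ball, dist_eq_norm]
    have h5 : |(y - x).re| ≤ ε / 3 := by
      rw [Complex.sub_re, abs_le]
      constructor <;> linarith
    have h6 : |(y - x).im| ≤ ε / 3 := by
      rw [Complex.sub_im, abs_le]
      constructor <;> linarith
    linarith [Complex.norm_le_abs_re_add_abs_im (y - x)]
  · have h1 : Complex.re ⁻¹' Set.Icc (x.re - ε / 3) (x.re + ε / 3) ∈ nhds x :=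
      Complex.continuous_re.continuousAt.preimage_mem_nhds
        (Icc_mem_nhds (by linarith) (by linarith))
    have h2 : Complex.im ⁻¹' Set.Icc (x.im - ε / 3) (x.im + ε / 3) ∈ nhds x :=
      Complex.continuous_im.continuousAt.preimage_mem_nhds
        (Icc_mem_nhds (by linarith) (by linarith))
    exact Filter.inter_mem h1 h2

omit [T2Space M] in
theorem exists_chartRect_subset {p x : M} (hx : x ∈ (chartAt ℂ p).source) {O : Set M}
    (hO : IsOpen O) (hxO : x ∈ O) : ∃ a b c d : ℝ, a ≤ b ∧ c ≤ d ∧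
      Set.Icc a b ×ℂ Set.Icc c d ⊆ (chartAt ℂ p).target ∧ chartRect p a b c d ⊆ O ∧
      chartRect p a b c d ∈ nhds x := by
  set φ := chartAt ℂ p
  obtain ⟨a, b, c, d, hab, hcd, hsub, hnhds⟩ := exists_rect_subset
    (φ.isOpen_image_of_subset_source (hO.inter φ.open_source) Set.inter_subset_right)
    (Set.mem_image_of_mem φ ⟨hxO, hx⟩)
  refine ⟨a, b, c, d, hab, hcd, ?_, ?_, ?_⟩
  · intro y hy
    obtain ⟨y, hy', rfl⟩ := hsub hy
    exact φ.map_source hy'.2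
  · rintro y ⟨hy, hy'⟩
    obtain ⟨y', hy', e⟩ := hsub hy'
    rw [← φ.injOn hy'.2 hy e]
    exact hy'.1
  · exact Filter.inter_mem (φ.open_source.mem_nhds hx) ((φ.continuousAt hx).preimage_mem_nhds hnhds)

-- A chain involves finitely many simplices, each with compact image. A chain off A therefore leaves
-- room for a neighbourhood of A when A is compact.
omit [ChartedSpace ℂ M] [T2Space M] in
theorem exists_isCompact_of_mem_supp {A : Set M} {n : ℕ} {z : (sing M).Ch n} (hz : z ∈ supp Aᶜ n) :
    ∃ K, IsCompact K ∧ A ∩ K = ∅ ∧ z ∈ supp K n := by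
  refine ⟨⋃ σ ∈ z.support, Set.range (σ : C(Simp n, M)),
    z.support.isCompact_biUnion fun σ _ => isCompact_range (ContinuousMap.continuous (X := Simp n) σ),
    ?_, ?_⟩
  · rw [Set.eq_empty_iff_forall_notMem]
    rintro x ⟨hx, hx'⟩
    obtain ⟨σ, hσ, t, rfl⟩ := Set.mem_iUnion₂.1 hx'
    exact (Finsupp.mem_supported ℚ z).1 hz hσ t hx
  · refine (Finsupp.mem_supported ℚ z).2 fun σ hσ t => Set.mem_iUnion₂.2 ⟨σ, hσ, t, rfl⟩

variable [IsManifold 𝓘(ℂ) ω M]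

-- Rectangles of one chart, together with the empty set, are closed under intersection.
variable (M) in
theorem good_iUnion_chartRect (p : M) {ι : Type*} (s : Finset ι) (a b c d : ι → ℝ)
    (h : ∀ i ∈ s, a i ≤ b i ∧ c i ≤ d i ∧
      Set.Icc (a i) (b i) ×ℂ Set.Icc (c i) (d i) ⊆ (chartAt ℂ p).target) :
    Good (⋃ i ∈ s, chartRect p (a i) (b i) (c i) (d i)) := by
  refine good_sUnion_finite M (Rs := {A | A = ∅ ∨ ∃ a b c d : ℝ, a ≤ b ∧ c ≤ d ∧
    Set.Icc a b ×ℂ Set.Icc c d ⊆ (chartAt ℂ p).target ∧ A = chartRect p a b c d}) ?_ ?_ ?_ _ _ ?_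
  · rintro A (rfl | ⟨a, b, c, d, hab, hcd, h, rfl⟩)
    · exact isClosed_empty
    · exact isClosed_chartRect h
  · rintro A (rfl | ⟨a, b, c, d, hab, hcd, h, rfl⟩)
    · exact good_empty
    · exact good_chartRect h hab hcd
  · rintro A (rfl | ⟨a, b, c, d, hab, hcd, h, rfl⟩) B (rfl | ⟨a', b', c', d', hab', hcd', h', rfl⟩)
    · left; simp
    · left; simp
    · left; simp
    · have e : chartRect p a b c d ∩ chartRect p a' b' c' d' =
          chartRect p (a ⊔ a') (b ⊓ b') (c ⊔ c') (d ⊓ d') := by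
        ext x
        simp only [chartRect, Set.mem_inter_iff, Set.mem_preimage, Complex.mem_reProdIm, Set.mem_Icc,
          sup_le_iff, le_inf_iff]
        tauto
      rcases Set.eq_empty_or_nonempty (chartRect p a b c d ∩ chartRect p a' b' c' d') with he | ⟨x, hx⟩
      · exact Or.inl he
      · right
        rw [e] at hx ⊢
        obtain ⟨-, ⟨h1, h2⟩, h3, h4⟩ := hx
        refine ⟨_, _, _, _, h1.trans h2, h3.trans h4, ?_, rfl⟩
        rintro y ⟨⟨h1, h2⟩, h3, h4⟩
        exact h ⟨⟨(le_sup_left).trans h1, h2.trans inf_le_left⟩, (le_sup_left).trans h3,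
          h4.trans inf_le_left⟩
  · exact fun i hi => Or.inr ⟨_, _, _, _, (h i hi).1, (h i hi).2.1, (h i hi).2.2, rfl⟩

omit [T2Space M] [IsManifold 𝓘(ℂ) ω M] in
theorem exists_chartRect_cover {A O : Set M} {p : M} (hA : IsCompact A)
    (hAp : A ⊆ (chartAt ℂ p).source) (hO : IsOpen O) (hAO : A ⊆ O) :
    ∃ (s : Finset A) (a b c d : A → ℝ), (∀ x : A, a x ≤ b x ∧ c x ≤ d x ∧
      Set.Icc (a x) (b x) ×ℂ Set.Icc (c x) (d x) ⊆ (chartAt ℂ p).target ∧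
      chartRect p (a x) (b x) (c x) (d x) ⊆ O ∧ (x : M) ∈ chartRect p (a x) (b x) (c x) (d x)) ∧
      A ⊆ ⋃ i ∈ s, chartRect p (a i) (b i) (c i) (d i) := by
  choose a b c d hab hcd h1 h2 h3 using fun x : A => exists_chartRect_subset (hAp x.2) hO (hAO x.2)
  obtain ⟨s, hs⟩ := hA.elim_nhds_subcover' (fun x hx => chartRect p (a ⟨x, hx⟩) (b ⟨x, hx⟩)
    (c ⟨x, hx⟩) (d ⟨x, hx⟩)) fun x hx => h3 ⟨x, hx⟩
  exact ⟨s, a, b, c, d, fun x => ⟨hab x, hcd x, h1 x, h2 x, mem_of_mem_nhds (h3 x)⟩, hs⟩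

/-- A chain off A is already off some finite union F of rectangles around A. Each rectangle contains
a point of A and the degree is constant along it, so vanishing degrees on A propagate to F. -/
theorem good_of_isCompact_of_subset {A : Set M} {p : M} (hA : IsCompact A)
    (hAp : A ⊆ (chartAt ℂ p).source) : Good A := by
  have key : ∀ {n : ℕ} {y : (sing M).Ch n}, y ∈ supp Aᶜ n → ∃ F, Good F ∧ A ⊆ F ∧
      y ∈ supp Fᶜ n ∧ ∀ z : (sing M).Ch 2, (sing M).bd 1 z ∈ supp Fᶜ 1 →
        (∀ x ∈ A, HasDeg M x z 0) → ∀ x ∈ F, HasDeg M x z 0 := by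
    intro n y hy
    obtain ⟨K, hK, hAK, hyK⟩ := exists_isCompact_of_mem_supp hy
    obtain ⟨s, a, b, c, d, h, hs⟩ := exists_chartRect_cover hA hAp hK.isClosed.isOpen_compl
      (fun x hx hxK => by
        have : x ∈ A ∩ K := ⟨hx, hxK⟩
        rw [hAK] at this
        exact this)
    refine ⟨_, good_iUnion_chartRect M p s a b c d fun i _ => ⟨(h i).1, (h i).2.1, (h i).2.2.1⟩, hs,
      supp_mono ?_ _ hyK, ?_⟩
    · intro x hxK hx
      obtain ⟨i, -, hx⟩ := Set.mem_iUnion₂.1 hx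
      exact (h i).2.2.2.1 hx hxK
    · intro z hz hd x hx
      obtain ⟨i, hi, hx⟩ := Set.mem_iUnion₂.1 hx
      obtain ⟨r, h1, -⟩ := exists_rat_hasDeg (h i).2.2.1 (h i).1 (h i).2.1 (z := z)
        (supp_mono (Set.compl_subset_compl.2 (Set.subset_biUnion_of_mem
          (u := fun i => chartRect p (a i) (b i) (c i) (d i)) hi)) _ hz)
      have := (hd i i.2).unique (h1 i (h i).2.2.2.2)
      rw [this]
      exact h1 x hx
  refine ⟨fun i z hz => ?_, fun z hz hd => ?_, ?_⟩
  · obtain ⟨F, gF, hAF, hF, -⟩ := key hz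
    obtain ⟨w, t, ht, e⟩ := gF.vanish i z hF
    exact ⟨w, t, supp_mono (Set.compl_subset_compl.2 hAF) _ ht, e⟩
  · obtain ⟨F, gF, hAF, hF, h0⟩ := key hz
    obtain ⟨w, t, ht, e⟩ := gF.unique z hF (h0 z hF hd)
    exact ⟨w, t, supp_mono (Set.compl_subset_compl.2 hAF) _ ht, e⟩
  · obtain ⟨F, gF, hAF, -, -⟩ := key (n := 0) (zero_mem _)
    obtain ⟨z, hz, hd⟩ := gF.exist
    exact ⟨z, supp_mono (Set.compl_subset_compl.2 hAF) _ hz, fun x hx => hd x (hAF hx)⟩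

-- The compact sets contained in some chart are closed under intersection, and finitely many of them
-- cover the surface.
variable (M) in
theorem good_univ [CompactSpace M] : Good (Set.univ : Set M) := by
  choose a b c d hab hcd h1 h2 h3 using fun x : M =>
    exists_chartRect_subset (mem_chart_source ℂ x) isOpen_univ (Set.mem_univ x)
  obtain ⟨s, -, hs⟩ := isCompact_univ.elim_nhds_subcover
    (fun x => chartRect x (a x) (b x) (c x) (d x)) fun x _ => h3 x
  rw [← Set.univ_subset_iff.1 hs]
  refine good_sUnion_finite M (Rs := {A | IsCompact A ∧ ∃ p, A ⊆ (chartAt ℂ p).source})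
    (fun A hA => hA.1.isClosed) (fun A hA => ?_) (fun A hA B hB => ?_) _ _ fun x _ => ?_
  · obtain ⟨p, hp⟩ := hA.2
    exact good_of_isCompact_of_subset hA.1 hp
  · obtain ⟨p, hp⟩ := hA.2
    exact ⟨hA.1.inter hB.1, p, Set.inter_subset_left.trans hp⟩
  · exact ⟨isCompact_chartRect (h1 x), x, Set.inter_subset_left⟩

/-- The degree of a cycle on a connected surface is constant. -/
theorem exists_rat_hasDeg_of_cycle [PreconnectedSpace M] [Nonempty M] {z : (sing M).Ch 2}
    (hz : (sing M).bd 1 z = 0) : ∃ r : ℚ, ∀ x, HasDeg M x z r := by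
  have hz0 : ∀ V : Set M, (sing M).bd 1 z ∈ supp V 1 := fun V => by rw [hz]; exact zero_mem _
  have hloc : ∀ x : M, ∃ r : ℚ, ∀ᶠ y in nhds x, HasDeg M y z r := by
    intro x
    obtain ⟨a, b, c, d, hab, hcd, h1, -, h3⟩ :=
      exists_chartRect_subset (mem_chart_source ℂ x) isOpen_univ (Set.mem_univ x)
    obtain ⟨r, hr, -⟩ := exists_rat_hasDeg h1 hab hcd (hz0 _)
    exact ⟨r, Filter.mem_of_superset h3 hr⟩
  choose f hf using hloc
  have hfx : ∀ x, HasDeg M x z (f x) := fun x => (hf x).self_of_nhds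
  -- The degree is constant along rectangles, which are neighbourhoods, and it is unique.
  have hlc : IsLocallyConstant f := by
    rw [IsLocallyConstant.iff_eventually_eq]
    intro x
    filter_upwards [hf x] with y hy
    have := (hfx y).unique hy
    exact_mod_cast this
  obtain ⟨x₀⟩ := ‹Nonempty M›
  refine ⟨f x₀, fun x => ?_⟩
  rw [hlc.apply_eq_of_preconnectedSpace x₀ x]
  exact hfx x

variable (M) in
/-- The fundamental class. -/
theorem exists_fundamental_class [CompactSpace M] : ∃ z : (sing M).Ch 2, (sing M).bd 1 z = 0 ∧
    ∀ x, HasDeg M x z 1 := by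
  obtain ⟨z, hz, hd⟩ := (good_univ M).exist
  rw [Set.compl_univ] at hz
  exact ⟨z, eq_zero_of_mem_supp_empty hz, fun x => hd x trivial⟩

theorem exists_eq_bd_of_hasDeg_zero [CompactSpace M] {z : (sing M).Ch 2}
    (hz : (sing M).bd 1 z = 0) (hd : ∀ x, HasDeg M x z 0) : ∃ w, z = (sing M).bd 2 w := by
  obtain ⟨w, t, ht, e⟩ := (good_univ M).unique z (by rw [hz]; exact zero_mem _) fun x _ => hd x
  rw [Set.compl_univ] at ht
  exact ⟨w, by rw [e, eq_zero_of_mem_supp_empty ht, add_zero]⟩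

end compact

end Sing

/-! ### Cosimplicial coefficients -/

namespace Kunneth

open SimplexCategory RatCohomology

/-- Monotone maps of finite ordinals. -/
abbrev Mor (m n : ℕ) : Type := SimplexCategory.mk m ⟶ SimplexCategory.mk n

/-- The semi-simplicial set of degree `m` maps to `[n]`. -/
def stdSemi (n : ℕ) : SemiSimp.{0} where
  T m := Mor m n
  face i f := SimplexCategory.δ i ≫ f
  face_face i j hij f := by
    rw [← Category.assoc, ← Category.assoc, SimplexCategory.δ_comp_δ hij]

/-- The universal case: ∂∂ = 0 on the identity simplex of [n + 2], transported by the linear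
extension of T. -/
theorem alt_alt {n : ℕ} {A : Type*} [AddCommGroup A] [Module ℚ A] (T : Mor n (n + 2) → A) :
    ∑ j : Fin (n + 3), (-1 : ℚ) ^ (j : ℕ) • ∑ i : Fin (n + 2), (-1 : ℚ) ^ (i : ℕ) •
      T (SimplexCategory.δ i ≫ SimplexCategory.δ j) = 0 := by
  set S := stdSemi (n + 2)
  let F : S.Ch n →ₗ[ℚ] A := Finsupp.linearCombination ℚ T
  have hF : ∀ x : S.T n, F (Finsupp.single x 1) = T x := fun x =>
    (Finsupp.linearCombination_single ℚ (v := T) 1 x).trans (one_smul ℚ _)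
  let e : S.T (n + 2) := 𝟙 (SimplexCategory.mk (n + 2))
  have h : F (S.bd n (S.bd (n + 1) (Finsupp.single e 1))) = 0 := by
    rw [SemiSimp.bd_bd, map_zero]
  rw [SemiSimp.bd_single, map_sum, map_sum] at h
  rw [← h]
  refine Finset.sum_congr rfl fun j _ => ?_
  rw [map_smul, map_smul, SemiSimp.bd_single, map_sum]
  refine congrArg _ (Finset.sum_congr rfl fun i _ => ?_)
  rw [map_smul, hF]
  simp only [S, e, stdSemi, Category.comp_id]

/-- A cosimplicial rational vector space. -/
structure CoSimp where
  /-- The spaces. -/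
  obj : ℕ → Type u
  [grp : ∀ n, AddCommGroup (obj n)]
  [mod : ∀ n, Module ℚ (obj n)]
  /-- The structure maps. -/
  map : ∀ {m n : ℕ}, Mor m n → obj m →ₗ[ℚ] obj n
  map_id : ∀ (n : ℕ) (x : obj n), map (𝟙 _) x = x
  map_map : ∀ {l m n : ℕ} (f : Mor l m) (g : Mor m n) (x : obj l), map g (map f x) = map (f ≫ g) x

attribute [instance] CoSimp.grp CoSimp.mod

/-- A map of cosimplicial vector spaces. -/
structure CoSimp.Hom (M N : CoSimp.{u}) where
  /-- The components. -/
  app : ∀ n, M.obj n →ₗ[ℚ] N.obj n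
  naturality : ∀ {m n : ℕ} (f : Mor m n) (x : M.obj m), app n (M.map f x) = N.map f (app m x)

variable (L : SSet.{u}) (M N : CoSimp.{u})

/-- The differential of a cosimplicial vector space. -/
noncomputable def dM (n : ℕ) : M.obj n →ₗ[ℚ] M.obj (n + 1) :=
  ∑ i : Fin (n + 2), (-1 : ℚ) ^ (i : ℕ) • M.map (SimplexCategory.δ i)

variable {M} in
theorem dM_apply {n : ℕ} (x : M.obj n) :
    dM M n x = ∑ i : Fin (n + 2), (-1 : ℚ) ^ (i : ℕ) • M.map (SimplexCategory.δ i) x := by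
  simp [dM]

theorem dM_dM {n : ℕ} (x : M.obj n) : dM M (n + 1) (dM M n x) = 0 := by
  rw [dM_apply, dM_apply]
  simp only [map_sum, map_smul, CoSimp.map_map]
  exact alt_alt fun g => M.map g x

variable {M N} in
theorem CoSimp.Hom.dM_app (F : CoSimp.Hom M N) {n : ℕ} (x : M.obj n) :
    dM N n (F.app n x) = F.app (n + 1) (dM M n x) := by
  simp only [dM_apply, map_sum, map_smul, F.naturality]

/-- Cochains of the diagonal. -/
abbrev R (n : ℕ) : Type u := L.obj (op (SimplexCategory.mk n)) → M.obj n

/-- The differential of the diagonal. -/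
noncomputable def dR (n : ℕ) : R L M n →ₗ[ℚ] R L M (n + 1) where
  toFun f y := ∑ i : Fin (n + 2), (-1 : ℚ) ^ (i : ℕ) •
    M.map (SimplexCategory.δ i) (f (L.map (SimplexCategory.δ i).op y))
  map_add' f g := by
    funext y
    simp [Finset.sum_add_distrib]
  map_smul' r f := by
    funext y
    simp only [Pi.smul_apply, map_smul, RingHom.id_apply, Finset.smul_sum]
    exact Finset.sum_congr rfl fun i _ => smul_comm _ _ _

variable {L M N}

theorem dR_apply {n : ℕ} (f : R L M n) (y) : dR L M n f y = ∑ i : Fin (n + 2), (-1 : ℚ) ^ (i : ℕ) •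
    M.map (SimplexCategory.δ i) (f (L.map (SimplexCategory.δ i).op y)) := rfl

theorem dR_dR {n : ℕ} (f : R L M n) : dR L M (n + 1) (dR L M n f) = 0 := by
  funext y
  rw [dR_apply]
  simp only [dR_apply, map_sum, map_smul, CoSimp.map_map, RatCohomology.map_map]
  exact alt_alt fun g => M.map g (f (L.map g.op y))

variable (L) in
/-- The map of diagonal cochains induced by a map of coefficients. -/
def CoSimp.Hom.mapR (F : CoSimp.Hom M N) (n : ℕ) : R L M n →ₗ[ℚ] R L N n where
  toFun f y := F.app n (f y)
  map_add' f g := by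
    funext y
    simp
  map_smul' r f := by
    funext y
    simp

theorem CoSimp.Hom.mapR_apply (F : CoSimp.Hom M N) {n : ℕ} (f : R L M n) (y) :
    F.mapR L n f y = F.app n (f y) := rfl

theorem CoSimp.Hom.dR_mapR (F : CoSimp.Hom M N) {n : ℕ} (f : R L M n) :
    dR L N n (F.mapR L n f) = F.mapR L (n + 1) (dR L M n f) := by
  funext y
  rw [mapR_apply, dR_apply, dR_apply, map_sum]
  simp only [map_smul, F.naturality, mapR_apply]

variable (L M) in
/-- The coboundaries of the diagonal. -/
noncomputable def bR : (n : ℕ) → Submodule ℚ (R L M n)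
  | 0 => ⊥
  | n + 1 => LinearMap.range (dR L M n)

theorem dR_of_mem {n : ℕ} {f : R L M n} (h : f ∈ bR L M n) : dR L M n f = 0 := by
  cases n with
  | zero =>
    have : f = 0 := h
    rw [this, map_zero]
  | succ n =>
    obtain ⟨g, rfl⟩ := h
    exact dR_dR g

theorem CoSimp.Hom.mapR_mem (F : CoSimp.Hom M N) {n : ℕ} {f : R L M n} (h : f ∈ bR L M n) :
    F.mapR L n f ∈ bR L N n := by
  cases n with
  | zero =>
    have : f = 0 := h
    rw [this, map_zero]
    exact zero_mem _
  | succ n =>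
    obtain ⟨g, rfl⟩ := h
    exact ⟨F.mapR L n g, F.dR_mapR g⟩

/-! #### Cross products with a cochain -/

/-- The cross product of `x` and a cochain. -/
def crossTerm {p q n : ℕ} (c : Cochain L q) (h : p + q = n) : M.obj p →ₗ[ℚ] R L M n where
  toFun x y := c (L.map (back h).op y) • M.map (front h) x
  map_add' x x' := by
    funext y
    simp
  map_smul' r x := by
    funext y
    simp [smul_comm r]

theorem crossTerm_apply {p q n : ℕ} (c : Cochain L q) (h : p + q = n) (x : M.obj p) (y) :
    crossTerm c h x y = c (L.map (back h).op y) • M.map (front h) x := rfl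

theorem CoSimp.Hom.mapR_crossTerm (F : CoSimp.Hom M N) {p q n : ℕ} (c : Cochain L q) (h : p + q = n)
    (x : M.obj p) : F.mapR L n (crossTerm c h x) = crossTerm c h (F.app p x) := by
  funext y
  rw [mapR_apply, crossTerm_apply, crossTerm_apply, map_smul, F.naturality]

/-- The Leibniz rule with one term missing. As c is a cocycle, its faces beyond the zeroth sum to
minus the zeroth one, and this supplies exactly the last front face, absent from the faces of index
at most p. -/
theorem dR_crossTerm {p q n : ℕ} {c : Cochain L q} (hc : c ∈ cocycles L q) (h : p + q = n)
    (h₁ : p + 1 + q = n + 1) (x : M.obj p) :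
    dR L M n (crossTerm c h x) = crossTerm c h₁ (dM M p x) := by
  have h₂ : p + (q + 1) = n + 1 := by omega
  funext y
  rw [dR_apply, crossTerm_apply, dM_apply]
  simp only [crossTerm_apply, map_smul, map_sum, CoSimp.map_map, RatCohomology.map_map]
  have hn : (p + 1) + (q + 1) = n + 2 := by omega
  have hcy : ∑ i : Fin (q + 2), (-1 : ℚ) ^ (i : ℕ) *
      c (L.map (SimplexCategory.δ i ≫ back h₂).op y) = 0 := by
    have := congrFun (mem_cocycles.1 hc) (L.map (back h₂).op y)
    simpa only [coboundary, LinearMap.coe_mk, AddHom.coe_mk, RatCohomology.map_map, Pi.zero_apply] using this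
  rw [← (finCongr hn).sum_comp, Fin.sum_univ_add, Fin.sum_univ_castSucc (n := p + 1),
    δ_last_front h₁ h₂]
  rw [Fin.sum_univ_succ, δ_zero_back h₁ h₂] at hcy
  have e1 : ∀ i : Fin (p + 1), (-1 : ℚ) ^ ((finCongr hn (Fin.castAdd (q + 1) i) : Fin _) : ℕ) •
      c (L.map (back h ≫ SimplexCategory.δ (finCongr hn (Fin.castAdd (q + 1) i))).op y) •
        M.map (front h ≫ SimplexCategory.δ (finCongr hn (Fin.castAdd (q + 1) i))) x =
      c (L.map (back h₁).op y) • (-1 : ℚ) ^ (i.castSucc : ℕ) •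
        M.map (SimplexCategory.δ i.castSucc ≫ front h₁) x := by
    intro i
    rw [front_δ_of_le h h₁ i.castSucc _ (by simp), back_δ_of_le h h₁ _ (by simp; omega), smul_comm]
    simp
  have e2 : ∀ i : Fin (q + 1), (-1 : ℚ) ^ ((finCongr hn (Fin.natAdd (p + 1) i) : Fin _) : ℕ) •
      c (L.map (back h ≫ SimplexCategory.δ (finCongr hn (Fin.natAdd (p + 1) i))).op y) •
        M.map (front h ≫ SimplexCategory.δ (finCongr hn (Fin.natAdd (p + 1) i))) x =
      ((-1 : ℚ) ^ p * ((-1 : ℚ) ^ (i.succ : ℕ) * c (L.map (SimplexCategory.δ i.succ ≫ back h₂).op y))) •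
        M.map (front h₂) x := by
    intro i
    rw [front_δ_of_gt h h₂ _ (by simp; omega), back_δ_of_gt h h₂ i.succ _ (by simp; omega), smul_smul]
    congr 1
    simp only [finCongr_apply, Fin.val_cast, Fin.val_natAdd, Fin.val_succ, pow_add, pow_one]
    ring
  simp only [e1, e2]
  rw [← Finset.smul_sum, ← Finset.sum_smul, ← Finset.mul_sum, smul_add, add_right_inj,
    eq_neg_of_add_eq_zero_right hcy, smul_smul]
  congr 1
  simp
  ring

/-! #### Families of coefficients -/

variable (r : ℕ → ℕ) (M) in
/-- Families of coefficients for cross products of total degree `n` with `r q` cochains of degree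
`q`, for all `q`. -/
abbrev Fam (n : ℕ) : Type u := (x : {x : ℕ × ℕ // x.1 + x.2 = n}) → Fin (r x.1.2) → M.obj x.1.1

variable {r : ℕ → ℕ}

/-- The differential of families. -/
noncomputable def dS {n : ℕ} (s : Fam M r n) : Fam M r (n + 1)
  | ⟨(0, _), _⟩, _ => 0
  | ⟨(p + 1, q), h⟩, j => dM M p (s ⟨(p, q), by dsimp only at h ⊢; omega⟩ j)

/-- The map of families induced by a map of coefficients. -/
def CoSimp.Hom.mapS (F : CoSimp.Hom M N) {n : ℕ} (s : Fam M r n) : Fam N r n :=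
  fun x j => F.app x.1.1 (s x j)

theorem dS_dS {n : ℕ} (s : Fam M r n) : dS (dS s) = 0 := by
  funext ⟨⟨p, q⟩, h⟩ j
  match p, h with
  | 0, _ => rfl
  | 1, _ => exact map_zero _
  | p + 2, _ => exact dM_dM M _

theorem dS_sub {n : ℕ} (s s' : Fam M r n) : dS (s - s') = dS s - dS s' := by
  funext ⟨⟨p, q⟩, h⟩ j
  match p, h with
  | 0, _ => exact (sub_zero _).symm
  | p + 1, _ => exact map_sub _ _ _

theorem dS_add {n : ℕ} (s s' : Fam M r n) : dS (s + s') = dS s + dS s' := by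
  funext ⟨⟨p, q⟩, h⟩ j
  match p, h with
  | 0, _ => exact (add_zero _).symm
  | p + 1, _ => exact map_add _ _ _

theorem CoSimp.Hom.dS_mapS (F : CoSimp.Hom M N) {n : ℕ} (s : Fam M r n) :
    dS (F.mapS s) = F.mapS (dS s) := by
  funext ⟨⟨p, q⟩, h⟩ j
  match p, h with
  | 0, _ => exact (map_zero _).symm
  | p + 1, _ => exact F.dM_app _

variable (c : ∀ q, Fin (r q) → Cochain L q)

/-- The sum of cross products of a family. -/
noncomputable def cr {n : ℕ} : Fam M r n →ₗ[ℚ] R L M n where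
  toFun s := ∑ p : Fin (n + 1), ∑ j : Fin (r (n - p)), crossTerm (c (n - p) j)
    (show (p : ℕ) + (n - p) = n by omega) (s ⟨(p, n - p), by dsimp only; omega⟩ j)
  map_add' s s' := by
    simp only [Pi.add_apply, map_add, Finset.sum_add_distrib]
  map_smul' a s := by
    simp only [Pi.smul_apply, map_smul, Finset.smul_sum, RingHom.id_apply]

theorem cr_apply {n : ℕ} (s : Fam M r n) : cr c s = ∑ p : Fin (n + 1), ∑ j : Fin (r (n - p)),
    crossTerm (c (n - p) j) (show (p : ℕ) + (n - p) = n by omega) (s ⟨(p, n - p), by dsimp only; omega⟩ j) := rfl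

theorem CoSimp.Hom.mapR_cr (F : CoSimp.Hom M N) {n : ℕ} (s : Fam M r n) :
    F.mapR L n (cr c s) = cr c (F.mapS s) := by
  simp only [cr_apply, map_sum, F.mapR_crossTerm]
  rfl

variable {c}

theorem dR_cr (hc : ∀ q j, c q j ∈ cocycles L q) {n : ℕ} (s : Fam M r n) :
    dR L M n (cr c s) = cr c (dS s) := by
  simp only [cr_apply, map_sum]
  conv_rhs => rw [Fin.sum_univ_succ]
  have h0 : ∀ j, crossTerm (c (n + 1 - ((0 : Fin (n + 2)) : ℕ)) j) (M := M)
    (show ((0 : Fin (n + 2)) : ℕ) + (n + 1 - ((0 : Fin (n + 2)) : ℕ)) = n + 1 by simp)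
    (dS s ⟨(((0 : Fin (n + 2)) : ℕ), n + 1 - ((0 : Fin (n + 2)) : ℕ)), by simp⟩ j) = 0 := by
    intro j
    exact map_zero _
  rw [Finset.sum_eq_zero fun j _ => h0 j, zero_add]
  refine Finset.sum_congr rfl fun p _ => ?_
  have key : ∀ q q' (h : (p : ℕ) + q = n) (h' : (p : ℕ) + 1 + q' = n + 1),
      ∑ j : Fin (r q), dR L M n (crossTerm (c q j) h (s ⟨(p, q), h⟩ j)) =
        ∑ j : Fin (r q'), crossTerm (c q' j) h' (dM M p (s ⟨(p, q'), by dsimp only; omega⟩ j)) := by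
    intro q q' h h'
    obtain rfl : q = q' := by omega
    exact Finset.sum_congr rfl fun j _ => dR_crossTerm (hc q j) h h' _
  exact key _ _ _ (by have := p.2; rw [Fin.val_succ]; omega)

end Kunneth

namespace Kunneth

open SimplexCategory RatCohomology

/-! #### The prism sum -/

/-- The combinatorics of a prism operator: F i k stands for the k-th face of the i-th piece. The
faces off the diagonal cancel against the homotopy of the faces, given by G, and the diagonal ones
telescope to the two ends. -/
theorem prism_sum {A : Type*} [AddCommGroup A] [Module ℚ A] (n : ℕ) (F G : ℕ → ℕ → A)
    (h1 : ∀ i k, k < i → i ≤ n → F i k = G k (i - 1))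
    (h2 : ∀ i k, i + 1 < k → k ≤ n + 1 → F i k = G (k - 1) i)
    (h3 : ∀ i < n, F i (i + 1) = F (i + 1) (i + 1)) :
    ∑ i ∈ Finset.range (n + 1), (-1 : ℚ) ^ i • ∑ k ∈ Finset.range (n + 2), (-1 : ℚ) ^ k • F i k +
      ∑ k ∈ Finset.range (n + 1), (-1 : ℚ) ^ k • ∑ i ∈ Finset.range n, (-1 : ℚ) ^ i • G k i =
    F 0 0 - F n (n + 1) := by
  have eF : ∀ i ∈ Finset.range (n + 1), (-1 : ℚ) ^ i • ∑ k ∈ Finset.range (n + 2),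
      (-1 : ℚ) ^ k • F i k = (F i i - F i (i + 1)) +
        (∑ k ∈ Finset.range (n + 2), (if k < i then (-1 : ℚ) ^ (i + k) • F i k else 0) +
        ∑ k ∈ Finset.range (n + 2), (if i + 1 < k then (-1 : ℚ) ^ (i + k) • F i k else 0)) := by
    intro i hi
    rw [Finset.mem_range] at hi
    have a1 : F i i = ∑ k ∈ Finset.range (n + 2), if k = i then (-1 : ℚ) ^ (i + k) • F i k else 0 := by
      rw [Finset.sum_ite_eq', if_pos (by simp; omega), ← two_mul, pow_mul]
      simp
    have a2 : - F i (i + 1) = ∑ k ∈ Finset.range (n + 2),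
        if k = i + 1 then (-1 : ℚ) ^ (i + k) • F i k else 0 := by
      rw [Finset.sum_ite_eq', if_pos (by simp; omega), ← add_assoc, ← two_mul, pow_succ, pow_mul]
      simp
    rw [sub_eq_add_neg, a1, a2, ← Finset.sum_add_distrib, ← Finset.sum_add_distrib,
      ← Finset.sum_add_distrib, Finset.smul_sum]
    refine Finset.sum_congr rfl fun k _ => ?_
    rw [smul_smul, ← pow_add]
    rcases lt_trichotomy k i with h | h | h
    · rw [if_neg (by omega), if_neg (by omega), if_pos h, if_neg (by omega)]
      simp
    · rw [if_pos h, if_neg (by omega), if_neg (by omega), if_neg (by omega)]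
      simp
    · by_cases h' : k = i + 1
      · rw [if_neg (by omega), if_pos h', if_neg (by omega), if_neg (by omega)]
        simp
      · rw [if_neg (by omega), if_neg h', if_neg (by omega), if_pos (by omega)]
        simp
  have eG : ∀ k ∈ Finset.range (n + 1), (-1 : ℚ) ^ k • ∑ i ∈ Finset.range n, (-1 : ℚ) ^ i • G k i =
      ∑ i ∈ Finset.range n, (if k ≤ i then (-1 : ℚ) ^ (i + k) • G k i else 0) +
        ∑ i ∈ Finset.range n, (if i < k then (-1 : ℚ) ^ (i + k) • G k i else 0) := by
    intro k _
    rw [Finset.smul_sum, ← Finset.sum_add_distrib]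
    refine Finset.sum_congr rfl fun i _ => ?_
    rw [smul_smul, ← pow_add, add_comm k i]
    by_cases h : k ≤ i
    · rw [if_pos h, if_neg (by omega), add_zero]
    · rw [if_neg h, if_pos (by omega), zero_add]
  have s1 : ∑ i ∈ Finset.range (n + 1), ∑ k ∈ Finset.range (n + 2),
      (if k < i then (-1 : ℚ) ^ (i + k) • F i k else 0) =
      - ∑ k ∈ Finset.range (n + 1), ∑ i ∈ Finset.range n,
        (if k ≤ i then (-1 : ℚ) ^ (i + k) • G k i else 0) := by
    rw [Finset.sum_comm, Finset.sum_range_succ, Finset.sum_eq_zero (s := Finset.range (n + 1))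
      (f := fun i => if n + 1 < i then (-1 : ℚ) ^ (i + (n + 1)) • F i (n + 1) else 0)
      (fun i hi => if_neg (by rw [Finset.mem_range] at hi; omega)), add_zero,
      ← Finset.sum_neg_distrib]
    refine Finset.sum_congr rfl fun k hk => ?_
    rw [Finset.sum_range_succ', if_neg (by omega), add_zero, ← Finset.sum_neg_distrib]
    refine Finset.sum_congr rfl fun i hi => ?_
    rw [Finset.mem_range] at hi
    by_cases h : k ≤ i
    · rw [if_pos h, if_pos (by omega), h1 _ _ (by omega) (by omega), Nat.add_sub_cancel,
        show i + 1 + k = i + k + 1 by omega, pow_succ]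
      simp
    · rw [if_neg h, if_neg (by omega), neg_zero]
  have s2 : ∑ i ∈ Finset.range (n + 1), ∑ k ∈ Finset.range (n + 2),
      (if i + 1 < k then (-1 : ℚ) ^ (i + k) • F i k else 0) =
      - ∑ k ∈ Finset.range (n + 1), ∑ i ∈ Finset.range n,
        (if i < k then (-1 : ℚ) ^ (i + k) • G k i else 0) := by
    rw [Finset.sum_comm, Finset.sum_range_succ', Finset.sum_eq_zero (s := Finset.range (n + 1))
      (f := fun i => if i + 1 < 0 then (-1 : ℚ) ^ (i + 0) • F i 0 else 0)
      (fun i hi => if_neg (by omega)), add_zero, ← Finset.sum_neg_distrib]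
    refine Finset.sum_congr rfl fun k hk => ?_
    rw [Finset.mem_range] at hk
    rw [Finset.sum_range_succ, if_neg (by omega), add_zero, ← Finset.sum_neg_distrib]
    refine Finset.sum_congr rfl fun i hi => ?_
    by_cases h : i < k
    · rw [if_pos h, if_pos (by omega), h2 _ _ (by omega) (by omega), Nat.add_sub_cancel,
        ← add_assoc, pow_succ]
      simp
    · rw [if_neg h, if_neg (by omega), neg_zero]
  have s3 : ∑ i ∈ Finset.range (n + 1), (F i i - F i (i + 1)) = F 0 0 - F n (n + 1) := by
    rw [Finset.sum_sub_distrib, Finset.sum_range_succ', Finset.sum_range_succ (fun i => F i (i + 1)),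
      Finset.sum_congr rfl fun i hi => h3 i (Finset.mem_range.1 hi)]
    abel
  rw [Finset.sum_congr rfl eF, Finset.sum_congr rfl eG, Finset.sum_add_distrib,
    Finset.sum_add_distrib, Finset.sum_add_distrib, s1, s2, s3]
  abel

/-- The `k`-th face map, with `k` a natural number. -/
def dd (n k : ℕ) : Mor n (n + 1) := SimplexCategory.mkHom
  { toFun := fun j => ⟨if (j : ℕ) < k then j else j + 1, by have := j.2; split_ifs <;> omega⟩
    monotone' := fun i j hij => by
      simp only [Fin.le_def] at hij ⊢
      split_ifs <;> omega }

/-- The `k`-th degeneracy map, with `k` a natural number. -/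
def ss (n k : ℕ) : Mor (n + 1) n := SimplexCategory.mkHom
  { toFun := fun j => ⟨if (j : ℕ) ≤ k then min (j : ℕ) n else j - 1, by
      have := j.2; split_ifs <;> omega⟩
    monotone' := fun i j hij => by
      simp only [Fin.le_def] at hij ⊢
      split_ifs <;> omega }

/-- The `k`-th degeneracy map, followed by the collapse of its initial segment. -/
def hh (n k : ℕ) : Mor (n + 1) n := SimplexCategory.mkHom
  { toFun := fun j => ⟨if (j : ℕ) ≤ k then 0 else (j : ℕ) - 1, by
      have := j.2; split_ifs <;> omega⟩
    monotone' := fun i j hij => by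
      simp only [Fin.le_def] at hij ⊢
      split_ifs <;> omega }

theorem dd_val (n k : ℕ) (j : Fin (n + 1)) :
    (((dd n k).toOrderHom j : Fin (n + 2)) : ℕ) = if (j : ℕ) < k then (j : ℕ) else j + 1 := rfl

theorem ss_val (n k : ℕ) (j : Fin (n + 2)) :
    (((ss n k).toOrderHom j : Fin (n + 1)) : ℕ) = if (j : ℕ) ≤ k then min (j : ℕ) n else j - 1 := rfl

theorem hh_val (n k : ℕ) (j : Fin (n + 2)) :
    (((hh n k).toOrderHom j : Fin (n + 1)) : ℕ) = if (j : ℕ) ≤ k then 0 else (j : ℕ) - 1 := rfl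

theorem comp_val {l m n : ℕ} (f : Mor l m) (g : Mor m n) (j : Fin (l + 1)) :
    (((f ≫ g).toOrderHom j : Fin (n + 1)) : ℕ) =
      (g.toOrderHom (f.toOrderHom j : Fin (m + 1)) : Fin (n + 1)) := rfl

theorem δ_eq_dd {n : ℕ} (i : Fin (n + 2)) : SimplexCategory.δ i = dd n i :=
  hom_ext_val fun k => δ_val i k

/-- The map of joins with a point. -/
def decMor {m n : ℕ} (f : Mor m n) : Mor (m + 1) (n + 1) := SimplexCategory.mkHom
  { toFun := Fin.cases 0 fun i => (f.toOrderHom i : Fin (n + 1)).succ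
    monotone' := fun i j hij => by
      induction i using Fin.cases with
      | zero => exact Fin.zero_le _
      | succ i =>
        induction j using Fin.cases with
        | zero => simp at hij
        | succ j =>
          simp only [Fin.cases_succ]
          exact Fin.succ_le_succ_iff.2 (f.toOrderHom.monotone (Fin.succ_le_succ_iff.1 hij)) }

theorem decMor_zero {m n : ℕ} (f : Mor m n) :
    ((decMor f).toOrderHom (0 : Fin (m + 2)) : Fin (n + 2)) = 0 := rfl

theorem decMor_succ {m n : ℕ} (f : Mor m n) (i : Fin (m + 1)) :
    ((decMor f).toOrderHom i.succ : Fin (n + 2)) = (f.toOrderHom i : Fin (n + 1)).succ := rfl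

theorem mor_ext {m n : ℕ} {f g : Mor m n}
    (h : ∀ k : Fin (m + 1), (f.toOrderHom k : Fin (n + 1)) = g.toOrderHom k) : f = g :=
  SimplexCategory.Hom.ext _ _ (OrderHom.ext _ _ (funext h))

theorem decMor_id (n : ℕ) : decMor (𝟙 (SimplexCategory.mk n)) = 𝟙 _ := by
  refine mor_ext fun k => ?_
  induction k using Fin.cases with
  | zero => rfl
  | succ k => rfl

theorem decMor_comp {l m n : ℕ} (f : Mor l m) (g : Mor m n) :
    decMor f ≫ decMor g = decMor (f ≫ g) := by
  refine mor_ext fun k => ?_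
  induction k using Fin.cases with
  | zero => rfl
  | succ k => rfl

/-- The shift has no face of index zero. This frees one degeneracy, `ss _ 0`, to act as a
contraction. -/
theorem decMor_dd (n k : ℕ) : decMor (dd n k) = dd (n + 1) (k + 1) := by
  refine hom_ext_val fun (j : Fin _) => ?_
  induction j using Fin.cases with
  | zero =>
    rw [decMor_zero, dd_val]
    simp
  | succ j =>
    rw [decMor_succ, dd_val, Fin.val_succ, Fin.val_succ, dd_val]
    split_ifs <;> omega

theorem δ_zero_decMor {m n : ℕ} (f : Mor m n) :
    SimplexCategory.δ 0 ≫ decMor f = f ≫ SimplexCategory.δ 0 := rfl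

/-! #### Shifted coefficients -/

/-- The shift of a cosimplicial vector space. -/
@[reducible] def Dec (M : CoSimp.{u}) : CoSimp.{u} where
  obj n := M.obj (n + 1)
  map f := M.map (decMor f)
  map_id n x := by rw [decMor_id, M.map_id]
  map_map f g x := by rw [M.map_map, decMor_comp]

/-- Constant coefficients. -/
@[reducible] def const (V : Type u) [AddCommGroup V] [Module ℚ V] : CoSimp.{u} where
  obj _ := V
  map _ := LinearMap.id
  map_id _ _ := rfl
  map_map _ _ _ := rfl

variable (M : CoSimp.{u})

/-- The map to the shift. -/
def toDec : CoSimp.Hom M (Dec M) where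
  app n := M.map (SimplexCategory.δ 0)
  naturality f x := by
    change M.map _ (M.map _ x) = M.map (decMor f) (M.map _ x)
    rw [M.map_map, M.map_map, δ_zero_decMor]

theorem toDec_injective (n : ℕ) : Function.Injective ((toDec M).app n) := by
  intro x y h
  have e : SimplexCategory.δ (0 : Fin (n + 2)) ≫ SimplexCategory.σ (0 : Fin (n + 1)) = 𝟙 _ :=
    SimplexCategory.δ_comp_σ_self
  have hx : ∀ x, M.map (SimplexCategory.σ 0) ((toDec M).app n x) = x := fun x => by
    change M.map _ (M.map _ x) = x
    rw [M.map_map, e, M.map_id]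
  rw [← hx x, h, hx]

/-- The cokernel of the map to the shift. -/
@[reducible] def Coker : CoSimp.{u} where
  obj n := M.obj (n + 1) ⧸ LinearMap.range ((toDec M).app n)
  map {m n} f := Submodule.mapQ _ _ (M.map (decMor f)) (by
    rintro _ ⟨x, rfl⟩
    exact ⟨M.map f x, (toDec M).naturality f x⟩)
  map_id n x := by
    obtain ⟨x, rfl⟩ := Submodule.Quotient.mk_surjective _ x
    exact congrArg _ ((Dec M).map_id n x)
  map_map f g x := by
    obtain ⟨x, rfl⟩ := Submodule.Quotient.mk_surjective _ x
    exact congrArg _ ((Dec M).map_map f g x)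

/-- The projection to the cokernel. -/
def toCoker : CoSimp.Hom (Dec M) (Coker M) where
  app _ := Submodule.mkQ _
  naturality _ _ := rfl

theorem toCoker_surjective (n : ℕ) : Function.Surjective ((toCoker M).app n) :=
  Submodule.mkQ_surjective _

theorem exists_of_toCoker_eq_zero {n : ℕ} {x : (Dec M).obj n} (h : (toCoker M).app n x = 0) :
    ∃ y, (toDec M).app n y = x :=
  (Submodule.Quotient.mk_eq_zero _).1 h

theorem toCoker_toDec {n : ℕ} (x : M.obj n) : (toCoker M).app n ((toDec M).app n x) = 0 :=
  (Submodule.Quotient.mk_eq_zero _).2 ⟨x, rfl⟩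

/-- The map to a point. -/
def toPt (n : ℕ) : Mor n 0 := SimplexCategory.mkHom ⟨fun _ => 0, fun _ _ _ => le_rfl⟩

/-- The initial vertex. -/
def vertZero (n : ℕ) : Mor 0 n := SimplexCategory.mkHom ⟨fun _ => 0, fun _ _ _ => le_rfl⟩

theorem mor_zero_eq {n : ℕ} (f g : Mor n 0) : f = g :=
  mor_ext fun _ => Subsingleton.elim (α := Fin 1) _ _

theorem vertZero_decMor {m n : ℕ} (f : Mor m n) : vertZero (m + 1) ≫ decMor f = vertZero (n + 1) :=
  rfl

/-- The collapse of the shift. -/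
def colDec : CoSimp.Hom (Dec M) (const (M.obj 0)) where
  app n := M.map (toPt (n + 1))
  naturality f x := by
    change M.map _ (M.map (decMor f) x) = M.map _ x
    rw [M.map_map]
    exact congrArg (fun g => M.map g x) (mor_zero_eq _ _)

/-- The inclusion of the initial vertex. -/
def incDec : CoSimp.Hom (const (M.obj 0)) (Dec M) where
  app n := M.map (vertZero (n + 1))
  naturality f x := by
    change M.map _ x = M.map (decMor f) (M.map _ x)
    rw [M.map_map, vertZero_decMor]

variable {M}

theorem dM_Dec {n : ℕ} (x : (Dec M).obj n) : dM (Dec M) n x =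
    ∑ i : Fin (n + 2), (-1 : ℚ) ^ (i : ℕ) • M.map (dd (n + 1) (i + 1)) x := by
  rw [dM_apply]
  refine Finset.sum_congr rfl fun i _ => ?_
  change _ • M.map (decMor _) x = _
  rw [δ_eq_dd, decMor_dd]

theorem dd_ss_succ {n k : ℕ} : dd n (k + 1) ≫ ss n k = 𝟙 _ := by
  refine hom_ext_val fun (j : Fin _) => ?_
  rw [comp_val, ss_val, dd_val]
  change _ = (j : ℕ)
  have := j.2
  split_ifs <;> omega

theorem dd_ss_of_lt {n i k : ℕ} (h : i + 1 < k) (hk : k ≤ n + 2) :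
    dd (n + 1) k ≫ ss (n + 1) i = ss n i ≫ dd n (k - 1) := by
  refine hom_ext_val fun (j : Fin _) => ?_
  rw [comp_val, comp_val, ss_val, dd_val, dd_val, ss_val]
  have := j.2
  split_ifs <;> omega

theorem dd_ss_of_gt {n i k : ℕ} (h : k < i) (hi : i ≤ n + 1) :
    dd (n + 1) k ≫ ss (n + 1) i = ss n (i - 1) ≫ dd n k := by
  refine hom_ext_val fun (j : Fin _) => ?_
  rw [comp_val, comp_val, ss_val, dd_val, dd_val, ss_val]
  have := j.2
  split_ifs <;> omega

theorem dd_hh_of_lt {n i k : ℕ} (h : i + 1 < k) :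
    dd (n + 1) k ≫ hh (n + 1) i = hh n i ≫ dd n (k - 1) := by
  refine hom_ext_val fun (j : Fin _) => ?_
  rw [comp_val, comp_val, hh_val, dd_val, dd_val, hh_val]
  have := j.2
  split_ifs <;> omega

theorem dd_hh_of_gt {n i k : ℕ} (h : k < i) (hk : 0 < k) :
    dd (n + 1) k ≫ hh (n + 1) i = hh n (i - 1) ≫ dd n k := by
  refine hom_ext_val fun (j : Fin _) => ?_
  rw [comp_val, comp_val, hh_val, dd_val, dd_val, hh_val]
  have := j.2
  split_ifs <;> omega

/-- Cocycles of positive degree of the shift are coboundaries. -/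
theorem dM_Dec_of_cocycle {n : ℕ} {x : (Dec M).obj (n + 1)} (h : dM (Dec M) (n + 1) x = 0) :
    dM (Dec M) n (M.map (ss (n + 1) 0) x) = x := by
  -- The extra degeneracy applied to the cocycle identity: the first face gives back x, and the
  -- others commute past it with index lowered by one.
  have h0 := congrArg (M.map (ss (n + 2) 0)) h
  rw [dM_Dec, Fin.sum_univ_succ, map_add, map_sum, map_zero] at h0
  simp only [map_smul, CoSimp.map_map] at h0
  rw [show ((0 : Fin (n + 1 + 2)) : ℕ) = 0 from rfl, dd_ss_succ, M.map_id, pow_zero,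
    one_smul] at h0
  conv_rhs => rw [eq_neg_of_add_eq_zero_left h0]
  rw [dM_Dec, ← Finset.sum_neg_distrib]
  refine Finset.sum_congr rfl fun i _ => ?_
  rw [M.map_map, dd_ss_of_lt (by simp) (by have := i.2; simp; omega), Fin.val_succ, pow_succ]
  simp

/-- Cocycles of degree zero of the shift come from the base point. -/
theorem incDec_colDec_of_cocycle {x : (Dec M).obj 0} (h : dM (Dec M) 0 x = 0) :
    (incDec M).app 0 ((colDec M).app 0 x) = x := by
  have h0 := congrArg (M.map (ss 1 0)) h
  rw [dM_Dec, Fin.sum_univ_two, map_add, map_zero] at h0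
  simp only [map_smul, CoSimp.map_map] at h0
  rw [show ((0 : Fin 2) : ℕ) = 0 from rfl, show ((1 : Fin 2) : ℕ) = 1 from rfl,
    dd_ss_succ, M.map_id, pow_zero, one_smul, pow_one, neg_one_smul,
    ← sub_eq_add_neg, sub_eq_zero] at h0
  change M.map _ (M.map _ x) = x
  rw [M.map_map]
  conv_rhs => rw [h0]
  refine congrArg (fun g => M.map g x) (hom_ext_val fun (j : Fin _) => ?_)
  rw [comp_val, comp_val, ss_val, dd_val]
  have := j.2
  change 0 = _
  split_ifs <;> omega

/-- The shift is homotopy equivalent to the base point. -/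
theorem sub_incDec_colDec_mem {L : SSet.{u}} {n : ℕ} {f : R L (Dec M) n}
    (hf : dR L (Dec M) n f = 0) : f - (incDec M).mapR L n ((colDec M).mapR L n f) ∈ bR L (Dec M) n := by
  let T : Mor (n + 1) (n + 1) → Mor n n → R L (Dec M) n :=
    fun a b y => M.map a (f (L.map b.op y))
  -- Pieces of a prism: `ss n i` degenerates the simplex of L while `hh` collapses an initial
  -- segment of the coefficient to the base vertex. The ends F 0 0 and F n (n + 1) are f and its
  -- full collapse.
  let F : ℕ → ℕ → R L (Dec M) n := fun i k =>
    T (dd (n + 1) (k + 1) ≫ hh (n + 1) (i + 1)) (dd n k ≫ ss n i)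
  -- Each inner sum is the cocycle identity of f at a degenerate simplex, pushed along `hh`.
  have hF : ∑ i ∈ Finset.range (n + 1), (-1 : ℚ) ^ i • ∑ k ∈ Finset.range (n + 2),
      (-1 : ℚ) ^ k • F i k = 0 := by
    refine Finset.sum_eq_zero fun i _ => ?_
    have : ∑ k ∈ Finset.range (n + 2), (-1 : ℚ) ^ k • F i k = 0 := by
      funext y
      have h0 := congrArg (M.map (hh (n + 1) (i + 1))) (congrFun hf (L.map (ss n i).op y))
      rw [dR_apply, map_sum, Pi.zero_apply, map_zero] at h0
      rw [Finset.sum_range, Finset.sum_apply, Pi.zero_apply, ← h0]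
      refine Finset.sum_congr rfl fun k _ => ?_
      rw [map_smul, Pi.smul_apply, show F i k y = M.map (dd (n + 1) (k + 1) ≫ hh (n + 1) (i + 1))
        (f (L.map (dd n k ≫ ss n i).op y)) from rfl]
      refine congrArg _ ?_
      change _ = M.map _ (M.map (decMor _) _)
      rw [M.map_map, RatCohomology.map_map, δ_eq_dd, decMor_dd]
    rw [this, smul_zero]
  have h00 : F 0 0 = f := by
    funext y
    change M.map _ (f (L.map _ y)) = f y
    rw [show dd n 0 ≫ ss n 0 = 𝟙 _ from hom_ext_val fun (j : Fin _) => by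
        rw [comp_val, ss_val, dd_val]
        change _ = (j : ℕ)
        have := j.2
        split_ifs <;> omega,
      show dd (n + 1) (0 + 1) ≫ hh (n + 1) (0 + 1) = 𝟙 _ from hom_ext_val fun (j : Fin _) => by
        rw [comp_val, hh_val, dd_val]
        change _ = (j : ℕ)
        have := j.2
        split_ifs <;> omega]
    rw [M.map_id]
    simp
  have hnn : F n (n + 1) = (incDec M).mapR L n ((colDec M).mapR L n f) := by
    funext y
    change M.map _ (f (L.map _ y)) = M.map _ (M.map _ (f y))
    rw [M.map_map, dd_ss_succ,
      show dd (n + 1) (n + 1 + 1) ≫ hh (n + 1) (n + 1) = toPt (n + 1) ≫ vertZero (n + 1) from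
        hom_ext_val fun (j : Fin _) => by
          rw [comp_val, hh_val, dd_val]
          change _ = 0
          have := j.2
          split_ifs <;> omega]
    simp
  have h3 : ∀ i < n, F i (i + 1) = F (i + 1) (i + 1) := by
    intro i hi
    have e1 : dd n (i + 1) ≫ ss n i = dd n (i + 1) ≫ ss n (i + 1) := hom_ext_val fun (j : Fin _) => by
      rw [comp_val, comp_val, ss_val, ss_val, dd_val]
      have := j.2
      split_ifs <;> omega
    have e2 : dd (n + 1) (i + 1 + 1) ≫ hh (n + 1) (i + 1) =
        dd (n + 1) (i + 1 + 1) ≫ hh (n + 1) (i + 1 + 1) := hom_ext_val fun (j : Fin _) => by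
      rw [comp_val, comp_val, hh_val, hh_val, dd_val]
      have := j.2
      split_ifs <;> omega
    change T _ _ = T _ _
    rw [e1, e2]
  cases n with
  | zero =>
    have := prism_sum 0 F (fun _ _ => 0) (fun i k h h' => by omega) (fun i k h h' => by omega) h3
    rw [hF, h00, hnn] at this
    rw [← this]
    simp
  | succ n =>
    have := prism_sum (n + 1) F
      (fun k i => T (hh (n + 1) (i + 1) ≫ dd (n + 1) (k + 1)) (ss n i ≫ dd n k))
      (fun i k h h' => by
        change T _ _ = T _ _
        rw [dd_ss_of_gt h h', dd_hh_of_gt (by omega) (by omega)]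
        rw [show i + 1 - 1 = i - 1 + 1 by omega])
      (fun i k h h' => by
        change T _ _ = T _ _
        rw [dd_ss_of_lt h (by omega), dd_hh_of_lt (by omega)]
        rw [show k + 1 - 1 = k - 1 + 1 by omega]) h3
    rw [hF, h00, hnn, zero_add] at this
    rw [← this]
    refine ⟨∑ i ∈ Finset.range (n + 1), (-1 : ℚ) ^ i •
      (fun y => M.map (hh (n + 1) (i + 1)) (f (L.map (ss n i).op y)) : R L (Dec M) n), ?_⟩
    funext y
    rw [dR_apply, Finset.sum_apply]
    conv_rhs => rw [Finset.sum_range]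
    refine Finset.sum_congr rfl fun k _ => ?_
    rw [Pi.smul_apply, Finset.sum_apply, Finset.sum_apply, map_sum]
    refine congrArg _ (Finset.sum_congr rfl fun i _ => ?_)
    rw [Pi.smul_apply, Pi.smul_apply, map_smul]
    refine congrArg _ ?_
    change M.map (decMor _) (M.map _ _) = M.map _ _
    rw [M.map_map, RatCohomology.map_map, δ_eq_dd, decMor_dd]

end Kunneth

/-! ### The Künneth theorem -/

namespace SemiSimp

/-- The cycles of a semi-simplicial set. -/
noncomputable def cyc (S : SemiSimp.{u}) : (n : ℕ) → Submodule ℚ (S.Ch n)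
  | 0 => ⊤
  | n + 1 => LinearMap.ker (S.bd n)

end SemiSimp

namespace Kunneth

open SimplexCategory RatCohomology

/-- The semi-simplicial set underlying a simplicial set. -/
@[reducible] def semi (L : SSet.{u}) : SemiSimp.{u} where
  T n := L.obj (op (SimplexCategory.mk n))
  face i x := L.map (SimplexCategory.δ i).op x
  face_face i j hij x := by
    rw [RatCohomology.map_map, RatCohomology.map_map, SimplexCategory.δ_comp_δ hij]

/-- Dual bases of the homology and the cohomology of a simplicial set. -/
structure HBasis (L : SSet.{u}) where
  /-- The Betti numbers. -/
  r : ℕ → ℕ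
  /-- The basis of cohomology. -/
  c : ∀ q, Fin (r q) → Cochain L q
  hc : ∀ q j, c q j ∈ cocycles L q
  /-- The basis of homology. -/
  z : ∀ q, Fin (r q) → (semi L).Ch q
  hz : ∀ q j, z q j ∈ (semi L).cyc q
  dual : ∀ q j k, Finsupp.linearCombination ℚ (c q j) (z q k) = if j = k then 1 else 0
  span : ∀ q, ∀ y ∈ (semi L).cyc q, ∃ w, y = ∑ j, Finsupp.linearCombination ℚ (c q j) y • z q j +
    (semi L).bd q w

/-! ### Universal coefficients for constant coefficients -/

section const

variable {L : SSet.{u}} {V : Type u} [AddCommGroup V] [Module ℚ V]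

/-- The extension of a cochain to chains. -/
noncomputable def lc {n : ℕ} (f : R L (const V) n) : (semi L).Ch n →ₗ[ℚ] V :=
  Finsupp.linearCombination ℚ (fun y => f y : L.obj (op (SimplexCategory.mk n)) → V)

theorem lc_single {n : ℕ} (f : R L (const V) n) (y : L.obj (op (SimplexCategory.mk n))) :
    lc f (Finsupp.single y 1) = f y := by
  simp [lc]

theorem lc_dR {n : ℕ} (f : R L (const V) n) (z : (semi L).Ch (n + 1)) :
    lc (dR L (const V) n f) z = lc f ((semi L).bd n z) := by
  suffices h : lc (dR L (const V) n f) = lc f ∘ₗ (semi L).bd n from congrArg (fun F => F z) h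
  refine Finsupp.lhom_ext' fun y => LinearMap.ext_ring ?_
  simp only [LinearMap.comp_apply, Finsupp.lsingle_apply]
  rw [lc_single, SemiSimp.bd_single, map_sum, dR_apply]
  refine Finset.sum_congr rfl fun i _ => ?_
  rw [map_smul, lc_single]
  rfl

theorem lc_smul {n : ℕ} (c : Cochain L n) (v : V) (z : (semi L).Ch n) :
    lc (fun y => c y • v : R L (const V) n) z = Finsupp.linearCombination ℚ c z • v := by
  suffices h : lc (fun y => c y • v : R L (const V) n) =
      (LinearMap.toSpanSingleton ℚ V v) ∘ₗ Finsupp.linearCombination ℚ c from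
    congrArg (fun F => F z) h
  refine Finsupp.lhom_ext' fun y => LinearMap.ext_ring ?_
  simp only [LinearMap.comp_apply, Finsupp.lsingle_apply]
  rw [lc_single]
  simp

theorem lc_add {n : ℕ} (f g : R L (const V) n) (z : (semi L).Ch n) :
    lc (f + g) z = lc f z + lc g z := by
  rw [← LinearMap.add_apply]
  congr 1
  refine Finsupp.lhom_ext' fun y => LinearMap.ext_ring ?_
  simp only [LinearMap.comp_apply, Finsupp.lsingle_apply, LinearMap.add_apply]
  rw [lc_single, lc_single, lc_single]
  rfl

theorem lc_zero {n : ℕ} (z : (semi L).Ch n) : lc (0 : R L (const V) n) z = 0 := by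
  have := lc_add (0 : R L (const V) n) 0 z
  simpa using this

theorem lc_sub {n : ℕ} (f g : R L (const V) n) (z : (semi L).Ch n) :
    lc (f - g) z = lc f z - lc g z := by
  rw [eq_sub_iff_add_eq, ← lc_add, sub_add_cancel]

theorem lc_sum {n : ℕ} {ι : Type*} (s : Finset ι) (f : ι → R L (const V) n) (z : (semi L).Ch n) :
    lc (∑ i ∈ s, f i) z = ∑ i ∈ s, lc (f i) z := by
  classical
  induction s using Finset.induction_on with
  | empty => simpa using lc_zero z
  | insert i s hi ih => rw [Finset.sum_insert hi, Finset.sum_insert hi, lc_add, ih]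

theorem exists_comp_eq {A B W : Type*} [AddCommGroup A] [Module ℚ A] [AddCommGroup B] [Module ℚ B]
    [AddCommGroup W] [Module ℚ W] (f : A →ₗ[ℚ] B) (g : A →ₗ[ℚ] W)
    (h : ∀ x, f x = 0 → g x = 0) : ∃ k : B →ₗ[ℚ] W, ∀ x, k (f x) = g x := by
  obtain ⟨k, hk⟩ := LinearMap.exists_extend
    (((LinearMap.ker f).liftQ g fun x hx => h x hx) ∘ₗ f.quotKerEquivRange.symm.toLinearMap)
  refine ⟨k, fun x => ?_⟩
  have := congrArg (fun F => F ⟨f x, ⟨x, rfl⟩⟩) hk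
  simp only [LinearMap.comp_apply, Submodule.subtype_apply] at this
  rw [this]
  have e : f.quotKerEquivRange.symm ⟨f x, ⟨x, rfl⟩⟩ = Submodule.Quotient.mk x := by
    rw [LinearEquiv.symm_apply_eq]
    rfl
  change (LinearMap.ker f).liftQ g _ (f.quotKerEquivRange.symm _) = _
  rw [e]
  rfl

/-- A map vanishing on cycles factors through the boundary, and over a field it extends from the
boundaries to all chains. -/
theorem mem_bR_const {n : ℕ} {f : R L (const V) n} (h : ∀ z ∈ (semi L).cyc n, lc f z = 0) :
    f ∈ bR L (const V) n := by
  cases n with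
  | zero =>
    refine (Submodule.mem_bot ℚ).2 (funext fun y => ?_)
    rw [← lc_single f y]
    exact h _ trivial
  | succ n =>
    obtain ⟨k, hk⟩ := exists_comp_eq ((semi L).bd n) (lc f) h
    refine ⟨fun y => k (Finsupp.single y 1), funext fun y => ?_⟩
    have : ∀ w, lc (fun y => k (Finsupp.single y 1) : R L (const V) n) w = k w := by
      intro w
      congr 1
      refine Finsupp.lhom_ext' fun y => LinearMap.ext_ring ?_
      simp only [LinearMap.comp_apply, Finsupp.lsingle_apply]
      rw [lc_single]
    rw [← lc_single (dR L (const V) n _), lc_dR, this, hk, lc_single]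

theorem lc_bd_of_cocycle {n : ℕ} {f : R L (const V) n} (h : dR L (const V) n f = 0)
    (w : (semi L).Ch (n + 1)) : lc f ((semi L).bd n w) = 0 := by
  rw [← lc_dR, h, lc_zero]

end const

/-! ### Künneth exactness for cosimplicial coefficients, by dimension shifting -/

section fam

variable {L : SSet.{u}} (B : HBasis L)

theorem lc_sum_smul {V : Type u} [AddCommGroup V] [Module ℚ V] {n : ℕ} (v : Fin (B.r n) → V)
    (k : Fin (B.r n)) :
    lc (∑ j, (fun y => B.c n j y • v j : R L (const V) n)) (B.z n k) = v k := by
  rw [lc_sum]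
  simp only [lc_smul, B.dual]
  simp

theorem eq_zero_of_sum_mem {V : Type u} [AddCommGroup V] [Module ℚ V] {n : ℕ} {v : Fin (B.r n) → V}
    (h : ∑ j, (fun y => B.c n j y • v j : R L (const V) n) ∈ bR L (const V) n) : v = 0 := by
  funext k
  rw [← lc_sum_smul B v k]
  cases n with
  | zero =>
    rw [(Submodule.mem_bot ℚ).1 h, lc_zero]
    rfl
  | succ n =>
    obtain ⟨g, hg⟩ := h
    have hz : (semi L).bd n (B.z (n + 1) k) = 0 := B.hz (n + 1) k
    rw [← hg, lc_dR, hz, map_zero]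
    rfl

/-- Every cycle is a combination of the basis cycles up to a boundary, so a cocycle is determined
modulo coboundaries by its values on them. With `eq_zero_of_sum_mem` this is Künneth for constant
coefficients. -/
theorem sub_sum_mem {V : Type u} [AddCommGroup V] [Module ℚ V] {n : ℕ} {f : R L (const V) n}
    (h : dR L (const V) n f = 0) :
    f - ∑ j, (fun y => B.c n j y • lc f (B.z n j) : R L (const V) n) ∈ bR L (const V) n := by
  refine mem_bR_const fun y hy => ?_
  obtain ⟨w, e⟩ := B.span n y hy
  rw [lc_sub, lc_sum]
  simp only [lc_smul]
  conv_lhs =>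
    arg 1
    rw [e]
  rw [map_add, map_sum, lc_bd_of_cocycle h, add_zero, sub_eq_zero]
  simp only [map_smul]

variable {M : CoSimp.{u}}

theorem back_self {n : ℕ} (h : 0 + n = n) : back h = 𝟙 _ :=
  hom_ext_val fun (k : Fin _) => by
    change 0 + (k : ℕ) = k
    omega

/-- A family in which only the coefficients of degree zero do not vanish. -/
def famZero (r : ℕ → ℕ) {n : ℕ} (v : Fin (r n) → M.obj 0) : Fam M r n
  | ⟨(0, q), h⟩, j => v (Fin.cast (congrArg r ((Nat.zero_add q).symm.trans h)) j)
  | ⟨(_ + 1, _), _⟩, _ => 0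

theorem cr_famZero {n : ℕ} (v : Fin (B.r n) → M.obj 0) :
    cr B.c (famZero B.r v) = fun y => ∑ j, B.c n j y • M.map (vertZero n) (v j) := by
  rw [cr_apply, Fin.sum_univ_succ]
  refine (add_eq_left.2 (Finset.sum_eq_zero fun p _ =>
    Finset.sum_eq_zero fun j _ => map_zero _)).trans ?_
  funext y
  rw [Finset.sum_apply]
  refine Finset.sum_congr rfl fun j _ => ?_
  have hb : ∀ (h : 0 + n = n) (y : L.obj (op (SimplexCategory.mk n))), L.map (back h).op y = y := by
    intro h y
    rw [back_self h]
    simp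
  exact congrArg₂ (fun (a : ℚ) (b : M.obj n) => a • b) (congrArg (B.c n j) (hb (Nat.zero_add n) y))
    (congrArg (fun g => M.map g (v j)) (hom_ext_val fun (k : Fin _) => Nat.lt_one_iff.1 k.2))

theorem eq_famZero {n : ℕ} {r : ℕ → ℕ} {s : Fam M r n} (h : ∀ p q h j, s ⟨(p + 1, q), h⟩ j = 0) :
    s = famZero r (fun j => s ⟨(0, n), Nat.zero_add n⟩ j) := by
  funext ⟨⟨p, q⟩, hpq⟩ j
  match p, hpq with
  | 0, hpq =>
    obtain rfl : q = n := by simpa using hpq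
    rfl
  | p + 1, hpq => exact h p q hpq j

theorem dS_famZero {n : ℕ} {r : ℕ → ℕ} {V : Type u} [AddCommGroup V] [Module ℚ V]
    (v : Fin (r n) → V) : dS (famZero (M := const V) r v) = 0 := by
  funext ⟨⟨p, q⟩, hpq⟩ j
  match p, hpq with
  | 0, _ => rfl
  | 1, _ =>
    change dM (const V) 0 _ = 0
    rw [dM_apply, Fin.sum_univ_two]
    simp [const]
  | p + 2, _ => exact map_zero _

variable (M) in
/-- Exactness of the mapping cone of the cross product in degree `n`. -/
def Ex : ℕ → Prop
  | 0 => ∀ s : Fam M B.r 0, cr B.c s = 0 → s = 0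
  | n + 1 => ∀ (s : Fam M B.r (n + 1)) (f : R L M n), dS s = 0 → cr B.c s = dR L M n f →
    ∃ s' : Fam M B.r n, s = dS s' ∧ f - cr B.c s' ∈ bR L M n

variable (M) in
theorem ex_zero : Ex B M 0 := by
  intro s hs
  have e : s = famZero B.r (fun j => s ⟨(0, 0), Nat.zero_add 0⟩ j) :=
    eq_famZero fun p q h j => absurd h (by dsimp only; omega)
  rw [e, cr_famZero] at hs
  have : (fun j => s ⟨(0, 0), Nat.zero_add 0⟩ j) = 0 := by
    refine eq_zero_of_sum_mem (V := M.obj 0) B ((Submodule.mem_bot ℚ).2 ?_)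
    rw [← hs]
    funext y
    rw [Finset.sum_apply]
    refine Finset.sum_congr rfl fun j _ => ?_
    rw [show vertZero 0 = 𝟙 _ from mor_zero_eq _ _, M.map_id]
  rw [e, this]
  funext ⟨⟨p, q⟩, hpq⟩ j
  match p, hpq with
  | 0, hpq => rfl
  | p + 1, hpq => rfl

-- The shift contracts onto the constant coefficients `M.obj 0`. An exact change of family removes
-- all coefficients of positive degree, and the remaining problem is the one for constant
-- coefficients.
variable (M) in
theorem ex_Dec (n : ℕ) : Ex B (Dec M) (n + 1) := by
  intro s f hs hf
  -- The contraction `ss _ 0` integrates the closed coefficients of positive degree.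
  let s' : Fam (Dec M) B.r n := fun x j =>
    M.map (ss (x.1.1 + 1) 0) (s ⟨(x.1.1 + 1, x.1.2), by have := x.2; dsimp only; omega⟩ j)
  have hs1 : ∀ p q h j, (s - dS s') ⟨(p + 1, q), h⟩ j = 0 := by
    intro p q h j
    refine sub_eq_zero.2 (dM_Dec_of_cocycle ?_).symm
    exact congrFun (congrFun hs ⟨(p + 2, q), by dsimp only at h ⊢; omega⟩) j
  have hs0 : ∀ j, (s - dS s') ⟨(0, n + 1), Nat.zero_add _⟩ j =
      s ⟨(0, n + 1), Nat.zero_add _⟩ j := fun j => sub_zero _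
  set t := s - dS s' with ht
  set f1 := f - cr B.c s' with hf1
  have htf : cr B.c t = dR L (Dec M) n f1 := by
    rw [ht, hf1, map_sub, map_sub, hf, dR_cr B.hc]
  -- The collapse of t is a combination of basis cocycles and is a coboundary, hence zero.
  -- Degree-zero cocycles of the shift are recovered from their collapse.
  have ht0 : t = 0 := by
    have hcol : (colDec M).mapS t = famZero B.r
        (fun j => (colDec M).app 0 (t ⟨(0, n + 1), Nat.zero_add _⟩ j)) :=
      eq_famZero fun p q h j => by
        change (colDec M).app _ (t _ j) = 0
        rw [hs1, map_zero]
    have hv : (fun j => (colDec M).app 0 (t ⟨(0, n + 1), Nat.zero_add _⟩ j)) = 0 := by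
      refine eq_zero_of_sum_mem B ?_
      refine ⟨(colDec M).mapR L n f1, ?_⟩
      rw [(colDec M).dR_mapR, ← htf, (colDec M).mapR_cr, hcol, cr_famZero]
      funext y
      rw [Finset.sum_apply]
      rfl
    rw [eq_famZero hs1]
    have : (fun j => t ⟨(0, n + 1), Nat.zero_add _⟩ j) = 0 := by
      funext j
      have hd : dM (Dec M) 0 (t ⟨(0, n + 1), Nat.zero_add _⟩ j) = 0 := by
        rw [hs0]
        exact congrFun (congrFun hs ⟨(1, n + 1), by dsimp only; omega⟩) j
      rw [← incDec_colDec_of_cocycle hd]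
      exact (congrArg _ (congrFun hv j)).trans (map_zero _)
    rw [this]
    funext ⟨⟨p, q⟩, hpq⟩ j
    match p, hpq with
    | 0, hpq => rfl
    | p + 1, hpq => rfl
  have hs' : s = dS s' := sub_eq_zero.1 ht0
  have hf0 : dR L (Dec M) n f1 = 0 := by rw [← htf, ht0, map_zero]
  -- What remains of f is a cocycle, homotopic to its collapse g; evaluating g on the basis cycles
  -- gives the missing family of degree zero.
  set g := (colDec M).mapR L n f1 with hg
  have hg0 : dR L (const (M.obj 0)) n g = 0 := by
    rw [hg, (colDec M).dR_mapR, hf0, map_zero]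
  let t' : Fam (const (M.obj 0)) B.r n :=
    famZero (M := const (M.obj 0)) B.r (fun j => lc g (B.z n j))
  have hgt : g - cr B.c t' ∈ bR L (const (M.obj 0)) n := by
    have := sub_sum_mem B hg0
    convert this using 2
    rw [cr_famZero]
    funext y
    rw [Finset.sum_apply]
    rfl
  refine ⟨s' + (incDec M).mapS t', ?_, ?_⟩
  · rw [dS_add, (incDec M).dS_mapS, dS_famZero, ← hs']
    have : (incDec M).mapS (0 : Fam (const (M.obj 0)) B.r (n + 1)) = 0 := by
      funext x j
      exact map_zero _
    rw [this, add_zero]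
  · have e : f - cr B.c (s' + (incDec M).mapS t') =
        (f1 - (incDec M).mapR L n g) + (incDec M).mapR L n (g - cr B.c t') := by
      rw [map_add, map_sub, (incDec M).mapR_cr, hf1]
      abel
    rw [e]
    exact add_mem (sub_incDec_colDec_mem hf0) ((incDec M).mapR_mem hgt)

theorem mapS_toDec_injective {n : ℕ} {r : ℕ → ℕ} {s s' : Fam M r n}
    (h : (toDec M).mapS s = (toDec M).mapS s') : s = s' :=
  funext fun x => funext fun j => toDec_injective M _ (congrFun (congrFun h x) j)

theorem mapR_toDec_injective {n : ℕ} {f f' : R L M n}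
    (h : (toDec M).mapR L n f = (toDec M).mapR L n f') : f = f' :=
  funext fun y => toDec_injective M _ (congrFun h y)

theorem exists_mapS_toDec {n : ℕ} {r : ℕ → ℕ} {s : Fam (Dec M) r n}
    (h : (toCoker M).mapS s = 0) : ∃ s', (toDec M).mapS s' = s := by
  choose s' hs' using fun x j => exists_of_toCoker_eq_zero M (congrFun (congrFun h x) j)
  exact ⟨s', funext fun x => funext fun j => hs' x j⟩

theorem exists_mapR_toDec {n : ℕ} {f : R L (Dec M) n}
    (h : (toCoker M).mapR L n f = 0) : ∃ f', (toDec M).mapR L n f' = f := by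
  choose f' hf' using fun y => exists_of_toCoker_eq_zero M (congrFun h y)
  exact ⟨f', funext hf'⟩

theorem exists_mapS_toCoker {n : ℕ} {r : ℕ → ℕ} (s : Fam (Coker M) r n) :
    ∃ s', (toCoker M).mapS s' = s := by
  choose s' hs' using fun x j => toCoker_surjective M _ (s x j)
  exact ⟨s', funext fun x => funext fun j => hs' x j⟩

theorem exists_mapR_mem_toCoker {n : ℕ} {f : R L (Coker M) n} (hf : f ∈ bR L (Coker M) n) :
    ∃ f' ∈ bR L (Dec M) n, (toCoker M).mapR L n f' = f := by
  cases n with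
  | zero => exact ⟨0, zero_mem _, by rw [map_zero, (Submodule.mem_bot ℚ).1 hf]⟩
  | succ n =>
    obtain ⟨g, rfl⟩ := hf
    choose g' hg' using fun y => toCoker_surjective M _ (g y)
    refine ⟨_, ⟨g', rfl⟩, ?_⟩
    rw [← (toCoker M).dR_mapR]
    exact congrArg _ (funext hg')

/-- A diagram chase in the sequence M → `Dec M` → `Coker M`: exactness for the shift, together with
exactness for the cokernel one degree lower, gives exactness for M. Degree zero of the cokernel is
separate, as there are no coboundaries to correct by. -/
theorem ex_step {n : ℕ} (hQ : Ex B (Coker M) n) : Ex B M (n + 1) := by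
  intro s f hs hf
  have hz : (toDec M).mapS (0 : Fam M B.r (n + 2)) = 0 := by
    funext x j
    exact map_zero _
  have hqS : ∀ {n : ℕ} (s : Fam M B.r n), (toCoker M).mapS ((toDec M).mapS s) = 0 := fun s => by
    funext x j
    exact toCoker_toDec M _
  have hqR : ∀ {n : ℕ} (f : R L M n), (toCoker M).mapR L n ((toDec M).mapR L n f) = 0 := fun f => by
    funext y
    exact toCoker_toDec M _
  obtain ⟨s', hs', hf'⟩ := ex_Dec B M n ((toDec M).mapS s) ((toDec M).mapR L n f)
    (by rw [(toDec M).dS_mapS, hs, hz]) (by rw [← (toDec M).mapR_cr, hf, (toDec M).dR_mapR])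
  have hds' : dS ((toCoker M).mapS s') = 0 := by rw [(toCoker M).dS_mapS, ← hs', hqS]
  cases n with
  | zero =>
    have hf'' : (toDec M).mapR L 0 f = cr B.c s' := sub_eq_zero.1 ((Submodule.mem_bot ℚ).1 hf')
    have h0 := hQ ((toCoker M).mapS s') (by rw [← (toCoker M).mapR_cr, ← hf'', hqR])
    obtain ⟨s₂, rfl⟩ := exists_mapS_toDec h0
    refine ⟨s₂, mapS_toDec_injective ?_, (Submodule.mem_bot ℚ).2 (sub_eq_zero.2
      (mapR_toDec_injective ?_))⟩
    · rw [hs', (toDec M).dS_mapS]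
    · rw [hf'', (toDec M).mapR_cr]
  | succ m =>
    obtain ⟨f', hf'⟩ := hf'
    have hcr : cr B.c s' = (toDec M).mapR L (m + 1) f - dR L (Dec M) m f' := by
      rw [hf', sub_sub_cancel]
    -- In the cokernel s' is closed and its cross product is the coboundary of -f'. Lifting the
    -- solution found there corrects both s' and f' so that they come from M.
    obtain ⟨s'', h1, h2⟩ := hQ ((toCoker M).mapS s') (-(toCoker M).mapR L m f') hds' (by
      rw [← (toCoker M).mapR_cr, hcr, map_sub, hqR, map_neg, (toCoker M).dR_mapR, zero_sub])
    obtain ⟨s₁, rfl⟩ := exists_mapS_toCoker s''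
    obtain ⟨b, hb, hb'⟩ := exists_mapR_mem_toCoker h2
    obtain ⟨s₂, hs₂⟩ := exists_mapS_toDec (s := s' - dS s₁) (by
      have : (toCoker M).mapS (s' - dS s₁) = (toCoker M).mapS s' - (toCoker M).mapS (dS s₁) := by
        funext x j
        exact map_sub _ _ _
      rw [this, h1, (toCoker M).dS_mapS, sub_self])
    obtain ⟨f₂, hf₂⟩ := exists_mapR_toDec (f := f' + cr B.c s₁ + b) (by
      rw [map_add, map_add, hb', (toCoker M).mapR_cr]
      abel)
    refine ⟨s₂, mapS_toDec_injective ?_, f₂, mapR_toDec_injective ?_⟩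
    · rw [hs', ← (toDec M).dS_mapS, hs₂, dS_sub, dS_dS, sub_zero]
    · rw [← (toDec M).dR_mapR, hf₂, map_sub, (toDec M).mapR_cr, hs₂, map_sub, hcr, map_add, map_add,
        dR_of_mem hb, dR_cr B.hc]
      abel

/-- The coefficients are quantified inside the induction, since the step for M appeals to its
cokernel. -/
theorem ex (n : ℕ) : ∀ M : CoSimp.{u}, Ex B M n := by
  induction n with
  | zero => exact ex_zero B
  | succ n ih => exact fun M => ex_step B (ih _)

end fam

end Kunneth

namespace Kunneth

open SimplexCategory RatCohomology

/-! #### Duality between chains and cochains -/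

section duality

variable {L : SSet.{u}} {q : ℕ}

theorem linearCombination_coboundary (f : Cochain L q) (z : (semi L).Ch (q + 1)) :
    Finsupp.linearCombination ℚ (coboundary L q f) z =
      Finsupp.linearCombination ℚ f ((semi L).bd q z) := by
  suffices h : (Finsupp.linearCombination ℚ (coboundary L q f) : (semi L).Ch (q + 1) →ₗ[ℚ] ℚ) =
    (Finsupp.linearCombination ℚ f : (semi L).Ch q →ₗ[ℚ] ℚ) ∘ₗ (semi L).bd q from
    congrArg (fun F => F z) h
  refine Finsupp.lhom_ext' fun y => LinearMap.ext_ring ?_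
  simp only [LinearMap.comp_apply, Finsupp.lsingle_apply]
  rw [SemiSimp.bd_single, map_sum, Finsupp.linearCombination_single, one_smul]
  change ∑ i : Fin (q + 2), (-1 : ℚ) ^ (i : ℕ) * f (L.map (SimplexCategory.δ i).op y) = _
  refine Finset.sum_congr rfl fun i _ => ?_
  rw [map_smul]
  refine congrArg (fun a : ℚ => (-1 : ℚ) ^ (i : ℕ) * a) (Eq.symm ?_)
  exact (Finsupp.linearCombination_single ℚ (v := f) 1 _).trans (one_smul ℚ _)

theorem linearCombination_bd {f : Cochain L q} (hf : f ∈ cocycles L q) (z : (semi L).Ch (q + 1)) :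
    Finsupp.linearCombination ℚ f ((semi L).bd q z) = 0 := by
  rw [← linearCombination_coboundary, mem_cocycles.1 hf]
  simp

theorem linearCombination_of_mem_coboundaries {f : Cochain L q} (hf : f ∈ coboundaries L q)
    {z : (semi L).Ch q} (hz : z ∈ (semi L).cyc q) : Finsupp.linearCombination ℚ f z = 0 := by
  cases q with
  | zero =>
    rw [(Submodule.mem_bot ℚ).1 hf]
    simp
  | succ q =>
    obtain ⟨g, rfl⟩ := hf
    rw [linearCombination_coboundary, LinearMap.mem_ker.1 hz, map_zero]

theorem mem_coboundaries_of_cyc {f : Cochain L q}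
    (h : ∀ z ∈ (semi L).cyc q, Finsupp.linearCombination ℚ f z = 0) : f ∈ coboundaries L q := by
  cases q with
  | zero =>
    refine (Submodule.mem_bot ℚ).2 (funext fun y => ?_)
    have := h (Finsupp.single y 1) trivial
    rwa [Finsupp.linearCombination_single, one_smul] at this
  | succ q =>
    obtain ⟨k, hk⟩ := exists_comp_eq ((semi L).bd q)
      (Finsupp.linearCombination ℚ f : (semi L).Ch (q + 1) →ₗ[ℚ] ℚ) h
    refine ⟨fun y => k (Finsupp.single y 1), funext fun y => ?_⟩
    have : ∀ w : (semi L).Ch q, Finsupp.linearCombination ℚ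
        (fun y : (semi L).T q => k (Finsupp.single y 1)) w = k w := by
      intro w
      refine congrArg (fun F : (semi L).Ch q →ₗ[ℚ] ℚ => F w) ?_
      refine Finsupp.lhom_ext' fun y => LinearMap.ext_ring ?_
      simp only [LinearMap.comp_apply, Finsupp.lsingle_apply]
      rw [Finsupp.linearCombination_single, one_smul]
    have h1 := linearCombination_coboundary (fun y => k (Finsupp.single y 1)) (Finsupp.single y 1)
    rw [Finsupp.linearCombination_single, one_smul] at h1
    rw [h1]
    refine (this _).trans ((hk _).trans ?_)
    rw [Finsupp.linearCombination_single, one_smul]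

/-- A chain on which all cocycles vanish is a boundary. -/
theorem exists_eq_bd_of_forall_cocycles {z : (semi L).Ch q}
    (h : ∀ f ∈ cocycles L q, Finsupp.linearCombination ℚ f z = 0) : ∃ w, z = (semi L).bd q w := by
  by_contra hne
  have hz : z ∉ LinearMap.range ((semi L).bd q) := fun ⟨w, hw⟩ => hne ⟨w, hw.symm⟩
  obtain ⟨F, hF, hker⟩ := Submodule.exists_le_ker_of_notMem hz
  have e : Finsupp.linearCombination ℚ (fun y : (semi L).T q => F (Finsupp.single y 1)) = F := by
    refine Finsupp.lhom_ext' fun y => LinearMap.ext_ring ?_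
    simp only [LinearMap.comp_apply, Finsupp.lsingle_apply]
    rw [Finsupp.linearCombination_single, one_smul]
  refine hF ?_
  rw [← e]
  refine h _ (mem_cocycles.2 (funext fun y => ?_))
  have h1 := linearCombination_coboundary (fun y => F (Finsupp.single y 1)) (Finsupp.single y 1)
  rw [Finsupp.linearCombination_single, one_smul] at h1
  rw [h1]
  exact (congrArg (fun G => G ((semi L).bd q (Finsupp.single y 1))) e).trans
    (LinearMap.mem_ker.1 (hker ⟨_, rfl⟩))

/-- The class of a cocycle. -/
def cls (L : SSet.{u}) (q : ℕ) : cocycles L q →ₗ[ℚ] SCohomology L q := Submodule.mkQ _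

theorem cls_surjective (L : SSet.{u}) (q : ℕ) : Function.Surjective (cls L q) :=
  Submodule.mkQ_surjective _

theorem cls_eq_zero {f : cocycles L q} : cls L q f = 0 ↔ (f : Cochain L q) ∈ coboundaries L q :=
  Submodule.Quotient.mk_eq_zero _

/-- Cocycles lifting a basis of cohomology are dualised by evaluating them on cycles. Finite
dimension makes the evaluation onto, so dual cycles exist; a cycle on which all basis cocycles
vanish is a boundary. -/
theorem exists_basis_degree (L : SSet.{u}) (q : ℕ) [Module.Finite ℚ (SCohomology L q)] :
    ∃ (r : ℕ) (c : Fin r → Cochain L q) (z : Fin r → (semi L).Ch q), (∀ j, c j ∈ cocycles L q) ∧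
      (∀ j, z j ∈ (semi L).cyc q) ∧
      (∀ j k, Finsupp.linearCombination ℚ (c j) (z k) = if j = k then 1 else 0) ∧
      ∀ y ∈ (semi L).cyc q, ∃ w, y = ∑ j, Finsupp.linearCombination ℚ (c j) y • z j +
        (semi L).bd q w := by
  let b := Module.finBasis ℚ (SCohomology L q)
  choose c hc using fun j => cls_surjective L q (b j)
  let T : (semi L).cyc q →ₗ[ℚ] (Fin (Module.finrank ℚ (SCohomology L q)) → ℚ) :=
    LinearMap.pi fun j => (Finsupp.linearCombination ℚ (c j : Cochain L q)).domRestrict _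
  -- Otherwise some nonzero functional kills the image; its coefficients give a combination of the
  -- basis cocycles that vanishes on all cycles, hence a coboundary, against independence.
  have hT : Function.Surjective T := by
    rw [← LinearMap.range_eq_top]
    by_contra hne
    obtain ⟨φ, hφ, hle⟩ := Submodule.exists_le_ker_of_lt_top _ (lt_top_iff_ne_top.2 hne)
    have hφa : ∀ v, φ v = ∑ j, φ (Pi.single j 1) * v j := by
      intro v
      conv_lhs => rw [pi_eq_sum_univ' v]
      rw [map_sum]
      refine Finset.sum_congr rfl fun j _ => ?_
      rw [map_smul, smul_eq_mul, mul_comm]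
    have hmem : ((∑ j, φ (Pi.single j 1) • c j : cocycles L q) : Cochain L q) ∈
        coboundaries L q := by
      refine mem_coboundaries_of_cyc fun z hz => ?_
      have h0 : φ (T ⟨z, hz⟩) = 0 := hle ⟨_, rfl⟩
      rw [hφa] at h0
      rw [← h0]
      have : Finsupp.linearCombination ℚ ((∑ j, φ (Pi.single j 1) • c j : cocycles L q) : Cochain L q) z =
          ∑ j, φ (Pi.single j 1) * Finsupp.linearCombination ℚ (c j : Cochain L q) z := by
        simp only [Finsupp.linearCombination_apply, Finsupp.sum, Finset.mul_sum]
        rw [Finset.sum_comm]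
        refine Finset.sum_congr rfl fun y _ => ?_
        simp only [Submodule.coe_sum, Submodule.coe_smul, Finset.sum_apply, Pi.smul_apply,
          smul_eq_mul, Finset.mul_sum]
        exact Finset.sum_congr rfl fun j _ => by ring
      rw [this]
      rfl
    have h0 := cls_eq_zero.2 hmem
    rw [map_sum] at h0
    simp only [map_smul, hc] at h0
    have ha := Fintype.linearIndependent_iff.1 b.linearIndependent _ h0
    exact hφ (LinearMap.ext fun v => by rw [hφa]; simp [ha])
  choose z hz using fun k => hT (Pi.single k 1)
  refine ⟨_, fun j => c j, fun k => z k, fun j => (c j).2, fun k => (z k).2, fun j k => ?_,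
    fun y hy => ?_⟩
  · have := congrFun (hz k) j
    rw [Pi.single_apply] at this
    exact this
  · set y' := y - ∑ j, Finsupp.linearCombination ℚ (c j : Cochain L q) y • (z j : (semi L).Ch q)
      with hy'
    have hy'c : y' ∈ (semi L).cyc q :=
      sub_mem hy (sum_mem fun j _ => Submodule.smul_mem _ _ (z j).2)
    have hcy : ∀ j, Finsupp.linearCombination ℚ (c j : Cochain L q) y' = 0 := by
      intro j
      rw [hy', map_sub, map_sum, sub_eq_zero]
      have : ∀ k, Finsupp.linearCombination ℚ (c j : Cochain L q)
          (Finsupp.linearCombination ℚ (c k : Cochain L q) y • (z k : (semi L).Ch q)) =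
          if j = k then Finsupp.linearCombination ℚ (c k : Cochain L q) y else 0 := by
        intro k
        have h1 := congrFun (hz k) j
        rw [Pi.single_apply] at h1
        rw [map_smul, show Finsupp.linearCombination ℚ (c j : Cochain L q) (z k : (semi L).Ch q) = _
          from h1]
        simp
      rw [Finset.sum_congr rfl fun k _ => this k]
      simp
    -- Any cocycle is a combination of the basis plus a coboundary, and both vanish on the reduced
    -- cycle y'.
    obtain ⟨w, hw⟩ := exists_eq_bd_of_forall_cocycles (z := y') fun f hf => by
      have hsp := b.sum_repr (cls L q ⟨f, hf⟩)
      have h0 : cls L q (⟨f, hf⟩ - ∑ j, b.repr (cls L q ⟨f, hf⟩) j • c j) = 0 := by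
        rw [map_sub, map_sum]
        simp only [map_smul, hc]
        rw [hsp, sub_self]
      have h1 := linearCombination_of_mem_coboundaries (cls_eq_zero.1 h0) hy'c
      rw [← h1]
      simp only [Finsupp.linearCombination_apply, Finsupp.sum]
      have h2 : ∑ y ∈ y'.support, y' y • (∑ j, b.repr (cls L q ⟨f, hf⟩) j • (c j : Cochain L q)) y =
          0 := by
        simp only [Finset.sum_apply, Pi.smul_apply, smul_eq_mul, Finset.mul_sum]
        rw [Finset.sum_comm]
        refine Finset.sum_eq_zero fun j _ => ?_
        have h3 := hcy j
        simp only [Finsupp.linearCombination_apply, Finsupp.sum, smul_eq_mul] at h3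
        rw [← mul_zero (b.repr (cls L q ⟨f, hf⟩) j), ← h3, Finset.mul_sum]
        exact Finset.sum_congr rfl fun y _ => by ring
      rw [eq_comm, ← sub_eq_zero, ← neg_eq_zero, neg_sub, ← h2, ← Finset.sum_sub_distrib]
      refine Finset.sum_congr rfl fun y _ => ?_
      simp only [Submodule.coe_sub, Submodule.coe_sum, Submodule.coe_smul, Pi.sub_apply, smul_eq_mul,
        mul_sub]
      ring
    refine ⟨w, ?_⟩
    rw [← hw, hy']
    abel

theorem nonempty_hBasis (L : SSet.{u}) (h : ∀ q, Module.Finite ℚ (SCohomology L q)) :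
    Nonempty (HBasis L) := by
  choose r c z h1 h2 h3 h4 using fun q => exists_basis_degree L q
  exact ⟨⟨r, c, h1, z, h2, h3, h4⟩⟩

end duality

end Kunneth

namespace Kunneth

open SimplexCategory RatCohomology

section decomposition

variable {K L : SSet.{u}} (B : HBasis L)

/-- The basis of cohomology, as cocycles. -/
def HBasis.cc (q : ℕ) (j : Fin (B.r q)) : cocycles L q := ⟨B.c q j, B.hc q j⟩

theorem HBasis.exists_eq_sum (q : ℕ) (y : SCohomology L q) :
    ∃ a : Fin (B.r q) → ℚ, y = ∑ j, a j • cls L q (B.cc q j) := by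
  obtain ⟨f, rfl⟩ := cls_surjective L q y
  refine ⟨fun j => Finsupp.linearCombination ℚ (f : Cochain L q) (B.z q j), ?_⟩
  rw [← sub_eq_zero]
  simp only [← map_smul]
  rw [← map_sum, ← map_sub, cls_eq_zero]
  refine mem_coboundaries_of_cyc fun y hy => ?_
  obtain ⟨w, hw⟩ := B.span q y hy
  have h1 := congrArg (Finsupp.linearCombination ℚ (f : Cochain L q)) hw
  rw [map_add, map_sum, linearCombination_bd f.2, add_zero] at h1
  simp only [map_smul, smul_eq_mul] at h1
  have h2 : ∀ g : Cochain L q, Finsupp.linearCombination ℚ g y = ∑ σ ∈ y.support, y σ * g σ :=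
    fun g => rfl
  rw [h2] at h1
  rw [h2]
  simp only [h2] at h1
  simp only [Submodule.coe_sub, Submodule.coe_sum, Submodule.coe_smul, Pi.sub_apply,
    Finset.sum_apply, Pi.smul_apply, smul_eq_mul, mul_sub, Finset.sum_sub_distrib]
  rw [h1, sub_eq_zero]
  simp only [Finset.mul_sum, Finset.sum_mul]
  rw [Finset.sum_comm]
  refine Finset.sum_congr rfl fun σ _ => Finset.sum_congr rfl fun j _ => ?_
  simp only [HBasis.cc]
  ring

theorem HBasis.exists_eq_sum_tmul (a q : ℕ) (t : SCohomology K a ⊗[ℚ] SCohomology L q) :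
    ∃ x : Fin (B.r q) → cocycles K a, t = ∑ j, cls K a (x j) ⊗ₜ[ℚ] cls L q (B.cc q j) := by
  induction t using TensorProduct.induction_on with
  | zero => exact ⟨0, by simp⟩
  | tmul k l =>
    obtain ⟨k, rfl⟩ := cls_surjective K a k
    obtain ⟨v, rfl⟩ := B.exists_eq_sum q l
    refine ⟨fun j => v j • k, ?_⟩
    rw [TensorProduct.tmul_sum]
    refine Finset.sum_congr rfl fun j _ => ?_
    rw [map_smul, TensorProduct.smul_tmul]
  | add t t' h h' =>
    obtain ⟨x, rfl⟩ := h
    obtain ⟨x', rfl⟩ := h'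
    refine ⟨x + x', ?_⟩
    simp only [Pi.add_apply, map_add, TensorProduct.add_tmul, Finset.sum_add_distrib]

end decomposition

/-! ### The Künneth isomorphism in degree two for simplicial sets -/

section product

variable {W K L : SSet.{u}}

/-- The cosimplicial vector space of cochains. -/
@[reducible] def coch (K : SSet.{u}) : CoSimp.{u} where
  obj n := Cochain K n
  map f :=
    { toFun := fun g σ => g (K.map f.op σ)
      map_add' := fun _ _ => rfl
      map_smul' := fun _ _ => rfl }
  map_id n g := by
    funext σ
    simp
  map_map f g x := by
    funext σ
    exact congrArg x (RatCohomology.map_map f g σ)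

theorem dM_coch {n : ℕ} (g : Cochain K n) : dM (coch K) n g = coboundary K n g := by
  funext σ
  rw [dM_apply, Finset.sum_apply]
  rfl

variable (p : W ⟶ K) (q : W ⟶ L)

/-- Cochains on the product as functions of two variables. -/
def toProd (n : ℕ) : R L (coch K) n →ₗ[ℚ] Cochain W n where
  toFun f w := f (q.app _ w) (p.app _ w)
  map_add' _ _ := rfl
  map_smul' _ _ := rfl

theorem coboundary_toProd {n : ℕ} (f : R L (coch K) n) :
    coboundary W n (toProd p q n f) = toProd p q (n + 1) (dR L (coch K) n f) := by
  funext w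
  change ∑ i : Fin (n + 2), (-1 : ℚ) ^ (i : ℕ) * f (q.app _ (W.map (SimplexCategory.δ i).op w))
    (p.app _ (W.map (SimplexCategory.δ i).op w)) = dR L (coch K) n f (q.app _ w) (p.app _ w)
  rw [dR_apply, Finset.sum_apply]
  refine Finset.sum_congr rfl fun i _ => ?_
  rw [NatTrans.naturality_apply, NatTrans.naturality_apply]
  rfl

/-- The front face acts on the factor K and the back face on L, so this abstract cross term is the
cup product of pulled back cochains. -/
theorem toProd_crossTerm {a b n : ℕ} (h : a + b = n) (c : Cochain L b) (x : Cochain K a) :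
    toProd p q n (crossTerm (M := coch K) c h x) =
      cochainCup W h (cochainMap p a x) (cochainMap q b c) := by
  funext w
  change c (L.map (back h).op (q.app _ w)) * x (K.map (front h).op (p.app _ w)) =
    x (p.app _ (W.map (front h).op w)) * c (q.app _ (W.map (back h).op w))
  rw [NatTrans.naturality_apply, NatTrans.naturality_apply, mul_comm]

variable {p q}

variable (hW : ∀ n, Function.Bijective fun w : W.obj (op (SimplexCategory.mk n)) =>
  (p.app (op (SimplexCategory.mk n)) w, q.app (op (SimplexCategory.mk n)) w))

include hW

theorem toProd_injective (n : ℕ) : Function.Injective (toProd p q n) := by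
  intro f g h
  funext y x
  obtain ⟨w, hw⟩ := (hW n).2 (x, y)
  obtain ⟨rfl, rfl⟩ := Prod.mk.inj hw
  exact congrFun h w

theorem toProd_surjective (n : ℕ) : Function.Surjective (toProd p q n) := by
  intro g
  choose w hw using fun x => (hW n).2 x
  refine ⟨fun y x => g (w (x, y)), funext fun σ => congrArg g ((hW n).1 ?_)⟩
  exact hw _

theorem toProd_mem_iff {n : ℕ} {f : R L (coch K) n} :
    toProd p q n f ∈ coboundaries W n ↔ f ∈ bR L (coch K) n := by
  cases n with
  | zero =>
    refine (Submodule.mem_bot ℚ).trans (Iff.trans ?_ (Submodule.mem_bot ℚ).symm)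
    rw [map_eq_zero_iff _ (toProd_injective hW 0)]
  | succ n =>
    constructor
    · rintro ⟨g, hg⟩
      obtain ⟨g, rfl⟩ := toProd_surjective hW n g
      rw [coboundary_toProd] at hg
      exact ⟨g, toProd_injective hW _ hg⟩
    · rintro ⟨g, rfl⟩
      exact ⟨toProd p q n g, coboundary_toProd p q g⟩

omit hW

variable (p q) in
/-- The cross product in cohomology. -/
def sCross {a b n : ℕ} (h : a + b = n) : SCohomology K a ⊗[ℚ] SCohomology L b →ₗ[ℚ] SCohomology W n :=
  TensorProduct.lift ((sCup W h).compl₁₂ (sPullback p a) (sPullback q b))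

variable (p q) in
/-- The cross product of cocycles. -/
def crossCocycle {a b n : ℕ} (h : a + b = n) (x : cocycles K a) (y : cocycles L b) : cocycles W n :=
  ⟨cochainCup W h (cochainMap p a x) (cochainMap q b y), cochainCup_mem_cocycles W h
    (cochainMap_mem_cocycles p x.2) (cochainMap_mem_cocycles q y.2)⟩

theorem sCross_cls {a b n : ℕ} (h : a + b = n) (x : cocycles K a) (y : cocycles L b) :
    sCross p q h (cls K a x ⊗ₜ[ℚ] cls L b y) = cls W n (crossCocycle p q h x y) := rfl

variable (p q) in
/-- The sum of the cross products in degree two. -/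
def kunnethTwo : ((SCohomology K 2 ⊗[ℚ] SCohomology L 0) × (SCohomology K 0 ⊗[ℚ] SCohomology L 2)) ×
    (SCohomology K 1 ⊗[ℚ] SCohomology L 1) →ₗ[ℚ] SCohomology W 2 :=
  ((sCross p q (a := 2) (b := 0) rfl).coprod (sCross p q (a := 0) (b := 2) rfl)).coprod
    (sCross p q (a := 1) (b := 1) rfl)

theorem kunnethTwo_apply (B : HBasis L) (x : Fin (B.r 0) → cocycles K 2)
    (y : Fin (B.r 2) → cocycles K 0) (z : Fin (B.r 1) → cocycles K 1) :
    kunnethTwo p q ((∑ j, cls K 2 (x j) ⊗ₜ[ℚ] cls L 0 (B.cc 0 j),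
      ∑ j, cls K 0 (y j) ⊗ₜ[ℚ] cls L 2 (B.cc 2 j)), ∑ j, cls K 1 (z j) ⊗ₜ[ℚ] cls L 1 (B.cc 1 j)) =
    cls W 2 (∑ j, crossCocycle p q rfl (x j) (B.cc 0 j) +
      ∑ j, crossCocycle p q rfl (y j) (B.cc 2 j) + ∑ j, crossCocycle p q rfl (z j) (B.cc 1 j)) := by
  simp only [kunnethTwo, LinearMap.coprod_apply, map_sum, map_add, sCross_cls]

theorem toProd_cr (B : HBasis L) (s : Fam (coch K) B.r 2) :
    toProd p q 2 (cr B.c s) =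
      ∑ j, cochainCup W rfl (cochainMap p 2 (s ⟨(2, 0), rfl⟩ j)) (cochainMap q 0 (B.c 0 j)) +
      ∑ j, cochainCup W rfl (cochainMap p 0 (s ⟨(0, 2), rfl⟩ j)) (cochainMap q 2 (B.c 2 j)) +
      ∑ j, cochainCup W rfl (cochainMap p 1 (s ⟨(1, 1), rfl⟩ j)) (cochainMap q 1 (B.c 1 j)) := by
  have e : cr B.c s = ∑ j, crossTerm (M := coch K) (B.c 0 j) rfl (s ⟨(2, 0), rfl⟩ j) +
      ∑ j, crossTerm (M := coch K) (B.c 2 j) rfl (s ⟨(0, 2), rfl⟩ j) +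
      ∑ j, crossTerm (M := coch K) (B.c 1 j) rfl (s ⟨(1, 1), rfl⟩ j) := by
    rw [cr_apply, Fin.sum_univ_three]
    change ∑ j, crossTerm (M := coch K) (B.c 2 j) rfl (s ⟨(0, 2), rfl⟩ j) +
      ∑ j, crossTerm (M := coch K) (B.c 1 j) rfl (s ⟨(1, 1), rfl⟩ j) +
      ∑ j, crossTerm (M := coch K) (B.c 0 j) rfl (s ⟨(2, 0), rfl⟩ j) = _
    abel
  rw [e, map_add, map_add, map_sum, map_sum, map_sum]
  exact congrArg₂ (· + ·) (congrArg₂ (· + ·)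
    (Finset.sum_congr rfl fun j _ => toProd_crossTerm p q _ _ _)
    (Finset.sum_congr rfl fun j _ => toProd_crossTerm p q _ _ _))
    (Finset.sum_congr rfl fun j _ => toProd_crossTerm p q _ _ _)

-- Exactness in degree three with the zero family: a cocycle is a sum of cross products with closed
-- coefficients, up to a coboundary.
include hW in
theorem kunnethTwo_surjective (B : HBasis L) : Function.Surjective (kunnethTwo p q) := by
  intro f
  obtain ⟨⟨f, hf⟩, rfl⟩ := cls_surjective W 2 f
  obtain ⟨f, rfl⟩ := toProd_surjective hW 2 f
  have hf0 : dR L (coch K) 2 f = 0 := by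
    rw [mem_cocycles, coboundary_toProd, map_eq_zero_iff _ (toProd_injective hW 3)] at hf
    exact hf
  have hz : dS (0 : Fam (coch K) B.r 3) = 0 := by
    have := dS_sub (0 : Fam (coch K) B.r 3) 0
    rwa [sub_self, sub_self] at this
  obtain ⟨s, hs, hfs⟩ := ex B 3 (coch K) 0 f hz (by rw [map_zero, hf0])
  have hc : ∀ (a b : ℕ) (h : a + b = 2) (j : Fin (B.r b)), s ⟨(a, b), h⟩ j ∈ cocycles K a := by
    intro a b h j
    have := congrFun (congrFun hs.symm ⟨(a + 1, b), by dsimp only; omega⟩) j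
    rw [mem_cocycles, ← dM_coch]
    exact this
  refine ⟨_, (kunnethTwo_apply B (fun j => ⟨s ⟨(2, 0), rfl⟩ j, hc _ _ _ _⟩)
    (fun j => ⟨s ⟨(0, 2), rfl⟩ j, hc _ _ _ _⟩) (fun j => ⟨s ⟨(1, 1), rfl⟩ j, hc _ _ _ _⟩)).trans ?_⟩
  rw [eq_comm, ← sub_eq_zero, ← map_sub, cls_eq_zero]
  have := (toProd_mem_iff hW).2 hfs
  rw [map_sub, toProd_cr] at this
  convert this using 1
  simp only [Submodule.coe_sub, Submodule.coe_add, Submodule.coe_sum]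
  rfl

-- Exactness in degree two: a closed family whose cross product is a coboundary is the differential
-- of a family, so all its classes vanish.
include hW in
theorem kunnethTwo_injective (B : HBasis L) : Function.Injective (kunnethTwo p q) := by
  rw [injective_iff_map_eq_zero]
  rintro ⟨⟨t1, t2⟩, t3⟩ ht
  obtain ⟨x, rfl⟩ := B.exists_eq_sum_tmul 2 0 t1
  obtain ⟨y, rfl⟩ := B.exists_eq_sum_tmul 0 2 t2
  obtain ⟨z, rfl⟩ := B.exists_eq_sum_tmul 1 1 t3
  rw [kunnethTwo_apply, cls_eq_zero] at ht
  -- The total degree is two, so the default case never occurs.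
  let s : Fam (coch K) B.r 2 := fun t j => match t, j with
    | ⟨(2, 0), _⟩, j => (x j : Cochain K 2)
    | ⟨(0, 2), _⟩, j => (y j : Cochain K 0)
    | ⟨(1, 1), _⟩, j => (z j : Cochain K 1)
    | _, _ => 0
  have hmem : cr B.c s ∈ bR L (coch K) 2 := by
    rw [← toProd_mem_iff hW, toProd_cr]
    convert ht using 1
    simp only [Submodule.coe_add, Submodule.coe_sum]
    rfl
  obtain ⟨f, hf⟩ := hmem
  have hs : dS s = 0 := by
    funext ⟨⟨a, b⟩, h⟩ j
    have h' : a = 0 ∨ (a = 1 ∧ b = 2) ∨ (a = 2 ∧ b = 1) ∨ (a = 3 ∧ b = 0) := by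
      have : a + b = 3 := h
      omega
    rcases h' with rfl | ⟨rfl, rfl⟩ | ⟨rfl, rfl⟩ | ⟨rfl, rfl⟩
    · rfl
    · exact (dM_coch _).trans (mem_cocycles.1 (y j).2)
    · exact (dM_coch _).trans (mem_cocycles.1 (z j).2)
    · exact (dM_coch _).trans (mem_cocycles.1 (x j).2)
  obtain ⟨s', hs', -⟩ := ex B 2 (coch K) s f hs hf.symm
  have hx : ∀ j, cls K 2 (x j) = 0 := fun j => by
    rw [cls_eq_zero]
    refine ⟨s' ⟨(1, 0), rfl⟩ j, ?_⟩
    rw [← dM_coch]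
    exact (congrFun (congrFun hs' ⟨(2, 0), rfl⟩) j).symm
  have hz : ∀ j, cls K 1 (z j) = 0 := fun j => by
    rw [cls_eq_zero]
    refine ⟨s' ⟨(0, 1), rfl⟩ j, ?_⟩
    rw [← dM_coch]
    exact (congrFun (congrFun hs' ⟨(1, 1), rfl⟩) j).symm
  -- The differential of a family has no component of degree zero, so these cochains vanish
  -- themselves.
  have hy : ∀ j, cls K 0 (y j) = 0 := fun j => by
    rw [cls_eq_zero]
    exact (Submodule.mem_bot ℚ).2 (congrFun (congrFun hs' ⟨(0, 2), rfl⟩) j)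
  simp only [hx, hy, hz, TensorProduct.zero_tmul, Finset.sum_const_zero]
  rfl

end product

end Kunneth

/-! ### The cohomology of a compact Riemann surface -/

namespace Sing

open SemiSimp RatCohomology Kunneth

/-! ### Comparison of the two models of singular chains -/

section comparison

variable {X Y : Type u} [TopologicalSpace X] [TopologicalSpace Y]

/-- Simplices of the singular simplicial set are continuous maps. -/
noncomputable def simpEquiv (X : Type u) [TopologicalSpace X] (n : ℕ) :
    (singularSet X).obj (op (SimplexCategory.mk n)) ≃ C(Simp n, X) :=
  TopCat.toSSetObjEquiv (TopCat.of X) (op (SimplexCategory.mk n))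

theorem simpEquiv_face {n : ℕ} (i : Fin (n + 2))
    (σ : (singularSet X).obj (op (SimplexCategory.mk (n + 1)))) :
    simpEquiv X n ((singularSet X).map (SimplexCategory.δ i).op σ) =
      (simpEquiv X (n + 1) σ).comp (Simp.face i) := rfl

theorem simpEquiv_map (f : C(X, Y)) {n : ℕ}
    (σ : (singularSet X).obj (op (SimplexCategory.mk n))) :
    simpEquiv Y n ((TopCat.toSSet.map (TopCat.ofHom f)).app (op (SimplexCategory.mk n)) σ) =
      f.comp (simpEquiv X n σ) := rfl

/-- The comparison of chains. -/
noncomputable def ofSing (X : Type u) [TopologicalSpace X] :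
    SemiSimp.Hom (sing X) (semi (singularSet X)) where
  app n σ := (simpEquiv X n).symm σ
  comm i σ := (simpEquiv X _).injective (by
    rw [simpEquiv_face, Equiv.apply_symm_apply, Equiv.apply_symm_apply])

/-- The comparison of chains. -/
noncomputable def toSing (X : Type u) [TopologicalSpace X] :
    SemiSimp.Hom (semi (singularSet X)) (sing X) where
  app n σ := simpEquiv X n σ
  comm i σ := (simpEquiv_face i σ).symm

theorem ofSing_toSing {n : ℕ} (z : (semi (singularSet X)).Ch n) :
    (ofSing X).chain n ((toSing X).chain n z) = z := by
  suffices h : (ofSing X).chain n ∘ₗ (toSing X).chain n = LinearMap.id from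
    congrArg (fun F => F z) h
  refine Finsupp.lhom_ext' fun σ => LinearMap.ext_ring ?_
  simp only [LinearMap.comp_apply, Finsupp.lsingle_apply, LinearMap.id_apply]
  rw [Hom.chain_single, Hom.chain_single]
  exact congrArg (fun τ => Finsupp.single τ (1 : ℚ)) ((simpEquiv X n).symm_apply_apply σ)

theorem toSing_ofSing {n : ℕ} (z : (sing X).Ch n) :
    (toSing X).chain n ((ofSing X).chain n z) = z := by
  suffices h : (toSing X).chain n ∘ₗ (ofSing X).chain n = LinearMap.id from
    congrArg (fun F => F z) h
  refine Finsupp.lhom_ext' fun σ => LinearMap.ext_ring ?_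
  simp only [LinearMap.comp_apply, Finsupp.lsingle_apply, LinearMap.id_apply]
  rw [Hom.chain_single, Hom.chain_single]
  exact congrArg (fun τ => Finsupp.single τ (1 : ℚ)) ((simpEquiv X n).apply_symm_apply σ)

theorem bd_toSing_of_mem_cyc {n : ℕ} {z : (semi (singularSet X)).Ch (n + 1)}
    (hz : z ∈ (semi (singularSet X)).cyc (n + 1)) : (sing X).bd n ((toSing X).chain (n + 1) z) = 0 := by
  rw [Hom.bd_chain, LinearMap.mem_ker.1 hz, map_zero]

theorem linearCombination_cochainMap (φ : C(X, Y)) {n : ℕ} (f : Cochain (singularSet Y) n)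
    (z : (sing X).Ch n) :
    Finsupp.linearCombination ℚ (cochainMap (TopCat.toSSet.map (TopCat.ofHom φ)) n f)
      ((ofSing X).chain n z) =
    Finsupp.linearCombination ℚ f ((ofSing Y).chain n (push φ n z)) := by
  refine eq_of_mem_supported (F := (Finsupp.linearCombination ℚ
    (cochainMap (TopCat.toSSet.map (TopCat.ofHom φ)) n f)) ∘ₗ (ofSing X).chain n)
    (G := Finsupp.linearCombination ℚ f ∘ₗ (ofSing Y).chain n ∘ₗ push φ n)
    (fun σ _ => ?_) (mem_supp_univ z)
  have hσ : Continuous (φ ∘ σ) := φ.continuous.comp σ.continuous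
  rw [LinearMap.comp_apply, LinearMap.comp_apply, LinearMap.comp_apply, push_single hσ,
    Hom.chain_single, Hom.chain_single]
  refine (Finsupp.linearCombination_single ℚ (1 : ℚ) _).trans (Eq.trans ?_
    (Finsupp.linearCombination_single ℚ (1 : ℚ) _).symm)
  refine congrArg (fun a : ℚ => (1 : ℚ) • a) (congrArg f ((simpEquiv Y n).injective ?_))
  rw [simpEquiv_map]
  refine Eq.trans ?_ ((simpEquiv Y n).apply_symm_apply _).symm
  exact congrArg φ.comp ((simpEquiv X n).apply_symm_apply σ)

theorem linearCombination_sub_smul {L : SSet.{u}} {n : ℕ} (f g : Cochain L n) (a : ℚ)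
    (z : (semi L).Ch n) : Finsupp.linearCombination ℚ (f - a • g) z =
      Finsupp.linearCombination ℚ f z - a * Finsupp.linearCombination ℚ g z := by
  simp only [Finsupp.linearCombination_apply, Finsupp.sum, Finset.mul_sum,
    ← Finset.sum_sub_distrib]
  refine Finset.sum_congr rfl fun σ _ => ?_
  simp only [Pi.sub_apply, Pi.smul_apply, smul_eq_mul]
  ring

theorem pullback_cls (φ : C(X, Y)) {n : ℕ} (f : cocycles (singularSet Y) n) :
    pullback n φ (cls _ n f) = cls _ n ⟨cochainMap (TopCat.toSSet.map (TopCat.ofHom φ)) n f,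
      cochainMap_mem_cocycles _ f.2⟩ := rfl

end comparison

/-! #### Degree zero -/

section degreeZero

variable {X : Type u} [TopologicalSpace X] [PathConnectedSpace X]

theorem apply_eq_of_cocycle {f : Cochain (singularSet X) 0} (hf : f ∈ cocycles (singularSet X) 0)
    (σ τ : (singularSet X).obj (op (SimplexCategory.mk 0))) : f σ = f τ := by
  obtain ⟨σ, rfl⟩ := (simpEquiv X 0).symm.surjective σ
  obtain ⟨τ, rfl⟩ := (simpEquiv X 0).symm.surjective τ
  let γ : Path (σ (vert 0 0)) (τ (vert 0 0)) := PathConnectedSpace.somePath _ _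
  -- The path is parametrised by the second barycentric coordinate, so the face opposite vertex 0 is
  -- its end point τ and the other one its start σ.
  let ρ : C(Simp 1, X) := ⟨fun t => γ ⟨t.1 1, t.2.1 1, by
      rw [← t.2.2]
      exact Finset.single_le_sum (fun i _ => t.2.1 i) (Finset.mem_univ _)⟩, by
    refine γ.continuous.comp (Continuous.subtype_mk ?_ _)
    exact (continuous_apply (1 : Fin 2)).comp continuous_subtype_val⟩
  have h := congrFun (mem_cocycles.1 hf) ((simpEquiv X 1).symm ρ)
  change ∑ i : Fin 2, (-1 : ℚ) ^ (i : ℕ) * f ((singularSet X).map (SimplexCategory.δ i).op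
    ((simpEquiv X 1).symm ρ)) = 0 at h
  have hv : ∀ t : Simp 0, t = vert 0 0 := fun t => Subsingleton.elim _ _
  have e : ∀ (i : Fin 2) (κ : C(Simp 0, X)), ρ (vert 1 (i.succAbove 0)) = κ (vert 0 0) →
      (singularSet X).map (SimplexCategory.δ i).op ((simpEquiv X 1).symm ρ) =
        (simpEquiv X 0).symm κ := by
    intro i κ hκ
    refine (simpEquiv X 0).injective ?_
    rw [simpEquiv_face, Equiv.apply_symm_apply, Equiv.apply_symm_apply]
    ext t
    rw [hv t, ← hκ, ContinuousMap.comp_apply]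
    exact congrArg ρ (Simp.face_vertex i 0)
  rw [Fin.sum_univ_two, e 0 τ ?_, e 1 σ ?_] at h
  · simp only [Fin.val_zero, Fin.val_one, pow_zero, pow_one, one_mul, neg_mul] at h
    linarith
  · refine (congrArg γ (Subtype.ext ?_)).trans γ.source
    simp [vert]
  · refine (congrArg γ (Subtype.ext ?_)).trans γ.target
    simp [vert]

omit [PathConnectedSpace X] in
theorem const_mem_cocycles (a : ℚ) : (fun _ => a : Cochain (singularSet X) 0) ∈
    cocycles (singularSet X) 0 := by
  rw [mem_cocycles]
  funext σ
  change ∑ i : Fin 2, (-1 : ℚ) ^ (i : ℕ) * a = 0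
  simp [Fin.sum_univ_two]

variable (X) in
theorem finrank_zero : Module.finrank ℚ (H 0 X) = 1 := by
  obtain ⟨x₀⟩ : Nonempty X := inferInstance
  let σ₀ := (simpEquiv X 0).symm (ContinuousMap.const _ x₀)
  refine finrank_eq_one_iff'.2 ⟨cls _ 0 ⟨_, const_mem_cocycles 1⟩, ?_, fun w => ?_⟩
  · rw [Ne, cls_eq_zero]
    intro h
    exact one_ne_zero (congrFun ((Submodule.mem_bot ℚ).1 h) σ₀)
  · obtain ⟨f, rfl⟩ := cls_surjective _ 0 w
    refine ⟨f.1 σ₀, ?_⟩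
    rw [← map_smul]
    refine congrArg _ (Subtype.ext (funext fun σ => ?_))
    rw [apply_eq_of_cocycle f.2 σ σ₀]
    exact mul_one _

theorem pullback_zero (φ : C(X, X)) : pullback 0 φ = LinearMap.id := by
  refine LinearMap.ext fun w => ?_
  obtain ⟨f, rfl⟩ := cls_surjective _ 0 w
  rw [pullback_cls]
  exact congrArg _ (Subtype.ext (funext fun σ => apply_eq_of_cocycle f.2 _ _))

end degreeZero

/-! #### Degree at least two -/

section surface

variable (M : Type u) [TopologicalSpace M] [ChartedSpace ℂ M] [T2Space M] [IsManifold 𝓘(ℂ) ω M]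
  [CompactSpace M]

/-- Along the whole surface the relative vanishing says that every cycle bounds, and a cocycle
vanishing on all cycles is a coboundary. -/
theorem subsingleton_of_three_le (n : ℕ) : Subsingleton (H (n + 3) M) := by
  refine subsingleton_of_forall_eq 0 fun w => ?_
  obtain ⟨f, rfl⟩ := cls_surjective _ _ w
  rw [cls_eq_zero]
  refine mem_coboundaries_of_cyc fun z hz => ?_
  obtain ⟨w, t, ht, e⟩ := (good_univ M).vanish n ((toSing M).chain (n + 3) z) (by
    rw [bd_toSing_of_mem_cyc hz]
    exact zero_mem _)
  rw [Set.compl_univ] at ht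
  rw [eq_zero_of_mem_supp_empty ht, add_zero] at e
  rw [← ofSing_toSing z, e, ← Hom.bd_chain, linearCombination_bd f.2]

variable [PreconnectedSpace M] [Nonempty M]

/-- The degree r of a cycle is constant and rational; subtracting r times the fundamental cycle
leaves a cycle of degree zero, which bounds. -/
theorem exists_eq_smul_add_bd {Z : (sing M).Ch 2} (hZ : (sing M).bd 1 Z = 0)
    (hd : ∀ x, HasDeg M x Z 1) {z : (semi (singularSet M)).Ch 2}
    (hz : z ∈ (semi (singularSet M)).cyc 2) : ∃ (r : ℚ) (w : (semi (singularSet M)).Ch 3),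
      z = r • (ofSing M).chain 2 Z + (semi (singularSet M)).bd 2 w := by
  have hb := bd_toSing_of_mem_cyc hz
  obtain ⟨r, hr⟩ := exists_rat_hasDeg_of_cycle hb
  obtain ⟨w, hw⟩ := exists_eq_bd_of_hasDeg_zero (z := (toSing M).chain 2 z - r • Z)
    (by rw [map_sub, map_smul, hb, hZ, smul_zero, sub_zero])
    (fun x => by simpa using (hr x).sub ((hd x).smul r))
  refine ⟨r, (ofSing M).chain 3 w, ?_⟩
  rw [Hom.bd_chain, ← hw, map_sub, map_smul, ofSing_toSing, add_sub_cancel]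

/-- The fundamental cycle has degree one, so it is not a boundary and some cocycle is nonzero on it.
Every cocycle is determined, up to coboundaries, by its value on it. -/
theorem finrank_two : Module.finrank ℚ (H 2 M) = 1 := by
  obtain ⟨Z, hZ, hd⟩ := exists_fundamental_class M
  have hZc : (ofSing M).chain 2 Z ∈ (semi (singularSet M)).cyc 2 := by
    refine LinearMap.mem_ker.2 ?_
    rw [Hom.bd_chain, hZ, map_zero]
  obtain ⟨f, hf, hfZ⟩ : ∃ f ∈ cocycles (singularSet M) 2,
      Finsupp.linearCombination ℚ f ((ofSing M).chain 2 Z) ≠ 0 := by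
    by_contra! h
    obtain ⟨w, hw⟩ := exists_eq_bd_of_forall_cocycles h
    have e : Z = (sing M).bd 2 ((toSing M).chain 3 w) + 0 := by
      rw [Hom.bd_chain, ← hw, toSing_ofSing, add_zero]
    obtain ⟨x⟩ := ‹Nonempty M›
    have h0 : HasDeg M x Z 0 := by
      rw [e]
      exact hasDeg_of_eq (zero_mem _)
    exact one_ne_zero ((hd x).unique h0)
  refine finrank_eq_one_iff'.2 ⟨cls _ 2 ⟨f, hf⟩, ?_, fun w => ?_⟩
  · rw [Ne, cls_eq_zero]
    exact fun h => hfZ (linearCombination_of_mem_coboundaries h hZc)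
  · obtain ⟨g, rfl⟩ := cls_surjective _ 2 w
    set a := Finsupp.linearCombination ℚ (g : Cochain (singularSet M) 2) ((ofSing M).chain 2 Z) /
      Finsupp.linearCombination ℚ f ((ofSing M).chain 2 Z) with ha
    refine ⟨a, ?_⟩
    rw [← map_smul, eq_comm, ← sub_eq_zero, ← map_sub, cls_eq_zero]
    refine mem_coboundaries_of_cyc fun z hz => ?_
    obtain ⟨r, w, e⟩ := exists_eq_smul_add_bd M hZ hd hz
    refine (linearCombination_sub_smul (g : Cochain (singularSet M) 2) f a z).trans ?_
    rw [e, map_add, map_add, linearCombination_bd hf, linearCombination_bd g.2, map_smul, map_smul,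
      add_zero, add_zero, smul_eq_mul, smul_eq_mul, ha]
    field_simp
    ring

/-- Holomorphic automorphisms act trivially on the second cohomology. -/
theorem pullback_two (g g' : C(M, M)) (hg : ContMDiff 𝓘(ℂ) 𝓘(ℂ) ω g)
    (hg' : ContMDiff 𝓘(ℂ) 𝓘(ℂ) ω g') (h1 : ∀ y, g' (g y) = y) (h2 : ∀ y, g (g' y) = y) :
    pullback 2 g = LinearMap.id := by
  obtain ⟨Z, hZ, hd⟩ := exists_fundamental_class M
  have hgc : ContinuousOn g Set.univ := g.continuous.continuousOn
  -- The translated fundamental cycle still has degree one everywhere, so it is homologous to the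
  -- original one.
  obtain ⟨v, hv⟩ := exists_eq_bd_of_hasDeg_zero (z := push g 2 Z - Z)
    (by rw [map_sub, bd_push hgc (mem_supp_univ Z), hZ, map_zero, sub_zero])
    (fun x => by
      have := (hd (g' x)).push hg hg' h1 h2
      rw [h2] at this
      simpa using this.sub (hd x))
  refine LinearMap.ext fun w => ?_
  obtain ⟨f, rfl⟩ := cls_surjective _ 2 w
  rw [pullback_cls, LinearMap.id_apply, ← sub_eq_zero, ← map_sub, cls_eq_zero]
  refine mem_coboundaries_of_cyc fun z hz => ?_
  obtain ⟨r, w, e⟩ := exists_eq_smul_add_bd M hZ hd hz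
  have hl := linearCombination_sub_smul (cochainMap (TopCat.toSSet.map (TopCat.ofHom g)) 2
    (f : Cochain (singularSet M) 2)) f 1 z
  rw [one_smul, one_mul] at hl
  refine hl.trans ?_
  rw [e, map_add, map_add, linearCombination_bd f.2, linearCombination_bd
    (cochainMap_mem_cocycles _ f.2), map_smul, map_smul, add_zero, add_zero,
    linearCombination_cochainMap, ← smul_sub, ← map_sub, ← map_sub, hv, ← Hom.bd_chain,
    linearCombination_bd f.2, smul_zero]

/-- A space of positive `finrank` is finite-dimensional, the default rank of infinite-dimensional
spaces being zero. Positive genus thus supplies the finiteness of the first cohomology. -/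
theorem nonempty_hBasis_of_genus [PathConnectedSpace M] (hg : 0 < Module.finrank ℚ (H 1 M)) :
    Nonempty (HBasis (singularSet M)) := by
  refine nonempty_hBasis _ fun q => ?_
  match q with
  | 0 => exact Module.finite_of_finrank_pos (by rw [finrank_zero M]; exact one_pos)
  | 1 => exact Module.finite_of_finrank_pos hg
  | 2 => exact Module.finite_of_finrank_pos (by rw [finrank_two M]; exact one_pos)
  | n + 3 =>
    have := subsingleton_of_three_le M n
    infer_instance

end surface

end Sing

/-! ### The cohomology of a quotient by a finite group acting freely -/

namespace Transfer

open RatCohomology Kunneth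

/-! ### Transfer for a finite group acting on a simplicial set -/

section simplicial

variable {K L : SSet.{u}} {G : Type v} [Group G] [Fintype G]

/-- The mean of the translates of a cochain. -/
def mean (A : G → (K ⟶ K)) (n : ℕ) : Cochain K n →ₗ[ℚ] Cochain K n :=
  (Fintype.card G : ℚ)⁻¹ • ∑ g, cochainMap (A g) n

omit [Group G] in
theorem coboundary_mean (A : G → (K ⟶ K)) (n : ℕ) (f : Cochain K n) :
    coboundary K n (mean A n f) = mean A (n + 1) (coboundary K n f) := by
  simp only [mean, LinearMap.smul_apply, LinearMap.sum_apply, map_smul, map_sum,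
    coboundary_cochainMap]

theorem mean_of_invariant {A : G → (K ⟶ K)} {n : ℕ} {f : Cochain K n}
    (hf : ∀ g, cochainMap (A g) n f = f) : mean A n f = f := by
  have h0 : (Fintype.card G : ℚ) ≠ 0 := Nat.cast_ne_zero.2 Fintype.card_ne_zero
  simp only [mean, LinearMap.smul_apply, LinearMap.sum_apply, hf, Finset.sum_const,
    Finset.card_univ]
  rw [← Nat.cast_smul_eq_nsmul ℚ, smul_smul, inv_mul_cancel₀ h0, one_smul]

theorem cls_mean {A : G → (K ⟶ K)} {n : ℕ} {f : cocycles K n}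
    (hf : ∀ g, sPullback (A g) n (cls K n f) = cls K n f) {f' : cocycles K n}
    (h : (f' : Cochain K n) = mean A n f) : cls K n f' = cls K n f := by
  have h0 : (Fintype.card G : ℚ) ≠ 0 := Nat.cast_ne_zero.2 Fintype.card_ne_zero
  have e : f' = (Fintype.card G : ℚ)⁻¹ • ∑ g, ((cochainMap (A g) n).restrict
      fun _ hf => cochainMap_mem_cocycles (A g) hf) f := by
    refine Subtype.ext ?_
    rw [h, mean, LinearMap.smul_apply, LinearMap.sum_apply, Submodule.coe_smul, Submodule.coe_sum]
    rfl
  rw [e, map_smul, map_sum]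
  refine (congrArg _ (Finset.sum_congr rfl fun g _ => hf g)).trans ?_
  rw [Finset.sum_const,
    Finset.card_univ, ← Nat.cast_smul_eq_nsmul ℚ, smul_smul, inv_mul_cancel₀ h0, one_smul]

variable {F : K ⟶ L} {A : G → (K ⟶ K)}
  (hA : ∀ g h n σ, (A g).app (op (SimplexCategory.mk n)) ((A h).app (op (SimplexCategory.mk n)) σ) =
    (A (g * h)).app (op (SimplexCategory.mk n)) σ)
  (hF : ∀ n, Function.Surjective (F.app (op (SimplexCategory.mk n))))
  (hfib : ∀ n σ τ, F.app (op (SimplexCategory.mk n)) σ = F.app (op (SimplexCategory.mk n)) τ ↔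
    ∃ g, (A g).app (op (SimplexCategory.mk n)) σ = τ)

include hA in
theorem cochainMap_mean (g : G) {n : ℕ} (f : Cochain K n) :
    cochainMap (A g) n (mean A n f) = mean A n f := by
  simp only [mean, LinearMap.smul_apply, LinearMap.sum_apply, map_smul, map_sum]
  congr 1
  refine Fintype.sum_equiv (Equiv.mulRight g) _ _ fun h => funext fun σ => ?_
  exact congrArg f (hA h g n σ)

include hF in
theorem cochainMap_injective (n : ℕ) : Function.Injective (cochainMap F n) := fun f f' h =>
  funext fun τ => by
    obtain ⟨σ, rfl⟩ := hF n τ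
    exact congrFun h σ

-- The simplices of the quotient are the orbits, so an invariant cochain takes a well-defined value
-- on any preimage.
omit [Group G] [Fintype G] in
include hF hfib in
theorem exists_cochainMap_eq {n : ℕ} {f : Cochain K n} (hf : ∀ g, cochainMap (A g) n f = f) :
    ∃ f', cochainMap F n f' = f := by
  refine ⟨fun τ => f (hF n τ).choose, funext fun σ => ?_⟩
  obtain ⟨g, hg⟩ := (hfib n _ σ).1 (hF n (F.app _ σ)).choose_spec
  exact (congrFun (hf g) _).symm.trans (congrArg f hg)

omit [Group G] [Fintype G] in
include hfib in
theorem cochainMap_cochainMap (g : G) {n : ℕ} (f : Cochain L n) :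
    cochainMap (A g) n (cochainMap F n f) = cochainMap F n f :=
  funext fun σ => congrArg f ((hfib n σ _).2 ⟨g, rfl⟩).symm

include hA hF hfib

/-- If a pulled back cocycle is a coboundary, the mean of a primitive is a primitive of the same
cocycle, as that is invariant, and it descends. -/
theorem sPullback_injective (n : ℕ) : Function.Injective (sPullback F n) := by
  rw [injective_iff_map_eq_zero]
  intro y hy
  obtain ⟨f, rfl⟩ := cls_surjective _ _ y
  have h : cochainMap F n (f : Cochain L n) ∈ coboundaries K n := cls_eq_zero.1 hy
  rw [cls_eq_zero]
  cases n with
  | zero =>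
    refine (Submodule.mem_bot ℚ).2 (cochainMap_injective hF 0 ?_)
    rw [map_zero]
    exact (Submodule.mem_bot ℚ).1 h
  | succ n =>
    obtain ⟨w, hw⟩ := h
    obtain ⟨w', hw'⟩ := exists_cochainMap_eq hF hfib fun g => cochainMap_mean hA g w
    refine ⟨w', cochainMap_injective hF _ ?_⟩
    rw [← coboundary_cochainMap, hw', coboundary_mean, hw,
      mean_of_invariant fun g => cochainMap_cochainMap hfib g _]

/-- Averaging an invariant class does not change it, and the averaged cocycle descends to the
quotient. -/
theorem mem_range_sPullback {n : ℕ} {y : SCohomology K n} :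
    y ∈ LinearMap.range (sPullback F n) ↔ ∀ g, sPullback (A g) n y = y := by
  constructor
  · rintro ⟨x, rfl⟩ g
    obtain ⟨f, rfl⟩ := cls_surjective _ _ x
    exact congrArg (cls K n) (Subtype.ext (cochainMap_cochainMap hfib g _))
  · intro h
    obtain ⟨f, rfl⟩ := cls_surjective _ _ y
    obtain ⟨w, hw⟩ := exists_cochainMap_eq hF hfib fun g => cochainMap_mean hA g (f : Cochain K n)
    have hwc : w ∈ cocycles L n := by
      rw [mem_cocycles, ← map_eq_zero_iff _ (cochainMap_injective hF _), ← coboundary_cochainMap, hw,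
        coboundary_mean, mem_cocycles.1 f.2, map_zero]
    exact ⟨cls L n ⟨w, hwc⟩, cls_mean h hw⟩

end simplicial

/-! ### Free quotients are coverings, so singular simplices lift -/

section topological

variable {G : Type v} [Group G] [Finite G] {X S : Type u} [TopologicalSpace X] [TopologicalSpace S]
  [T2Space X] [LocallyCompactSpace X] [MulAction G X] [ContinuousConstSMul G X] {π : C(X, S)}
  (hπ : IsLocalHomeomorph π) (hs : Function.Surjective π)
  (hfree : ∀ (g : G) (x : X), g • x = x → g = 1) (hfib : ∀ x y, π x = π y ↔ ∃ g : G, g • x = y)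

/-- Translation by a group element. -/
def translation (X : Type u) [TopologicalSpace X] [MulAction G X] [ContinuousConstSMul G X] (g : G) :
    C(X, X) := ⟨fun x => g • x, continuous_const_smul g⟩

include hπ hs hfree hfib

theorem isCoveringMap : IsCoveringMap π := by
  have : IsCancelSMul G X := isCancelSMul_iff_eq_one_of_smul_eq.2 hfree
  refine ((hπ.isOpenMap.isQuotientMap π.continuous hs).isQuotientCoveringMap_of_properlyDiscontinuousSMul
    (G := G) fun {x y} => ?_).isCoveringMap
  rw [eq_comm, hfib]
  rfl

/-- A simplex is simply connected and locally path connected, so it lifts through the covering. -/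
theorem simplex_surjective (n : ℕ) : Function.Surjective
    ((TopCat.toSSet.map (TopCat.ofHom π)).app (op (SimplexCategory.mk n))) := by
  intro τ
  obtain ⟨x, hx⟩ := hs (Sing.simpEquiv S n τ (Sing.vert n 0))
  obtain ⟨σ, ⟨-, hσ⟩, -⟩ := (isCoveringMap hπ hs hfree hfib).existsUnique_continuousMap_lifts
    (Sing.simpEquiv S n τ) (Sing.vert n 0) x hx
  refine ⟨(Sing.simpEquiv X n).symm σ, (Sing.simpEquiv S n).injective ?_⟩
  rw [Sing.simpEquiv_map, Equiv.apply_symm_apply]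
  exact ContinuousMap.coe_injective hσ

/-- Two lifts of one simplex agree after the translation that matches them at a vertex, by
uniqueness of lifts. -/
theorem simplex_eq_iff (n : ℕ) (σ τ : (singularSet X).obj (op (SimplexCategory.mk n))) :
    (TopCat.toSSet.map (TopCat.ofHom π)).app (op (SimplexCategory.mk n)) σ =
      (TopCat.toSSet.map (TopCat.ofHom π)).app (op (SimplexCategory.mk n)) τ ↔
    ∃ g : G, (TopCat.toSSet.map (TopCat.ofHom (translation X g))).app
      (op (SimplexCategory.mk n)) σ = τ := by
  rw [← (Sing.simpEquiv S n).injective.eq_iff, Sing.simpEquiv_map, Sing.simpEquiv_map]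
  simp only [← (Sing.simpEquiv X n).injective.eq_iff, Sing.simpEquiv_map]
  constructor
  · intro h
    obtain ⟨g, hg⟩ := (hfib _ _).1 (DFunLike.congr_fun h (Sing.vert n 0))
    refine ⟨g, ContinuousMap.coe_injective ((isCoveringMap hπ hs hfree hfib).eq_of_comp_eq
      (ContinuousMap.continuous _) (ContinuousMap.continuous _) ?_ (Sing.vert n 0) hg)⟩
    rw [← ContinuousMap.coe_comp, ← ContinuousMap.coe_comp, ← h]
    ext t
    exact ((hfib _ _).2 ⟨g, rfl⟩).symm
  · rintro ⟨g, hg⟩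
    rw [← hg]
    ext t
    exact (hfib _ _).2 ⟨g, rfl⟩

theorem pullback_injective (n : ℕ) : Function.Injective (pullback n π) := by
  have := Fintype.ofFinite G
  exact sPullback_injective (A := fun g : G => TopCat.toSSet.map (TopCat.ofHom (translation X g)))
    (fun g h n σ => (Sing.simpEquiv X n).injective (ContinuousMap.ext fun t => smul_smul g h _))
    (simplex_surjective hπ hs hfree hfib) (simplex_eq_iff hπ hs hfree hfib) n

theorem mem_range_pullback {n : ℕ} {y : H n X} :
    y ∈ LinearMap.range (pullback n π) ↔ ∀ g : G, pullback n (translation X g) y = y := by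
  have := Fintype.ofFinite G
  exact mem_range_sPullback
    (A := fun g : G => TopCat.toSSet.map (TopCat.ofHom (translation X g)))
    (fun g h n σ => (Sing.simpEquiv X n).injective (ContinuousMap.ext fun t => smul_smul g h _))
    (simplex_surjective hπ hs hfree hfib) (simplex_eq_iff hπ hs hfree hfib)

end topological

end Transfer

/-! ### The second cohomology of a surface isogenous to a product -/

namespace RatCohomology

open Kunneth Transfer

theorem sPullback_sCup {K L : SSet.{u}} (F : K ⟶ L) {p q n : ℕ} (h : p + q = n)
    (a : SCohomology L p) (b : SCohomology L q) :
    sPullback F n (sCup L h a b) = sCup K h (sPullback F p a) (sPullback F q b) := by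
  obtain ⟨f, rfl⟩ := cls_surjective _ _ a
  obtain ⟨g, rfl⟩ := cls_surjective _ _ b
  refine congrArg (cls K n) (Subtype.ext (funext fun σ => ?_))
  change f.1 (L.map (front h).op (F.app _ σ)) * g.1 (L.map (back h).op (F.app _ σ)) =
    f.1 (F.app _ (K.map (front h).op σ)) * g.1 (F.app _ (K.map (back h).op σ))
  rw [NatTrans.naturality_apply, NatTrans.naturality_apply]

section product

variable {X Y : Type u} [TopologicalSpace X] [TopologicalSpace Y]

theorem pullback_cross {k : C(X × Y, X × Y)} {f : C(X, X)} {g : C(Y, Y)}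
    (hk : ∀ z, k z = (f z.1, g z.2)) {p q n : ℕ} (h : p + q = n) (t : H p X ⊗[ℚ] H q Y) :
    pullback n k (cross h t) = cross h (TensorProduct.map (pullback p f) (pullback q g) t) := by
  have h1 : ContinuousMap.fst.comp k = f.comp ContinuousMap.fst :=
    ContinuousMap.ext fun z => congrArg Prod.fst (hk z)
  have h2 : ContinuousMap.snd.comp k = g.comp ContinuousMap.snd :=
    ContinuousMap.ext fun z => congrArg Prod.snd (hk z)
  suffices e : pullback n k ∘ₗ cross h =
      cross h ∘ₗ TensorProduct.map (pullback p f) (pullback q g) from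
    congrArg (fun T => T t) e
  refine TensorProduct.ext' fun a b => ?_
  have e1 := congrArg (fun T => T a) (congrArg (pullback p) h1)
  have e2 := congrArg (fun T => T b) (congrArg (pullback q) h2)
  simp only [pullback_comp, LinearMap.comp_apply] at e1 e2
  refine (sPullback_sCup _ h _ _).trans ?_
  exact congrArg₂ (fun a b => sCup _ h a b) e1 e2

variable (X Y) in
theorem simplex_prod_bijective (n : ℕ) : Function.Bijective
    fun w : (singularSet (X × Y)).obj (op (SimplexCategory.mk n)) =>
      ((TopCat.toSSet.map (TopCat.ofHom (ContinuousMap.fst : C(X × Y, X)))).app _ w,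
        (TopCat.toSSet.map (TopCat.ofHom (ContinuousMap.snd : C(X × Y, Y)))).app _ w) := by
  constructor
  · intro w w' h
    have h1 := congrArg (Sing.simpEquiv X n) (congrArg Prod.fst h)
    have h2 := congrArg (Sing.simpEquiv Y n) (congrArg Prod.snd h)
    exact (Sing.simpEquiv (X × Y) n).injective (ContinuousMap.ext fun t =>
      Prod.ext (DFunLike.congr_fun h1 t) (DFunLike.congr_fun h2 t))
  · rintro ⟨a, b⟩
    refine ⟨(Sing.simpEquiv (X × Y) n).symm ((Sing.simpEquiv X n a).prodMk (Sing.simpEquiv Y n b)),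
      Prod.ext ((Sing.simpEquiv X n).injective ?_) ((Sing.simpEquiv Y n).injective ?_)⟩
    · dsimp only
      rw [Sing.simpEquiv_map, Equiv.apply_symm_apply]
      rfl
    · dsimp only
      rw [Sing.simpEquiv_map, Equiv.apply_symm_apply]
      rfl

variable (X Y) in
/-- The sum of the cross products in degree two. -/
noncomputable def crossTwo : IsogenousToProduct.U X Y × (H 1 X ⊗[ℚ] H 1 Y) →ₗ[ℚ] H 2 (X × Y) :=
  ((cross (p := 2) (q := 0) rfl).coprod (cross (p := 0) (q := 2) rfl)).coprod
    (cross (p := 1) (q := 1) rfl)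

theorem crossTwo_bijective (B : HBasis (singularSet Y)) : Function.Bijective (crossTwo X Y) :=
  ⟨kunnethTwo_injective (simplex_prod_bijective X Y) B,
    kunnethTwo_surjective (simplex_prod_bijective X Y) B⟩

theorem pullback_crossTwo [PathConnectedSpace X] [PathConnectedSpace Y] {k : C(X × Y, X × Y)}
    {f : C(X, X)} {g : C(Y, Y)} (hk : ∀ z, k z = (f z.1, g z.2)) (hf : pullback 2 f = LinearMap.id)
    (hg : pullback 2 g = LinearMap.id) (t : IsogenousToProduct.U X Y × (H 1 X ⊗[ℚ] H 1 Y)) :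
    pullback 2 k (crossTwo X Y t) =
      crossTwo X Y (t.1, TensorProduct.map (pullback 1 f) (pullback 1 g) t.2) := by
  simp only [crossTwo, LinearMap.coprod_apply, map_add, pullback_cross hk, hf, hg,
    Sing.pullback_zero, TensorProduct.map_id, LinearMap.id_apply]

end product

end RatCohomology

-- Künneth coordinates are unique and the group moves only the H¹ ⊗ H¹ coordinate, so a class is
-- invariant exactly when that coordinate is.
open RatCohomology Transfer in
theorem IsogenousToProduct.range_crossUZ {G : Type v} [Group G] {C D : Type u} [TopologicalSpace C]
    [TopologicalSpace D] [PathConnectedSpace C] [PathConnectedSpace D] [MulAction G C]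
    [ContinuousConstSMul G C] [MulAction G D] [ContinuousConstSMul G D]
    (B : Kunneth.HBasis (singularSet D))
    (hC : ∀ g : G, pullback 2 (translation C g) = LinearMap.id)
    (hD : ∀ g : G, pullback 2 (translation D g) = LinearMap.id) (y : H 2 (C × D)) :
    y ∈ LinearMap.range (crossUZ G C D) ↔
      ∀ g : G, pullback 2 (translation (C × D) g) y = y := by
  obtain ⟨⟨u, z⟩, rfl⟩ := (crossTwo_bijective B).2 y
  have h : crossTwo C D (u, z) ∈ LinearMap.range (crossUZ G C D) ↔ z ∈ Z G C D := by
    constructor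
    · rintro ⟨⟨u', z'⟩, h⟩
      have h' : crossTwo C D (u', (z' : H 1 C ⊗[ℚ] H 1 D)) = crossTwo C D (u, z) := h
      have e := (crossTwo_bijective B).1 h'
      have e2 : (z' : H 1 C ⊗[ℚ] H 1 D) = z := congrArg Prod.snd e
      exact e2 ▸ z'.2
    · exact fun hz => ⟨(u, ⟨z, hz⟩), rfl⟩
  -- The representation lets g act by the pullback along its inverse, so the quantifier is reindexed
  -- by inversion.
  rw [h, Representation.mem_invariants, ← (Equiv.inv G).forall_congr_right]
  refine forall_congr' fun g => ?_
  rw [pullback_crossTwo (k := translation (C × D) g) (f := translation C g) (g := translation D g)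
    (fun _ => rfl) (hC g) (hD g), (crossTwo_bijective B).1.eq_iff, Prod.mk.injEq,
    and_iff_right rfl]
  have e : ((action G 1 C).tprod (action G 1 D)) ((Equiv.inv G) g) =
      TensorProduct.map (pullback 1 (translation C g)) (pullback 1 (translation D g)) := by
    change TensorProduct.map (pullback 1 (translation C (g⁻¹)⁻¹))
      (pullback 1 (translation D (g⁻¹)⁻¹)) = _
    rw [inv_inv]
  rw [e]

theorem mainTheorem7 {G : Type v} [Group G] [Finite G] {C D S : Type u}
    [TopologicalSpace C] [T2Space C] [CompactSpace C] [ConnectedSpace C]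
    [ChartedSpace ℂ C] [IsManifold 𝓘(ℂ) ω C]
    [TopologicalSpace D] [T2Space D] [CompactSpace D] [ConnectedSpace D]
    [ChartedSpace ℂ D] [IsManifold 𝓘(ℂ) ω D]
    [TopologicalSpace S] [ChartedSpace (ℂ × ℂ) S] [IsManifold 𝓘(ℂ, ℂ × ℂ) ω S]
    [MulAction G C] [ContinuousConstSMul G C] [MulAction G D] [ContinuousConstSMul G D]
    (π : C(C × D, S)) (hπ : IsogenousToProduct.IsUnmixedHigherQuotient G π) :
    Module.finrank ℚ (IsogenousToProduct.U C D) = 2 ∧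
      ∃ e : RatCohomology.H 2 S ≃ₗ[ℚ] IsogenousToProduct.U C D × IsogenousToProduct.Z G C D,
        ∀ x : RatCohomology.H 2 S,
          RatCohomology.pullback 2 π x = IsogenousToProduct.crossUZ G C D (e x) := by
  have : LocallyPathConnectedSpace C := ChartedSpace.locallyPathConnectedSpace ℂ C
  have : LocallyPathConnectedSpace D := ChartedSpace.locallyPathConnectedSpace ℂ D
  have : PathConnectedSpace C := pathConnectedSpace_iff_connectedSpace.2 inferInstance
  have : PathConnectedSpace D := pathConnectedSpace_iff_connectedSpace.2 inferInstance
  constructor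
  · have h1 := Sing.finrank_zero C
    have h2 := Sing.finrank_zero D
    have h3 := Sing.finrank_two C
    have h4 := Sing.finrank_two D
    have : Module.Finite ℚ (RatCohomology.H 0 C) := Module.finite_of_finrank_pos (by omega)
    have : Module.Finite ℚ (RatCohomology.H 0 D) := Module.finite_of_finrank_pos (by omega)
    have : Module.Finite ℚ (RatCohomology.H 2 C) := Module.finite_of_finrank_pos (by omega)
    have : Module.Finite ℚ (RatCohomology.H 2 D) := Module.finite_of_finrank_pos (by omega)
    rw [Module.finrank_prod, Module.finrank_tensorProduct, Module.finrank_tensorProduct, h1, h2, h3,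
      h4]
  -- Only D needs finite-dimensional cohomology; its genus is half the first Betti number, which is
  -- therefore positive.
  · obtain ⟨B⟩ := Sing.nonempty_hBasis_of_genus D (by
      have := hπ.two_le_genus_right
      rw [IsogenousToProduct.genus] at this
      omega)
    have hC : ∀ g : G, RatCohomology.pullback 2 (Transfer.translation C g) = LinearMap.id := fun g =>
      Sing.pullback_two C _ (Transfer.translation C g⁻¹) (hπ.holomorphic_left g)
        (hπ.holomorphic_left g⁻¹) (inv_smul_smul g) (smul_inv_smul g)
    have hD : ∀ g : G, RatCohomology.pullback 2 (Transfer.translation D g) = LinearMap.id := fun g =>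
      Sing.pullback_two D _ (Transfer.translation D g⁻¹) (hπ.holomorphic_right g)
        (hπ.holomorphic_right g⁻¹) (inv_smul_smul g) (smul_inv_smul g)
    have hloc := hπ.locally_biholomorphic.isLocalHomeomorph
    -- Both ranges are the space of invariant classes on C × D.
    have hr : LinearMap.range (RatCohomology.pullback 2 π) =
        LinearMap.range (IsogenousToProduct.crossUZ G C D) := by
      ext y
      rw [IsogenousToProduct.range_crossUZ B hC hD,
        Transfer.mem_range_pullback hloc hπ.surjective hπ.free hπ.fibres]
    have hi : Function.Injective (IsogenousToProduct.crossUZ G C D) := by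
      have := (RatCohomology.crossTwo_bijective (X := C) B).1.comp
        (Function.injective_id.prodMap (IsogenousToProduct.Z G C D).subtype_injective)
      exact this
    refine ⟨(LinearEquiv.ofInjective _
      (Transfer.pullback_injective hloc hπ.surjective hπ.free hπ.fibres 2)).trans
      ((LinearEquiv.ofEq _ _ hr).trans (LinearEquiv.ofInjective _ hi).symm), fun x => ?_⟩
    rw [LinearEquiv.trans_apply, LinearEquiv.trans_apply, ← LinearEquiv.ofInjective_apply (h := hi),
      LinearEquiv.apply_symm_apply]
    rfl
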